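/- **Setting.** Let $\mathcal H_s,\mathcal H_b$ be complex Hilbert spaces and $\mathcal H=\mathcal H_s\otimes\mathcal H_b$ their Hilbert space tensor product. Let $H_s$, $H_b$ be (possibly unbounded) self-adjoint operators on $\mathcal H_s$, $\mathcal H_b$, and let $e^{-\beta H_b}$ be trace class, i.e. $H_b$ has an orthonormal basis of eigenvectors $e_k$ with eigenvalues $E_k$ and $Z_b=\sum_k e^{-\beta E_k}<\infty$; put $\rho_b=Z_b^{-1}e^{-\beta H_b}$. Let $\rho_s$ be a density operator on $\mathcal H_s$, $\rho(0)=\rho_s\otimes\rho_b$, let $O_s$ and $W_s=W_s^*$ be bounded operators on $\mathcal H_s$, and put $O=O_s\otimes\mathrm{Id}_b$, $\mathring W=W_s\otimes\mathrm{Id}_b$. Let $W_b$ and $\widetilde W_b$ be (possibly unbounded) symmetric operators on $\mathcal H_b$, each given on a subspace that contains all $e_k$ and is invariant under the operator itself and under all $e^{-isH_b}$, $s\in\mathbb R$. Assume that $H_s\otimes\mathrm{Id}_b+\mathrm{Id}_s\otimes H_b+W_s\otimes W_b$ is essentially self-adjoint on the algebraic tensor product of the domain of $H_s$ with the intersection of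 the domains of $H_b$ and $W_b$, and let $H$ be its closure. Fix $t$. For a self-adjoint $K$ and an operator $P$, the unfolded propagator is, for $r_{\mathrm i}\le r_{\mathrm f}$, $$G_{K,P}(r_{\mathrm f},r_{\mathrm i})=\begin{cases}e^{-i(r_{\mathrm f}-r_{\mathrm i})K},& r_{\mathrm f}<t,\\ e^{i(r_{\mathrm f}-r_{\mathrm i})K},& t\le r_{\mathrm i},\\ e^{i(r_{\mathrm f}-t)K}\,P\,e^{-i(t-r_{\mathrm i})K},& r_{\mathrm i}<t\le r_{\mathrm f}.\end{cases}$$ Put $G_s=G_{H_s,O_s}$, $G_b=G_{H_b,\mathrm{Id}_b}$, $G=G_{H,O}$. For $\boldsymbol s=(s_m,\dots,s_1)$ with $s_m>\dots>s_1$ put $$\mathcal U_s(s_{\mathrm f},\boldsymbol s,s_{\mathrm i})=G_s(s_{\mathrm f},s_m)W_sG_s(s_m,s_{m-1})W_s\cdots W_sG_s(s_1,s_{\mathrm i}),$$ $$\mathring{\mathcal U}(s_{\mathrm f},\boldsymbol s,s_{\mathrm i})=G(s_{\mathrm f},s_m)\mathring WG(s_m,s_{m-1})\mathring W\cdots\mathring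 WG(s_1,s_{\mathrm i}),$$ and let $\#\{\boldsymbol s<t\}$ be the number of $j$ with $s_j<t$. Let $\mathcal Q(\boldsymbol s)$ be the set of all partitions $\mathfrak q$ of $\{s_1,\dots,s_m\}$ into ordered pairs $(\tau_1,\tau_2)$, $\tau_1<\tau_2$, and $\mathcal L_B(\mathfrak q)=\prod_{(\tau_1,\tau_2)\in\mathfrak q}B(\tau_1,\tau_2)$, with $\mathcal L_B(\emptyset)=1$. The bath correlation function of $W_b$ is $$B(\tau_1,\tau_2)=\mathrm{tr}_b\big(\rho_bG_b(2t,\tau_2)W_bG_b(\tau_2,\tau_1)W_bG_b(\tau_1,0)\big),\qquad 0\le\tau_1\le\tau_2\le2t,$$ $\widetilde B$ is the same with $\widetilde W_b$ in place of $W_b$, and $\Delta B=\widetilde B-B$. Traces $\mathrm{tr}_b(\rho_b\,\cdot\,)$ of unbounded operators are computed in the basis $(e_k)$. Assume Wick's theorem for $W_b$: for all $m\ge0$ and $2t>s_m>\dots>s_1>0$ the trace $\mathrm{tr}_b(\rho_bG_b(2t,s_m)W_bG_b(s_m,s_{m-1})W_b\cdots W_bG_b(s_1,0))$ converges absolutely,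 is $0$ for odd $m$, and equals $\sum_{\mathfrak q\in\mathcal Q(\boldsymbol s)}\mathcal L_B(\mathfrak q)$ for even $m$; and likewise for $\widetilde W_b$, $\widetilde B$. **Theorem.** Assume that $B$ and $\widetilde B$ are bounded. Let $0\le s_{\mathrm i}\le s_{\mathrm f}$ with $s_{\mathrm i}+s_{\mathrm f}=2t$ (for instance $s_{\mathrm i}=0$, $s_{\mathrm f}=2t$). Then $$\sum_{\substack{m\ge0\\ m\text{ even}}} i^m\int_{s_{\mathrm f}>s_m>\dots>s_1>s_{\mathrm i}}(-1)^{\#\{\boldsymbol s<t\}}\,\mathrm{tr}_s\big(\rho_s\,\mathcal U_s(s_{\mathrm f},\boldsymbol s,s_{\mathrm i})\big)\sum_{\mathfrak q\in\mathcal Q(\boldsymbol s)}\big(\mathcal L_{\widetilde B}(\mathfrak q)-\mathcal L_B(\mathfrak q)\big)\,ds_1\cdots ds_m$$ $$=\sum_{\substack{m\ge2\\ m\text{ even}}} i^m\int_{s_{\mathrm f}>s_m>\dots>s_1>s_{\mathrm i}}(-1)^{\#\{\boldsymbol s<t\}}\,\mathrm{tr}\big(\rho(0)\,\mathring{\mathcal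 U}(s_{\mathrm f},\boldsymbol s,s_{\mathrm i})\big)\sum_{\mathfrak q\in\mathcal Q(\boldsymbol s)}\mathcal L_{\Delta B}(\mathfrak q)\,ds_1\cdots ds_m,$$ where all integrals and both series converge absolutely (the series of the integrals of the absolute values of the integrands converge). -/

import Mathlib

open scoped TensorProduct InnerProductSpace

noncomputable section

/-! ### Hilbert space preliminaries -/

/-- The Hilbert space tensor product: the completion of the algebraic tensor product with
respect to the inner product `⟪x ⊗ y, x' ⊗ y'⟫ = ⟪x, x'⟫ * ⟪y, y'⟫`. -/
abbrev HilbertTensor (E F : Type*) [NormedAddCommGroup E] [InnerProductSpace ℂ E]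
    [NormedAddCommGroup F] [InnerProductSpace ℂ F] : Type _ :=
  UniformSpace.Completion (E ⊗[ℂ] F)

/-- The elementary tensor `x ⊗ y` in the Hilbert space tensor product. -/
def elemTensor {E F : Type*} [NormedAddCommGroup E] [InnerProductSpace ℂ E]
    [NormedAddCommGroup F] [InnerProductSpace ℂ F] (x : E) (y : F) : HilbertTensor E F :=
  ((x ⊗ₜ[ℂ] y : E ⊗[ℂ] F) : UniformSpace.Completion (E ⊗[ℂ] F))

/-- The bounded operator `A ⊗ B` on the Hilbert space tensor product. -/
def tensorOp {E F : Type*} [NormedAddCommGroup E] [InnerProductSpace ℂ E]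
    [NormedAddCommGroup F] [InnerProductSpace ℂ F] (A : E →L[ℂ] E) (B : F →L[ℂ] F) :
    HilbertTensor E F →L[ℂ] HilbertTensor E F :=
  (TensorProduct.mapL A B).completion

/-- The trace `∑ i, ⟪b i, T (b i)⟫` over a Hilbert basis `b` (for trace class `T` the value does
not depend on the basis). -/
def hilbertTrace {E : Type*} [NormedAddCommGroup E] [InnerProductSpace ℂ E] [CompleteSpace E]
    (T : E →L[ℂ] E) : ℂ :=
  ∑' i : (exists_hilbertBasis ℂ E).choose,
    ⟪(exists_hilbertBasis ℂ E).choose_spec.choose i,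
      T ((exists_hilbertBasis ℂ E).choose_spec.choose i)⟫_ℂ

/-- A density operator: positive with trace one. (A divergent trace is assigned the value `0`,
so `hilbertTrace ρ = 1` includes that the trace converges.) -/
def IsDensity {E : Type*} [NormedAddCommGroup E] [InnerProductSpace ℂ E] [CompleteSpace E]
    (ρ : E →L[ℂ] E) : Prop :=
  ρ.IsPositive ∧ hilbertTrace ρ = 1

/-- A (possibly unbounded) self-adjoint operator `op = H` together with the strongly continuous
unitary group `evol s = exp (-i s H)` that it generates. The last field says that `-i H` is the
infinitesimal generator of `evol`, which determines `evol` from `op` and conversely. -/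
structure Hamiltonian (E : Type*) [NormedAddCommGroup E] [InnerProductSpace ℂ E]
    [CompleteSpace E] where
  op : E →ₗ.[ℂ] E
  isSelfAdjoint : IsSelfAdjoint op
  evol : ℝ → E →L[ℂ] E
  evol_unitary : ∀ s, evol s ∈ unitary (E →L[ℂ] E)
  evol_zero : evol 0 = 1
  evol_add : ∀ s r, evol (s + r) = evol s * evol r
  evol_continuous : ∀ x, Continuous fun s => evol s x
  mem_graph_iff : ∀ x y, (x, y) ∈ op.graph ↔
    HasDerivAt (fun s : ℝ => evol s x) (-(Complex.I • y)) 0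

/-! ### Time-ordered products on the unfolded Keldysh contour -/

/-- The propagator from time `i` to time `f` (`i ≤ f`) on the unfolded Keldysh contour `[0, 2t]`,
for the group `U s = exp (-i s H)` and an operator `O` inserted at time `t`:
`exp (-i (f - i) H)` for `i ≤ f < t`, `exp (i (f - i) H)` for `t ≤ i ≤ f`, and
`exp (i (f - t) H) O exp (-i (t - i) H)` for `i < t ≤ f`. -/
def keldyshPropagator {M : Type*} [Monoid M] (U : ℝ → M) (O : M) (t f i : ℝ) : M :=
  if f < t then U (f - i)
  else if t ≤ i then U (i - f)
  else U (t - f) * O * U (t - i)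

/-- `G(f, s_m) W G(s_m, s_{m-1}) W ⋯ W G(s_2, s_1) W G(s_1, i)`, where `s_1, …, s_m` are the
values of `s` in order. For `m = 0` this is `G(f, i)`. -/
def orderedChain {M : Type*} [Monoid M] (G : ℝ → ℝ → M) (W : M) (i : ℝ) :
    (m : ℕ) → (Fin m → ℝ) → ℝ → M
  | 0, _, f => G f i
  | m + 1, s, f =>
      G f (s (Fin.last m)) * W * orderedChain G W i m (Fin.init s) (s (Fin.last m))

/-- The domain `sf > s_m > ⋯ > s_1 > si`. -/
def timeSimplex (m : ℕ) (si sf : ℝ) : Set (Fin m → ℝ) :=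
  {s | StrictMono s ∧ ∀ i, s i ∈ Set.Ioo si sf}

/-- The sign `(-1) ^ #{s < t}`. -/
def contourSign {m : ℕ} (t : ℝ) (s : Fin m → ℝ) : ℂ :=
  (-1) ^ (Finset.univ.filter fun i => s i < t).card

/-- All ordered pairings of `m` time points: the sets of pairs `(j, k)` of indices with `j < k`
such that every index lies in exactly one pair. -/
def orderedPairings (m : ℕ) : Finset (Finset (Fin m × Fin m)) := by
  classical
  exact Finset.univ.filter fun q =>
    (∀ p ∈ q, p.1 < p.2) ∧ ∀ i, ∃! p, p ∈ q ∧ (p.1 = i ∨ p.2 = i)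

/-- `L_B(q) = ∏_{(τ₁, τ₂) ∈ q} B(τ₁, τ₂)`. -/
def pairingWeight {m : ℕ} (B : ℝ → ℝ → ℂ) (s : Fin m → ℝ) (q : Finset (Fin m × Fin m)) : ℂ :=
  ∏ p ∈ q, B (s p.1) (s p.2)

/-! ### The thermal bath and its couplings -/

/-- A bath Hamiltonian `H_b` and an inverse temperature `β` for which `exp (-β H_b)` is trace
class: `H_b` has an orthonormal basis of eigenvectors with `∑ exp (-β E_k) < ∞`. -/
structure ThermalBath (κ F : Type*) [NormedAddCommGroup F] [InnerProductSpace ℂ F]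
    [CompleteSpace F] where
  ham : Hamiltonian F
  eigenvector : HilbertBasis κ ℂ F
  energy : κ → ℝ
  eigen : ∀ k, (eigenvector k, (energy k : ℂ) • eigenvector k) ∈ ham.op.graph
  β : ℝ
  summable_boltzmann : Summable fun k => Real.exp (-(β * energy k))

namespace ThermalBath

variable {κ F : Type*} [NormedAddCommGroup F] [InnerProductSpace ℂ F] [CompleteSpace F]

/-- The partition function `Z_b = tr exp (-β H_b)`. -/
def partitionFn (bath : ThermalBath κ F) : ℝ :=
  ∑' k, Real.exp (-(bath.β * bath.energy k))

/-- The thermal state `ρ_b = Z_b⁻¹ exp (-β H_b)`, as the (norm convergent) sum of its spectral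
projections. -/
def state (bath : ThermalBath κ F) : F →L[ℂ] F :=
  ∑' k, ((Real.exp (-(bath.β * bath.energy k)) / bath.partitionFn : ℝ) : ℂ) •
    InnerProductSpace.rankOne ℂ (bath.eigenvector k) (bath.eigenvector k)

end ThermalBath

/-- A (possibly unbounded) symmetric bath coupling operator `W_b`, given on an invariant domain:
a subspace that contains the energy eigenvectors and is mapped into itself by `exp (-i s H_b)`
and by `W_b`. On this domain all products of propagators and `W_b` are defined. -/
structure BathCoupling {κ F : Type*} [NormedAddCommGroup F] [InnerProductSpace ℂ F]
    [CompleteSpace F] (bath : ThermalBath κ F) where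
  dom : Submodule ℂ F
  eigenvector_mem : ∀ k, bath.eigenvector k ∈ dom
  evol_mem : ∀ s, ∀ x ∈ dom, bath.ham.evol s x ∈ dom
  op : dom →ₗ[ℂ] dom
  symmetric : ∀ x y : dom, ⟪(op x : F), (y : F)⟫_ℂ = ⟪(x : F), (op y : F)⟫_ℂ

namespace BathCoupling

variable {κ F : Type*} [NormedAddCommGroup F] [InnerProductSpace ℂ F] [CompleteSpace F]
  {bath : ThermalBath κ F}

/-- `exp (-i s H_b)` restricted to the domain of the coupling. -/
def evol (V : BathCoupling bath) (s : ℝ) : Module.End ℂ V.dom :=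
  (bath.ham.evol s : F →ₗ[ℂ] F).restrict (V.evol_mem s)

/-- The bath propagator `G_b` on the unfolded contour (identity inserted at time `t`). -/
def propagator (V : BathCoupling bath) (t f i : ℝ) : Module.End ℂ V.dom :=
  keldyshPropagator V.evol 1 t f i

/-- The diagonal elements of `ρ_b A` in the energy eigenbasis. -/
def traceTerm (V : BathCoupling bath) (A : Module.End ℂ V.dom) (k : κ) : ℂ :=
  ⟪bath.eigenvector k,
    bath.state (A ⟨bath.eigenvector k, V.eigenvector_mem k⟩ : V.dom)⟫_ℂ

/-- `tr_b (ρ_b A)` for an operator `A` on the domain of the coupling. -/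
def thermalTrace (V : BathCoupling bath) (A : Module.End ℂ V.dom) : ℂ :=
  ∑' k, V.traceTerm A k

/-- The product `G_b(2t, s_m) W_b G_b(s_m, s_{m-1}) W_b ⋯ W_b G_b(s_1, 0)`. -/
def bathChain (V : BathCoupling bath) (t : ℝ) {m : ℕ} (s : Fin m → ℝ) : Module.End ℂ V.dom :=
  orderedChain (V.propagator t) V.op 0 m s (2 * t)

/-- The unfolded bath correlation function
`B(τ₁, τ₂) = tr_b (ρ_b G_b(2t, τ₂) W_b G_b(τ₂, τ₁) W_b G_b(τ₁, 0))`. -/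
def corr (V : BathCoupling bath) (t τ₁ τ₂ : ℝ) : ℂ :=
  V.thermalTrace
    (V.propagator t (2 * t) τ₂ * V.op * V.propagator t τ₂ τ₁ * V.op * V.propagator t τ₁ 0)

/-- Wick's theorem for the bath on the contour `[0, 2t]`: for all times `2t > s_m > ⋯ > s_1 > 0`
the trace `L_b(s)` converges, vanishes for odd `m`, and equals the sum of `L_B(q)` over all
ordered pairings `q` for even `m`. -/
def Wick (V : BathCoupling bath) (t : ℝ) : Prop :=
  ∀ (m : ℕ), ∀ s ∈ timeSimplex m 0 (2 * t),
    Summable (V.traceTerm (V.bathChain t s)) ∧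
    V.thermalTrace (V.bathChain t s) =
      if Even m then ∑ q ∈ orderedPairings m, pairingWeight (V.corr t) s q else 0

/-- Boundedness of the bath correlation function on `0 ≤ τ₁ ≤ τ₂ ≤ 2t`. -/
def BoundedCorr (V : BathCoupling bath) (t : ℝ) : Prop :=
  ∃ C : ℝ, ∀ τ₁ τ₂, 0 ≤ τ₁ → τ₁ ≤ τ₂ → τ₂ ≤ 2 * t → ‖V.corr t τ₁ τ₂‖ ≤ C

end BathCoupling

/-! ### The coupled system -/

section Coupled

variable {κ E F : Type*} [NormedAddCommGroup E] [InnerProductSpace ℂ E] [CompleteSpace E]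
  [NormedAddCommGroup F] [InnerProductSpace ℂ F] [CompleteSpace F]

/-- The graph of `H_s ⊗ Id + Id ⊗ H_b + W_s ⊗ W_b` on the algebraic tensor product of the domain
of `H_s` with the common domain of `H_b` and `W_b`. -/
def interactingGraph (Hs : Hamiltonian E) {bath : ThermalBath κ F} (V : BathCoupling bath)
    (Ws : E →L[ℂ] E) : Submodule ℂ (HilbertTensor E F × HilbertTensor E F) :=
  Submodule.span ℂ {p | ∃ (x : Hs.op.domain) (y : bath.ham.op.domain) (hy : (y : F) ∈ V.dom),
    p = (elemTensor (x : E) (y : F),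
      elemTensor (Hs.op x) (y : F) + elemTensor (x : E) (bath.ham.op y) +
        elemTensor (Ws x) (V.op ⟨y, hy⟩ : F))}

/-- `H` is the total Hamiltonian `H_s ⊗ Id + Id ⊗ H_b + W_s ⊗ W_b`, i.e. this operator is
essentially self-adjoint on its natural domain and `H` is its closure. -/
def IsTotalHamiltonian (Hs : Hamiltonian E) {bath : ThermalBath κ F} (V : BathCoupling bath)
    (Ws : E →L[ℂ] E) (H : Hamiltonian (HilbertTensor E F)) : Prop :=
  H.op.graph = (interactingGraph Hs V Ws).topologicalClosure

/-- The system factor `U_s(sf, s, si) = G_s(sf, s_m) W_s ⋯ W_s G_s(s_1, si)`. -/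
def systemChain (Hs : Hamiltonian E) (Ws Os : E →L[ℂ] E) (t si sf : ℝ) {m : ℕ}
    (s : Fin m → ℝ) : E →L[ℂ] E :=
  orderedChain (keldyshPropagator Hs.evol Os t) Ws si m s sf

/-- `Ů(sf, s, si) = G(sf, s_m) W̊ G(s_m, s_{m-1}) W̊ ⋯ W̊ G(s_1, si)`, where `G` is the propagator
of the total Hamiltonian with `O = O_s ⊗ Id` inserted at time `t`, and `W̊ = W_s ⊗ Id`. -/
def fullChain (H : Hamiltonian (HilbertTensor E F)) (Ws Os : E →L[ℂ] E) (t si sf : ℝ) {m : ℕ}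
    (s : Fin m → ℝ) : HilbertTensor E F →L[ℂ] HilbertTensor E F :=
  orderedChain (keldyshPropagator H.evol (tensorOp Os 1) t) (tensorOp Ws 1) si m s sf

/-- `(-1)^{#{s<t}} tr_s (ρ_s U_s(sf, s, si)) ∑_q (L_{B'}(q) - L_B(q))`. -/
def systemIntegrand (Hs : Hamiltonian E) (Ws Os ρs : E →L[ℂ] E) (B B' : ℝ → ℝ → ℂ)
    (t si sf : ℝ) (m : ℕ) (s : Fin m → ℝ) : ℂ :=
  contourSign t s * hilbertTrace (ρs * systemChain Hs Ws Os t si sf s) *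
    ∑ q ∈ orderedPairings m, (pairingWeight B' s q - pairingWeight B s q)

/-- `(-1)^{#{s<t}} tr (ρ(0) Ů(sf, s, si)) ∑_q L_D(q)` with `ρ(0) = ρ_s ⊗ ρ_b`. -/
def fullIntegrand (H : Hamiltonian (HilbertTensor E F)) (bath : ThermalBath κ F)
    (Ws Os ρs : E →L[ℂ] E) (D : ℝ → ℝ → ℂ) (t si sf : ℝ) (m : ℕ) (s : Fin m → ℝ) : ℂ :=
  contourSign t s *
    hilbertTrace (tensorOp ρs bath.state * fullChain H Ws Os t si sf s) *
    ∑ q ∈ orderedPairings m, pairingWeight D s q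

end Coupled

end

noncomputable section

/-! ### Functions of finite sets of times -/

/-! Both series are rewritten as integrals ∫ f(C) dC over finite sets C of times, with the measure
`confMeasure` that weights n-tuples by 1/n!, so that a set stands for its n! orderings. This measure
satisfies ∫∫ Φ(A, D) dA dD = ∫ Σ_{A ⊆ C} Φ(A, C \ A) dC (`integral_prod_times`), which is the engine
of the resummation.

Algebra. Since B̃ = ΔB + B, the pairing sum of B̃ over C is the sum over A ⊆ C of the pairing sum of
ΔB over A times that of B over C \ A (`pairSum_add`). The term A = ∅ is the pairing sum of B, so the
left side involves only nonempty A and becomes a double integral over A and D = C \ A. The phase i^m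
(-1)^{#} is multiplicative over disjoint unions. It remains to see that, for fixed A, integrating
phase(D) · tr_s(ρ_s U_s(A ∪ D)) · L_B(D) over D gives tr(ρ(0) Ů(A)). This is the Dyson expansion of
the full propagators in W_s ⊗ W_b, with the bath trace evaluated by Wick's theorem
(`fullTrace_eq_integral` together with `hasSum_fullTrace`).

Analysis. As W_b may be unbounded, the Dyson series is summed on vectors and not in operator norm.
Folding the contour at t turns every trace into a sum over initial vectors w_i ⊗ e_k of inner
products of two vectors, each evolved over [si, t] (`inner_orderedChain`, `integral_split_reflect`).
Let p_k be the thermal probabilities and T_B the time-ordered product of Heisenberg operators W_b at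
the times B, |B| = n. Wick's theorem at the times B and their reflections says that Σ_k p_k ‖T_B
e_k‖² is a pairing sum over 2n times, hence at most (2K)^n n! when |B(τ₁, τ₂)| ≤ K. So ‖T_B e_k‖
grows at most like the square root of y^n n!, and against the weight 1/n! the series of vectors
converges absolutely.

Its sum is a weak solution of the Schrödinger equation: all operators act on the test vector, so no
domain question arises for the sum (`partialDyson_weak_solution`). The test vectors span a core of
the self-adjoint H, which makes weak solutions unique (`Hamiltonian.eq_evol_of_weak_solution`).
Hence the sum is the evolution under H, and the insertions at A are added one at a time
(`dyson_series`). To exchange the sum over k with the integrals, Cauchy–Schwarz in k replaces the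
levelwise bound, which carries a factor 1/p_k (`BathCoupling.Wick.sum_norm_mul_le`).

Measurability is derived throughout: unbounded operators are tested against the countable
eigenbasis, and the correlation function is measurable because it is a two-time Wick sum. -/

/-- A family of functions of `m`-tuples, evaluated at the increasing enumeration of a finite set. -/
def onFinset {X : Type*} (F : (m : ℕ) → (Fin m → ℝ) → X) (A : Finset ℝ) : X :=
  F A.card (A.orderEmbOfFin rfl)

theorem onFinset_image {X : Type*} (F : (m : ℕ) → (Fin m → ℝ) → X) {m : ℕ} {s : Fin m → ℝ}
    (hs : StrictMono s) : onFinset F (Finset.univ.image s) = F m s := by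
  have hc : (Finset.univ.image s).card = m := by
    rw [Finset.card_image_of_injective _ hs.injective, Finset.card_univ, Fintype.card_fin]
  -- The cardinality becomes a variable `k`, so that substitution can remove the dependence of the
  -- tuple type on `A.card`.
  have key : ∀ (A : Finset ℝ) (k : ℕ) (h : A.card = k) (f : Fin k → ℝ), (∀ x, f x ∈ A) →
      StrictMono f → onFinset F A = F k f := by
    rintro A k rfl f hf hm
    rw [onFinset, Finset.orderEmbOfFin_unique rfl hf hm]
  exact key _ m hc s (fun x => Finset.mem_image_of_mem _ (Finset.mem_univ _)) hs

theorem image_univ_succ {m : ℕ} (s : Fin (m + 1) → ℝ) :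
    Finset.univ.image s = insert (s (Fin.last m)) (Finset.univ.image (Fin.init s)) := by
  ext x
  simp only [Finset.mem_image, Finset.mem_univ, true_and, Finset.mem_insert]
  constructor
  · rintro ⟨i, rfl⟩
    induction i using Fin.lastCases with
    | last => exact Or.inl rfl
    | cast i => exact Or.inr ⟨i, rfl⟩
  · rintro (rfl | ⟨i, rfl⟩)
    · exact ⟨_, rfl⟩
    · exact ⟨i.castSucc, rfl⟩

theorem strictMono_init {m : ℕ} {s : Fin (m + 1) → ℝ} (hs : StrictMono s) :
    StrictMono (Fin.init s) := fun _ _ h => hs (Fin.castSucc_lt_castSucc_iff.2 h)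

theorem lt_last_of_mem_image_init {m : ℕ} {s : Fin (m + 1) → ℝ} (hs : StrictMono s) :
    ∀ x ∈ Finset.univ.image (Fin.init s), x < s (Fin.last m) := by
  intro x hx
  obtain ⟨i, -, rfl⟩ := Finset.mem_image.1 hx
  exact hs (Fin.castSucc_lt_last i)

/-- The values of a tuple in the time simplex lie in the interval. -/
theorem mem_Ioo_of_mem_image {m : ℕ} {si sf : ℝ} {s : Fin m → ℝ} (hs : s ∈ timeSimplex m si sf) :
    ∀ x ∈ Finset.univ.image s, x ∈ Set.Ioo si sf := by
  intro x hx
  obtain ⟨i, -, rfl⟩ := Finset.mem_image.1 hx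
  exact hs.2 i

/-! ### Time-ordered products -/

section TimeProd

variable {M : Type*} [Monoid M]

/-- The product of `w x` over the times `x ∈ A`, later times to the left. -/
def timeProd (w : ℝ → M) (A : Finset ℝ) : M := ((A.sort (· ≥ ·)).map w).prod

@[simp] theorem timeProd_empty (w : ℝ → M) : timeProd w ∅ = 1 := by simp [timeProd]

theorem timeProd_insert_max (w : ℝ → M) {A : Finset ℝ} {a : ℝ} (h : ∀ x ∈ A, x < a) :
    timeProd w (insert a A) = w a * timeProd w A := by
  rw [timeProd, Finset.sort_insert (fun x y => x ≥ y) (fun b hb => (h b hb).le)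
    (fun ha => lt_irrefl _ (h a ha)), List.map_cons, List.prod_cons, timeProd]

theorem timeProd_insert_min (w : ℝ → M) {A : Finset ℝ} {a : ℝ} (h : ∀ x ∈ A, a < x) :
    timeProd w (insert a A) = timeProd w A * w a := by
  induction A using Finset.induction_on_max with
  | empty => simpa using timeProd_insert_max w (A := ∅) (a := a) (by simp)
  | insert b A hb ih =>
    have hab : a < b := h b (Finset.mem_insert_self _ _)
    rw [Finset.insert_comm, timeProd_insert_max, timeProd_insert_max w hb,
      ih fun x hx => h x (Finset.mem_insert_of_mem hx), mul_assoc]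
    intro x hx
    rcases Finset.mem_insert.1 hx with rfl | hx
    exacts [hab, hb x hx]

theorem timeProd_image_succ (w : ℝ → M) {m : ℕ} {s : Fin (m + 1) → ℝ} (hs : StrictMono s) :
    timeProd w (Finset.univ.image s) =
      w (s (Fin.last m)) * timeProd w (Finset.univ.image (Fin.init s)) := by
  rw [image_univ_succ, timeProd_insert_max w (lt_last_of_mem_image_init hs)]

/-- If `R` is compatible with reversing products, it relates the time-ordered product over the
reflected times to the time-ordered product of the reflected factors. -/
theorem timeProd_reflect {N : Type*} [Monoid N] (R : M → N → Prop) (h1 : R 1 1)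
    (hmul : ∀ a b c d, R a b → R c d → R (a * c) (d * b)) (w : ℝ → M) (w' : ℝ → N)
    (hw : ∀ x, R (w x) (w' x)) (c : ℝ) (A : Finset ℝ) :
    R (timeProd w (A.image fun x => c - x)) (timeProd (fun x => w' (c - x)) A) := by
  induction A using Finset.induction_on_max with
  | empty => simpa using h1
  | insert a A ha ih =>
    rw [Finset.image_insert, timeProd_insert_max _ ha, timeProd_insert_min]
    · exact hmul _ _ _ _ ih (hw _)
    · intro x hx
      obtain ⟨y, hy, rfl⟩ := Finset.mem_image.1 hx
      linarith [ha y hy]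

/-- The Heisenberg picture operator at time `x`. -/
def heisenberg (U : ℝ → M) (W : M) (x : ℝ) : M := U (-x) * W * U x

/-- Before the time `t` the ordered chain is a time-ordered product of Heisenberg operators. -/
theorem orderedChain_keldysh_lt {U : ℝ → M} (hU : ∀ a b, U (a + b) = U a * U b) (O W : M)
    {t i : ℝ} {m : ℕ} {s : Fin m → ℝ} (hs : StrictMono s) {f : ℝ} (hsf : ∀ j, s j < f)
    (hf : f < t) : orderedChain (keldyshPropagator U O t) W i m s f =
      U f * timeProd (heisenberg U W) (Finset.univ.image s) * U (-i) := by
  induction m generalizing f with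
  | zero => simp [orderedChain, keldyshPropagator, hf, ← hU, sub_eq_add_neg]
  | succ m ih =>
    rw [orderedChain, ih (strictMono_init hs) (fun j => hs (Fin.castSucc_lt_last j))
      ((hsf _).trans hf), timeProd_image_succ _ hs, keldyshPropagator, if_pos hf, sub_eq_add_neg,
      hU, heisenberg]
    simp only [mul_assoc]

/-- Past the time `t` the ordered chain is the product of an anti-time-ordered and a time-ordered
product of Heisenberg operators. -/
theorem orderedChain_keldysh_ge {U : ℝ → M} (hU : ∀ a b, U (a + b) = U a * U b) (O W : M)
    {t i : ℝ} (hi : i < t) {m : ℕ} {s : Fin m → ℝ} (hs : StrictMono s) {f : ℝ}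
    (hsf : ∀ j, s j < f) (hf : t ≤ f) : orderedChain (keldyshPropagator U O t) W i m s f =
      U (2 * t - f) * timeProd (fun x => heisenberg U W (2 * t - x))
          ((Finset.univ.image s).filter fun x => t ≤ x) * heisenberg U O t *
        timeProd (heisenberg U W) ((Finset.univ.image s).filter fun x => x < t) * U (-i) := by
  induction m generalizing f with
  | zero =>
    have h1 : U (t - f) = U (2 * t - f) * U (-t) := by rw [← hU]; congr 1; ring
    have h2 : U (t - i) = U t * U (-i) := by rw [← hU, sub_eq_add_neg]
    simp [orderedChain, keldyshPropagator, hf.not_gt, hi.not_ge, h1, h2, heisenberg, mul_assoc]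
  | succ m ih =>
    have hlt := lt_last_of_mem_image_init hs
    have hinit : ∀ j, Fin.init s j < s (Fin.last m) := fun j => hs (Fin.castSucc_lt_last j)
    rw [orderedChain, image_univ_succ]
    by_cases hl : t ≤ s (Fin.last m)
    -- On the backward branch real time runs backwards, so an insertion at contour time s is a
    -- Heisenberg operator at the reflected time 2t - s.
    · have h1 : U (s (Fin.last m) - f) = U (2 * t - f) * U (-(2 * t - s (Fin.last m))) := by
        rw [← hU]; congr 1; ring
      rw [ih (strictMono_init hs) hinit hl, Finset.filter_insert, if_pos hl, Finset.filter_insert,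
        if_neg hl.not_gt, timeProd_insert_max, keldyshPropagator, if_neg hf.not_gt, if_pos hl, h1,
        heisenberg.eq_1 U W (2 * t - s (Fin.last m))]
      · simp only [mul_assoc]
      · exact fun x hx => hlt x (Finset.mem_filter.1 hx).1
    · have hl' := not_le.1 hl
      have h1 : U (t - f) = U (2 * t - f) * U (-t) := by rw [← hU]; congr 1; ring
      have h4 : U (t - s (Fin.last m)) = U t * U (-s (Fin.last m)) := by
        rw [← hU, sub_eq_add_neg]
      have h2 : (Finset.univ.image (Fin.init s)).filter (fun x => t ≤ x) = ∅ :=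
        Finset.filter_eq_empty_iff.2 fun x hx => not_le.2 ((hlt x hx).trans hl')
      have h3 : (Finset.univ.image (Fin.init s)).filter (fun x => x < t) =
          Finset.univ.image (Fin.init s) :=
        Finset.filter_eq_self.2 fun x hx => (hlt x hx).trans hl'
      rw [orderedChain_keldysh_lt hU O W (strictMono_init hs) hinit hl', Finset.filter_insert,
        if_neg hl, h2, Finset.filter_insert, if_pos hl', h3, timeProd_insert_max _ hlt,
        keldyshPropagator, if_neg hf.not_gt, if_neg hl, h1, h4, timeProd_empty]
      simp only [heisenberg, mul_assoc, one_mul]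

end TimeProd

/-! ### Sums over pairings of a finite set -/

section Pairings

open scoped Classical in
/-- The ordered pairings of a finite set. -/
def finsetPairings {α : Type*} [LinearOrder α] (A : Finset α) : Finset (Finset (α × α)) :=
  (A ×ˢ A).powerset.filter fun q =>
    (∀ p ∈ q, p.1 < p.2) ∧ ∀ i ∈ A, ∃! p, p ∈ q ∧ (p.1 = i ∨ p.2 = i)

theorem mem_finsetPairings {α : Type*} [LinearOrder α] {A : Finset α} {q : Finset (α × α)} :
    q ∈ finsetPairings A ↔ (∀ p ∈ q, p.1 ∈ A ∧ p.2 ∈ A ∧ p.1 < p.2) ∧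
      ∀ i ∈ A, ∃! p, p ∈ q ∧ (p.1 = i ∨ p.2 = i) := by
  simp only [finsetPairings, Finset.mem_filter, Finset.mem_powerset, Finset.subset_iff,
    Finset.mem_product]
  grind

/-- The sum over all ordered pairings of the products of `B`. -/
def pairSum {α : Type*} [LinearOrder α] (B : α → α → ℂ) (A : Finset α) : ℂ :=
  ∑ q ∈ finsetPairings A, ∏ p ∈ q, B p.1 p.2

@[simp] theorem pairSum_empty {α : Type*} [LinearOrder α] (B : α → α → ℂ) :
    pairSum B ∅ = 1 := by
  have : finsetPairings (∅ : Finset α) = {∅} := by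
    ext q
    simp only [mem_finsetPairings, Finset.notMem_empty, Finset.mem_singleton, false_and,
      IsEmpty.forall_iff, implies_true, and_true, imp_false, Finset.eq_empty_iff_forall_notMem]
  simp [pairSum, this]

/-- An increasing tuple carries index pairs bijectively and monotonically to pairs of times. On sets
of times, passing to a subset needs no relabelling, which is why the combinatorics is done there. -/
theorem sum_orderedPairings {m : ℕ} {s : Fin m → ℝ} (hs : StrictMono s) (B : ℝ → ℝ → ℂ) :
    ∑ q ∈ orderedPairings m, pairingWeight B s q = pairSum B (Finset.univ.image s) := by
  classical
  have hinj : Function.Injective (Prod.map s s) := hs.injective.prodMap hs.injective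
  refine Finset.sum_bij (fun q _ => q.image (Prod.map s s)) ?_ ?_ ?_ ?_
  · intro q hq
    simp only [orderedPairings, Finset.mem_filter, Finset.mem_univ, true_and] at hq
    rw [mem_finsetPairings]
    refine ⟨?_, ?_⟩
    · intro p hp
      obtain ⟨p, hp₀, rfl⟩ := Finset.mem_image.1 hp
      exact ⟨by simp, by simp, hs (hq.1 p hp₀)⟩
    · intro i hi
      obtain ⟨i, -, rfl⟩ := Finset.mem_image.1 hi
      obtain ⟨p, ⟨hp, hpi⟩, hu⟩ := hq.2 i
      refine ⟨Prod.map s s p, ⟨Finset.mem_image_of_mem _ hp, ?_⟩, ?_⟩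
      · exact hpi.imp (fun h => congrArg s h) (fun h => congrArg s h)
      · rintro p' ⟨hp', hpi'⟩
        obtain ⟨p', hp₀, rfl⟩ := Finset.mem_image.1 hp'
        rw [hu p' ⟨hp₀, hpi'.imp (fun h => hs.injective h) (fun h => hs.injective h)⟩]
  · intro q _ q' _ h
    exact Finset.image_injective hinj h
  · intro q hq
    rw [mem_finsetPairings] at hq
    have hq' : (Finset.univ.filter fun p : Fin m × Fin m => Prod.map s s p ∈ q).image
        (Prod.map s s) = q := by
      ext p
      simp only [Finset.mem_image, Finset.mem_filter, Finset.mem_univ, true_and]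
      constructor
      · rintro ⟨p, hp, rfl⟩
        exact hp
      · intro hp
        obtain ⟨i, -, hi⟩ := Finset.mem_image.1 (hq.1 p hp).1
        obtain ⟨j, -, hj⟩ := Finset.mem_image.1 (hq.1 p hp).2.1
        have : Prod.map s s (i, j) = p := Prod.ext hi hj
        exact ⟨(i, j), this.symm ▸ hp, this⟩
    refine ⟨Finset.univ.filter fun p : Fin m × Fin m => Prod.map s s p ∈ q, ?_, hq'⟩
    simp only [orderedPairings, Finset.mem_filter, Finset.mem_univ, true_and]
    refine ⟨fun p hp => hs.lt_iff_lt.1 (hq.1 _ hp).2.2, fun i => ?_⟩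
    obtain ⟨p, ⟨hp, hpi⟩, hu⟩ := hq.2 (s i) (by simp)
    rw [← hq'] at hp
    obtain ⟨p, hp₀, rfl⟩ := Finset.mem_image.1 hp
    refine ⟨p, ⟨(Finset.mem_filter.1 hp₀).2,
      hpi.imp (fun h => hs.injective h) (fun h => hs.injective h)⟩, ?_⟩
    rintro p' ⟨hp', hpi'⟩
    exact hinj (hu _ ⟨hp', hpi'.imp (fun h => congrArg s h) (fun h => congrArg s h)⟩)
  · intro q _
    rw [Finset.prod_image fun a _ b _ h => hinj h]
    rfl

/-- The elements that occur in a set of pairs. -/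
def pairSupport {α : Type*} [LinearOrder α] (q : Finset (α × α)) : Finset α :=
  q.image Prod.fst ∪ q.image Prod.snd

theorem mem_pairSupport {α : Type*} [LinearOrder α] {q : Finset (α × α)} {i : α} :
    i ∈ pairSupport q ↔ ∃ p ∈ q, p.1 = i ∨ p.2 = i := by
  simp only [pairSupport, Finset.mem_union, Finset.mem_image]
  grind

theorem pairSupport_eq {α : Type*} [LinearOrder α] {A : Finset α} {q : Finset (α × α)}
    (hq : q ∈ finsetPairings A) : pairSupport q = A := by
  rw [mem_finsetPairings] at hq
  ext i
  rw [mem_pairSupport]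
  constructor
  · rintro ⟨p, hp, rfl | rfl⟩
    exacts [(hq.1 p hp).1, (hq.1 p hp).2.1]
  · intro hi
    obtain ⟨p, hp, -⟩ := hq.2 i hi
    exact ⟨p, hp⟩

theorem finsetPairings_subset {α : Type*} [LinearOrder α] {C : Finset α} {q q' : Finset (α × α)}
    (hq : q ∈ finsetPairings C) (h : q' ⊆ q) : q' ∈ finsetPairings (pairSupport q') := by
  rw [mem_finsetPairings] at hq ⊢
  refine ⟨fun p hp => ⟨mem_pairSupport.2 ⟨p, hp, Or.inl rfl⟩,
    mem_pairSupport.2 ⟨p, hp, Or.inr rfl⟩, (hq.1 p (h hp)).2.2⟩, fun i hi => ?_⟩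
  obtain ⟨p, hp, hpi⟩ := mem_pairSupport.1 hi
  have hiC : i ∈ C := by
    rcases hpi with rfl | rfl
    exacts [(hq.1 p (h hp)).1, (hq.1 p (h hp)).2.1]
  exact ⟨p, ⟨hp, hpi⟩, fun p' hp' => (hq.2 i hiC).unique ⟨h hp'.1, hp'.2⟩ ⟨h hp, hpi⟩⟩

theorem pairSupport_sdiff {α : Type*} [LinearOrder α] {C : Finset α} {q q' : Finset (α × α)}
    (hq : q ∈ finsetPairings C) (h : q' ⊆ q) : pairSupport (q \ q') = C \ pairSupport q' := by
  have hs := pairSupport_eq hq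
  rw [mem_finsetPairings] at hq
  ext i
  rw [Finset.mem_sdiff, mem_pairSupport, mem_pairSupport]
  constructor
  · rintro ⟨p, hp, hpi⟩
    rw [Finset.mem_sdiff] at hp
    have hiC : i ∈ C := by rw [← hs]; exact mem_pairSupport.2 ⟨p, hp.1, hpi⟩
    refine ⟨hiC, ?_⟩
    rintro ⟨p', hp', hpi'⟩
    exact hp.2 ((hq.2 i hiC).unique ⟨h hp', hpi'⟩ ⟨hp.1, hpi⟩ ▸ hp')
  · rintro ⟨hi, hn⟩
    obtain ⟨p, ⟨hp, hpi⟩, -⟩ := hq.2 i hi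
    exact ⟨p, Finset.mem_sdiff.2 ⟨hp, fun hp' => hn ⟨p, hp', hpi⟩⟩, hpi⟩

theorem union_mem_finsetPairings {α : Type*} [LinearOrder α] {A A' : Finset α}
    (hd : Disjoint A A') {q q' : Finset (α × α)} (hq : q ∈ finsetPairings A)
    (hq' : q' ∈ finsetPairings A') : q ∪ q' ∈ finsetPairings (A ∪ A') := by
  rw [mem_finsetPairings] at *
  rw [Finset.disjoint_left] at hd
  refine ⟨by grind, fun i hi => ?_⟩
  rcases Finset.mem_union.1 hi with hi | hi
  · obtain ⟨p, hp, hu⟩ := hq.2 i hi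
    exact ⟨p, by grind, by grind⟩
  · obtain ⟨p, hp, hu⟩ := hq'.2 i hi
    exact ⟨p, by grind, by grind⟩

/-- The pairing sum of `D + B` splits into pairing sums of `D` and `B`. -/
theorem pairSum_add {α : Type*} [LinearOrder α] (D B : α → α → ℂ) (C : Finset α) :
    pairSum (fun x y => D x y + B x y) C =
      ∑ A ∈ C.powerset, pairSum D A * pairSum B (C \ A) := by
  -- Multiplying out the product over a pairing q gives a sum over subsets q' ⊆ q. Such a q' is the
  -- same as a set A (its support), a pairing of A, and a pairing q \ q' of the remaining points.
  simp only [pairSum, Finset.prod_add, Finset.sum_mul_sum, ← Finset.sum_product']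
  rw [Finset.sum_sigma', Finset.sum_sigma']
  refine Finset.sum_bij' (fun x _ => ⟨pairSupport x.2, (x.2, x.1 \ x.2)⟩)
    (fun y _ => ⟨y.2.1 ∪ y.2.2, y.2.1⟩) ?_ ?_ ?_ ?_ ?_
  · rintro ⟨q, q'⟩ h
    simp only [Finset.mem_sigma, Finset.mem_powerset, Finset.mem_product] at h ⊢
    refine ⟨?_, finsetPairings_subset h.1 h.2, ?_⟩
    · intro i hi
      obtain ⟨p, hp, hpi⟩ := mem_pairSupport.1 hi
      rw [← pairSupport_eq h.1]
      exact mem_pairSupport.2 ⟨p, h.2 hp, hpi⟩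
    · rw [← pairSupport_sdiff h.1 h.2]
      exact finsetPairings_subset h.1 Finset.sdiff_subset
  · rintro ⟨A, q, q'⟩ h
    simp only [Finset.mem_sigma, Finset.mem_powerset, Finset.mem_product] at h ⊢
    refine ⟨?_, Finset.subset_union_left⟩
    have := union_mem_finsetPairings Finset.disjoint_sdiff h.2.1 h.2.2
    rwa [Finset.union_sdiff_of_subset h.1] at this
  · rintro ⟨q, q'⟩ h
    simp only [Finset.mem_sigma, Finset.mem_powerset] at h
    simp [Finset.union_sdiff_of_subset h.2]
  · rintro ⟨A, q, q'⟩ h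
    simp only [Finset.mem_sigma, Finset.mem_powerset, Finset.mem_product] at h
    have hd : Disjoint q q' := by
      rw [Finset.disjoint_left]
      intro p hp hp'
      have h1 := ((mem_finsetPairings.1 h.2.1).1 p hp).1
      have h2 := ((mem_finsetPairings.1 h.2.2).1 p hp').1
      exact (Finset.mem_sdiff.1 h2).2 h1
    simp only [pairSupport_eq h.2.1, Finset.union_sdiff_cancel_left hd]
  · rintro ⟨q, q'⟩ h
    rfl

/-- The largest element `m` can only be the second entry of its pair (x, m). Deleting this pair
leaves a pairing of the other points. -/
theorem card_finsetPairings_insert_le {α : Type*} [LinearOrder α] {A : Finset α} {m : α}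
    (hm : ∀ x ∈ A, x < m) : (finsetPairings (insert m A)).card ≤
      ∑ x ∈ A, (finsetPairings (A.erase x)).card := by
  have hsub : finsetPairings (insert m A) ⊆
      A.biUnion fun x => (finsetPairings (A.erase x)).image (insert (x, m)) := by
    intro q hq
    rw [mem_finsetPairings] at hq
    obtain ⟨⟨x, y⟩, ⟨hp, hpm⟩, hu⟩ := hq.2 m (Finset.mem_insert_self _ _)
    have hxy := hq.1 _ hp
    have hy : y = m := by grind
    subst hy
    have hx : x ∈ A := by grind
    rw [Finset.mem_biUnion]
    refine ⟨x, hx, Finset.mem_image.2 ⟨q.erase (x, y), ?_, Finset.insert_erase hp⟩⟩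
    rw [mem_finsetPairings]
    have hux : ∀ p, p ∈ q ∧ (p.1 = x ∨ p.2 = x) → p = (x, y) := fun p h =>
      (hq.2 x (by grind)).unique h ⟨hp, Or.inl rfl⟩
    refine ⟨fun p hpq => ?_, fun i hi => ?_⟩
    · have hpq' := Finset.mem_erase.1 hpq
      have h3 : ¬ (p.1 = x ∨ p.2 = x) := fun h => hpq'.1 (hux _ ⟨hpq'.2, h⟩)
      have h4 : ¬ (p.1 = y ∨ p.2 = y) := fun h => hpq'.1 (hu _ ⟨hpq'.2, h⟩)
      have h5 := hq.1 p hpq'.2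
      grind
    · obtain ⟨p, hp', hu'⟩ := hq.2 i (by grind)
      have : p ≠ (x, y) := by
        rintro rfl
        have := hm i (by grind)
        grind
      exact ⟨p, ⟨Finset.mem_erase.2 ⟨this, hp'.1⟩, hp'.2⟩, fun p' h =>
        hu' p' ⟨Finset.mem_of_mem_erase h.1, h.2⟩⟩
  exact (Finset.card_le_card hsub).trans (Finset.card_biUnion_le.trans
    (Finset.sum_le_sum fun x _ => Finset.card_image_le))

/-- There are no pairings of a set with an odd number of elements. -/
theorem card_finsetPairings_odd {α : Type*} [LinearOrder α] (n : ℕ) :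
    ∀ A : Finset α, A.card = 2 * n + 1 → (finsetPairings A).card = 0 := by
  induction n with
  | zero =>
    intro A hA
    obtain ⟨a, rfl⟩ := Finset.card_eq_one.1 hA
    simpa using card_finsetPairings_insert_le (A := ∅) (m := a) (by simp)
  | succ n ih =>
    intro A hA
    have hne : A.Nonempty := Finset.card_pos.1 (by omega)
    have h := card_finsetPairings_insert_le (A := A.erase (A.max' hne)) (m := A.max' hne)
      fun x hx => A.lt_max'_of_mem_erase_max' hne hx
    rw [Finset.insert_erase (A.max'_mem hne)] at h
    refine Nat.le_zero.1 (h.trans (le_of_eq (Finset.sum_eq_zero fun x hx => ih _ ?_)))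
    rw [Finset.card_erase_of_mem hx, Finset.card_erase_of_mem (A.max'_mem hne)]
    omega

/-- The maximum has 2n - 1 possible partners among 2n points; rounding this factor up to 2n at each
step gives the product 2^n n!. -/
theorem card_finsetPairings_even_le {α : Type*} [LinearOrder α] (n : ℕ) :
    ∀ A : Finset α, A.card = 2 * n → (finsetPairings A).card ≤ 2 ^ n * n.factorial := by
  induction n with
  | zero =>
    intro A hA
    rw [mul_zero, Finset.card_eq_zero] at hA
    subst hA
    refine (Finset.card_le_card (t := {∅}) fun q hq => ?_).trans (by simp)
    rw [mem_finsetPairings] at hq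
    exact Finset.mem_singleton.2 (Finset.eq_empty_of_forall_notMem fun p hp =>
      Finset.notMem_empty _ (hq.1 p hp).1)
  | succ n ih =>
    intro A hA
    have hne : A.Nonempty := Finset.card_pos.1 (by omega)
    have h := card_finsetPairings_insert_le (A := A.erase (A.max' hne)) (m := A.max' hne)
      fun x hx => A.lt_max'_of_mem_erase_max' hne hx
    rw [Finset.insert_erase (A.max'_mem hne)] at h
    refine h.trans ((Finset.sum_le_card_nsmul _ _ (2 ^ n * n.factorial) fun x hx => ih _ ?_).trans
      ?_)
    · rw [Finset.card_erase_of_mem hx, Finset.card_erase_of_mem (A.max'_mem hne)]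
      omega
    · rw [Finset.card_erase_of_mem (A.max'_mem hne), hA, smul_eq_mul, Nat.factorial_succ, pow_succ]
      have : 2 * (n + 1) - 1 ≤ 2 * (n + 1) := Nat.sub_le _ _
      calc (2 * (n + 1) - 1) * (2 ^ n * n.factorial)
          ≤ 2 * (n + 1) * (2 ^ n * n.factorial) := Nat.mul_le_mul_right _ this
        _ = _ := by ring

/-- A pairing sum is bounded by `K ^ (n / 2)` times the number of pairings. -/
theorem norm_pairSum_le {B : ℝ → ℝ → ℂ} {K : ℝ} (hK : 0 ≤ K) {A : Finset ℝ}
    (hB : ∀ x ∈ A, ∀ y ∈ A, x < y → ‖B x y‖ ≤ K) {n : ℕ} (hA : A.card = 2 * n) :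
    ‖pairSum B A‖ ≤ (2 * K) ^ n * n.factorial := by
  have hcard : ∀ q ∈ finsetPairings A, q.card = n := by
    intro q hq
    have h1 := pairSupport_eq hq
    rw [mem_finsetPairings] at hq
    have h2 : (pairSupport q).card = 2 * q.card := by
      rw [pairSupport, Finset.card_union_of_disjoint, Finset.card_image_of_injOn,
        Finset.card_image_of_injOn, two_mul]
      · intro p hp p' hp' h
        exact (hq.2 p.2 (hq.1 p hp).2.1).unique ⟨hp, Or.inr rfl⟩ ⟨hp', Or.inr h.symm⟩
      · intro p hp p' hp' h
        exact (hq.2 p.1 (hq.1 p hp).1).unique ⟨hp, Or.inl rfl⟩ ⟨hp', Or.inl h.symm⟩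
      · rw [Finset.disjoint_left]
        intro i hi hi'
        obtain ⟨p, hp, rfl⟩ := Finset.mem_image.1 hi
        obtain ⟨p', hp', h⟩ := Finset.mem_image.1 hi'
        have := (hq.2 p.1 (hq.1 p hp).1).unique ⟨hp, Or.inl rfl⟩ ⟨hp', Or.inr h⟩
        subst this
        exact (hq.1 p hp).2.2.ne' h
    rw [h1, hA] at h2
    omega
  calc ‖pairSum B A‖ ≤ ∑ q ∈ finsetPairings A, K ^ n := by
        refine norm_sum_le_of_le _ fun q hq => ?_
        rw [norm_prod, ← hcard q hq, ← Finset.prod_const]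
        rw [mem_finsetPairings] at hq
        exact Finset.prod_le_prod (fun _ _ => norm_nonneg _) fun p hp =>
          hB _ (hq.1 p hp).1 _ (hq.1 p hp).2.1 (hq.1 p hp).2.2
    _ = (finsetPairings A).card * K ^ n := by rw [Finset.sum_const, nsmul_eq_mul]
    _ ≤ (2 ^ n * n.factorial : ℕ) * K ^ n := by
        gcongr
        exact card_finsetPairings_even_le n A hA
    _ = _ := by push_cast; rw [mul_pow]; ring

theorem pairSum_odd {B : ℝ → ℝ → ℂ} {A : Finset ℝ} (hA : ¬ Even A.card) : pairSum B A = 0 := by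
  obtain ⟨n, hn⟩ := Nat.not_even_iff_odd.1 hA
  rw [pairSum, Finset.card_eq_zero.1 (card_finsetPairings_odd n A hn), Finset.sum_empty]

end Pairings
end

noncomputable section

open MeasureTheory
open scoped ENNReal

/-! ### The measure on finite configurations of times -/

/-- Finite tuples of times. -/
abbrev Conf : Type := Σ n : ℕ, Fin n → ℝ

/-- The set of times of a configuration. -/
def Conf.times (c : Conf) : Finset ℝ := Finset.univ.image c.2

/-- The configuration given by a tuple. -/
def confMk (n : ℕ) (s : Fin n → ℝ) : Conf := ⟨n, s⟩

theorem measurableEmbedding_confMk (n : ℕ) : MeasurableEmbedding (confMk n) where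
  injective := fun _ _ h => sigma_mk_injective h
  measurable := by
    intro s hs
    exact MeasurableSpace.measurableSet_iInf.1 hs n
  measurableSet_image' := by
    intro s hs
    refine MeasurableSpace.measurableSet_iInf.2 fun m => ?_
    change MeasurableSet (confMk m ⁻¹' (confMk n '' s))
    rcases eq_or_ne m n with rfl | h
    · rwa [Set.preimage_image_eq (f := confMk m) s fun _ _ h => sigma_mk_injective h]
    · convert MeasurableSet.empty
      ext x
      simp [confMk, h.symm]

/-- The measure `∑ n, (1 / n!) ν ^ n` on finite configurations. -/
def confMeasure (ν : Measure ℝ) : Measure Conf :=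
  Measure.sum fun n => (n.factorial : ℝ≥0∞)⁻¹ • (Measure.pi fun _ : Fin n => ν).map (confMk n)

variable {ν : Measure ℝ}

instance confMeasure.sFinite [SigmaFinite ν] : SFinite (confMeasure ν) := by
  unfold confMeasure
  infer_instance

theorem factorial_inv_ne_zero (n : ℕ) : (n.factorial : ℝ≥0∞)⁻¹ ≠ 0 :=
  ENNReal.inv_ne_zero.2 (ENNReal.natCast_ne_top _)

theorem factorial_inv_ne_top (n : ℕ) : (n.factorial : ℝ≥0∞)⁻¹ ≠ ∞ :=
  ENNReal.inv_ne_top.2 (by exact_mod_cast n.factorial_ne_zero)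

theorem ae_confMeasure_iff {p : Conf → Prop} :
    (∀ᵐ c ∂confMeasure ν, p c) ↔ ∀ n, ∀ᵐ s ∂(Measure.pi fun _ : Fin n => ν), p ⟨n, s⟩ := by
  rw [confMeasure, Measure.ae_sum_iff]
  refine forall_congr' fun n => ?_
  rw [Measure.ae_ennreal_smul_measure_iff (factorial_inv_ne_zero n),
    (measurableEmbedding_confMk n).ae_map_iff]
  rfl

theorem aestronglyMeasurable_conf_iff {X : Type*} [TopologicalSpace X]
    [TopologicalSpace.PseudoMetrizableSpace X] {f : Conf → X} :
    AEStronglyMeasurable f (confMeasure ν) ↔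
      ∀ n, AEStronglyMeasurable (fun s => f ⟨n, s⟩) (Measure.pi fun _ : Fin n => ν) := by
  rw [confMeasure, aestronglyMeasurable_sum_measure_iff]
  refine forall_congr' fun n => ?_
  change _ ↔ AEStronglyMeasurable (f ∘ confMk n) _
  rw [← (measurableEmbedding_confMk n).aestronglyMeasurable_map_iff]
  exact ⟨fun h => ⟨h.mk f, h.stronglyMeasurable_mk,
    (Measure.ae_ennreal_smul_measure_iff (factorial_inv_ne_zero n)).1 h.ae_eq_mk⟩,
    fun h => h.smul_measure _⟩

theorem lintegral_conf (f : Conf → ℝ≥0∞) : ∫⁻ c, f c ∂confMeasure ν =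
    ∑' n : ℕ, (n.factorial : ℝ≥0∞)⁻¹ * ∫⁻ s, f ⟨n, s⟩ ∂(Measure.pi fun _ : Fin n => ν) := by
  rw [confMeasure, lintegral_sum_measure]
  congr 1
  ext n
  rw [lintegral_smul_measure, (measurableEmbedding_confMk n).lintegral_map, smul_eq_mul]
  rfl

theorem integrable_conf_iff {X : Type*} [NormedAddCommGroup X] {f : Conf → X} :
    Integrable f (confMeasure ν) ↔
      (∀ n, Integrable (fun s => f ⟨n, s⟩) (Measure.pi fun _ : Fin n => ν)) ∧
      Summable fun n : ℕ => (n.factorial : ℝ)⁻¹ *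
        ∫ s, ‖f ⟨n, s⟩‖ ∂(Measure.pi fun _ : Fin n => ν) := by
  rw [confMeasure, integrable_sum_measure_iff]
  refine and_congr (forall_congr' fun n => ?_) ?_
  · rw [integrable_smul_measure (factorial_inv_ne_zero n) (factorial_inv_ne_top n),
      (measurableEmbedding_confMk n).integrable_map_iff]
    rfl
  · simp_rw [integral_smul_measure, (measurableEmbedding_confMk _).integral_map]
    simp [confMk]

theorem hasSum_integral_conf {X : Type*} [NormedAddCommGroup X] [NormedSpace ℝ X] {f : Conf → X}
    (hf : Integrable f (confMeasure ν)) :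
    HasSum (fun n : ℕ => (n.factorial : ℝ)⁻¹ • ∫ s, f ⟨n, s⟩ ∂(Measure.pi fun _ : Fin n => ν))
      (∫ c, f c ∂confMeasure ν) := by
  have h := hasSum_integral_measure hf
  simp_rw [integral_smul_measure, (measurableEmbedding_confMk _).integral_map] at h
  simpa [confMeasure, confMk] using h

/-- Functions bounded by a summable function of the number of times are integrable. -/
theorem integrable_conf_of_le [IsFiniteMeasure ν] {X : Type*} [NormedAddCommGroup X]
    {f : Conf → X} (hf : AEStronglyMeasurable f (confMeasure ν)) {b : ℕ → ℝ}
    (hb : Summable fun n => b n * ν.real Set.univ ^ n / n.factorial)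
    (hfb : ∀ᵐ c ∂confMeasure ν, ‖f c‖ ≤ b c.1) : Integrable f (confMeasure ν) := by
  rw [ae_confMeasure_iff] at hfb
  rw [aestronglyMeasurable_conf_iff] at hf
  have hi : ∀ n, Integrable (fun s => f ⟨n, s⟩) (Measure.pi fun _ : Fin n => ν) := fun n =>
    Integrable.of_bound (hf n) (b n) (hfb n)
  refine integrable_conf_iff.2 ⟨hi, Summable.of_nonneg_of_le (fun n => ?_) (fun n => ?_) hb⟩
  · positivity
  · have h1 : ∫ s, ‖f ⟨n, s⟩‖ ∂(Measure.pi fun _ : Fin n => ν) ≤ b n * ν.real Set.univ ^ n := by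
      refine (integral_mono_ae (hi n).norm (integrable_const (b n)) (hfb n)).trans (le_of_eq ?_)
      rw [integral_const, smul_eq_mul, mul_comm, Measure.real, Measure.pi_univ]
      simp [Measure.real]
    rw [inv_mul_eq_div]
    gcongr

theorem ae_conf_forall [SigmaFinite ν] {p : ℝ → Prop} (hp : ∀ᵐ x ∂ν, p x) :
    ∀ᵐ c ∂confMeasure ν, ∀ x ∈ c.times, p x := by
  rw [ae_confMeasure_iff]
  intro n
  have : ∀ i : Fin n, ∀ᵐ s ∂(Measure.pi fun _ : Fin n => ν), p (s i) := fun i =>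
    (Measure.tendsto_eval_ae_ae (μ := fun _ : Fin n => ν) (i := i)).eventually hp
  filter_upwards [ae_all_iff.2 this] with s hs x hx
  obtain ⟨i, -, rfl⟩ := Finset.mem_image.1 hx
  exact hs i

theorem ae_conf_notMem [SigmaFinite ν] [NullSingletonClass ν] (x : ℝ) :
    ∀ᵐ c ∂confMeasure ν, x ∉ c.times := by
  have : ∀ᵐ y ∂ν, y ≠ x := by simp [ae_iff, measure_singleton]
  filter_upwards [ae_conf_forall this] with c hc hx using hc x hx rfl

theorem ae_conf_disjoint [SigmaFinite ν] [NullSingletonClass ν] (A : Finset ℝ) :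
    ∀ᵐ c ∂confMeasure ν, Disjoint A c.times := by
  have : ∀ᵐ c ∂confMeasure ν, ∀ x : A, (x : ℝ) ∉ c.times :=
    ae_all_iff.2 fun x => ae_conf_notMem x.1
  filter_upwards [this] with c hc
  exact Finset.disjoint_left.2 fun x hx => hc ⟨x, hx⟩

/-! ### Splitting configurations -/

/-- The part of a tuple with indices in `S`. -/
def confRestrict {N : ℕ} (S : Finset (Fin N)) (s : Fin N → ℝ) : Conf :=
  ⟨S.card, fun i => s (S.orderEmbOfFin rfl i)⟩

theorem times_confRestrict {N : ℕ} (S : Finset (Fin N)) (s : Fin N → ℝ) :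
    (confRestrict S s).times = S.image s := by
  ext x
  simp only [Conf.times, confRestrict, Finset.mem_image]
  constructor
  · rintro ⟨i, -, rfl⟩
    exact ⟨_, Finset.orderEmbOfFin_mem S rfl i, rfl⟩
  · rintro ⟨i, hi, rfl⟩
    have : i ∈ Set.range (S.orderEmbOfFin rfl) := by rwa [Finset.range_orderEmbOfFin]
    obtain ⟨k, hk⟩ := this
    exact ⟨k, Finset.mem_univ _, by rw [hk]⟩

theorem measurePreserving_comp_equiv [SigmaFinite ν] {ι ι' : Type*} [Fintype ι] [Fintype ι']
    (e : ι' ≃ ι) : MeasurePreserving (fun s : ι → ℝ => fun i => s (e i))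
      (Measure.pi fun _ : ι => ν) (Measure.pi fun _ : ι' => ν) := by
  have h := measurePreserving_piCongrLeft (fun _ : ι' => ν) e.symm
  convert h using 1
  ext s i
  obtain ⟨j, rfl⟩ := e.symm.surjective i
  rw [MeasurableEquiv.coe_piCongrLeft, Equiv.piCongrLeft_apply_apply, Equiv.apply_symm_apply]

theorem measurePreserving_confSplit [SigmaFinite ν] {N : ℕ} (S : Finset (Fin N)) :
    MeasurePreserving (fun s : Fin N → ℝ =>
        ((fun i => s (S.orderEmbOfFin rfl i), fun i => s (Sᶜ.orderEmbOfFin rfl i)) :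
          (Fin S.card → ℝ) × (Fin Sᶜ.card → ℝ)))
      (Measure.pi fun _ : Fin N => ν)
      ((Measure.pi fun _ : Fin S.card => ν).prod (Measure.pi fun _ : Fin Sᶜ.card => ν)) := by
  have h1 := measurePreserving_piEquivPiSubtypeProd (fun _ : Fin N => ν) (fun i => i ∈ S)
  have h2 := (@measurePreserving_comp_equiv ν _ _ _ (Subtype.fintype fun i => i ∈ S) _ (S.orderIsoOfFin rfl).toEquiv).prod
    (measurePreserving_comp_equiv (ν := ν) ((Sᶜ.orderIsoOfFin rfl).toEquiv.trans
      (Equiv.subtypeEquivRight fun i => Finset.mem_compl)))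
  exact h2.comp h1

/-- Diagonals are null: separating one coordinate from the rest exhibits the measure as a product,
and Fubini reduces the claim to singletons being null for ν. -/
theorem ae_pi_injective [SigmaFinite ν] [NullSingletonClass ν] (n : ℕ) :
    ∀ᵐ s ∂(Measure.pi fun _ : Fin n => ν), Function.Injective s := by
  have key : ∀ i j : Fin n, i ≠ j → ∀ᵐ s ∂(Measure.pi fun _ : Fin n => ν), s i ≠ s j := by
    intro i j hij
    have h1 := measurePreserving_confSplit (ν := ν) ({i} : Finset (Fin n))
    have hj : j ∈ Set.range (({i}ᶜ : Finset (Fin n)).orderEmbOfFin rfl) := by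
      rw [Finset.range_orderEmbOfFin]; simpa using hij.symm
    obtain ⟨k, hk⟩ := hj
    have hc : 0 < ({i} : Finset (Fin n)).card := by simp
    have h2 : ∀ᵐ z ∂((Measure.pi fun _ : Fin ({i} : Finset (Fin n)).card => ν).prod
        (Measure.pi fun _ : Fin ({i}ᶜ : Finset (Fin n)).card => ν)), z.1 ⟨0, hc⟩ ≠ z.2 k := by
      have hm : MeasurableSet {z : (Fin ({i} : Finset (Fin n)).card → ℝ) ×
          (Fin ({i}ᶜ : Finset (Fin n)).card → ℝ) | z.1 ⟨0, hc⟩ ≠ z.2 k} := by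
        refine MeasurableSet.compl (measurableSet_eq_fun ?_ ?_)
        · exact (measurable_pi_apply _).comp measurable_fst
        · exact (measurable_pi_apply _).comp measurable_snd
      rw [Measure.ae_prod_iff_ae_ae hm]
      refine Filter.Eventually.of_forall fun u => ?_
      have : ∀ᵐ y ∂ν, u ⟨0, hc⟩ ≠ y := by
        simp [ae_iff, eq_comm]
      exact (Measure.tendsto_eval_ae_ae (μ := fun _ => ν) (i := k)).eventually this
    filter_upwards [h1.quasiMeasurePreserving.ae h2] with s hs
    have h3 : ({i} : Finset (Fin n)).orderEmbOfFin rfl ⟨0, hc⟩ = i :=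
      Finset.mem_singleton.1 (Finset.orderEmbOfFin_mem _ _ _)
    simpa [h3, hk] using hs
  have : ∀ᵐ s ∂(Measure.pi fun _ : Fin n => ν), ∀ i j : Fin n, i ≠ j → s i ≠ s j := by
    rw [ae_all_iff]; intro i
    rw [ae_all_iff]; intro j
    by_cases h : i = j
    · simp [h]
    · simpa [h] using key i j h
  filter_upwards [this] with s hs i j h
  by_contra hne
  exact hs i j hne h

theorem ae_conf_injective [SigmaFinite ν] [NullSingletonClass ν] :
    ∀ᵐ c ∂confMeasure ν, Function.Injective c.2 :=
  ae_confMeasure_iff.2 fun n => ae_pi_injective n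

/-- A tuple split into the part with indices in `S` and the rest. -/
def confSplit {N : ℕ} (S : Finset (Fin N)) (s : Fin N → ℝ) : Conf × Conf :=
  (confRestrict S s, confRestrict Sᶜ s)

theorem measurable_confSplit {N : ℕ} (S : Finset (Fin N)) : Measurable (confSplit S) := by
  refine Measurable.prodMk ?_ ?_
  · exact (measurableEmbedding_confMk _).measurable.comp
      (measurable_pi_lambda _ fun i => measurable_pi_apply _)
  · exact (measurableEmbedding_confMk _).measurable.comp
      (measurable_pi_lambda _ fun i => measurable_pi_apply _)

/-- The weight 1/N! spread over the binomially many index sets of size m is 1/m! · 1/n!. This is why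
the product of two configuration measures is a measure on split configurations. -/
theorem factorial_inv_mul_choose {m n : ℕ} :
    (((m + n).factorial : ℝ≥0∞)⁻¹) * ((m + n).choose m : ℝ≥0∞) =
      (m.factorial : ℝ≥0∞)⁻¹ * (n.factorial : ℝ≥0∞)⁻¹ := by
  have h := Nat.add_choose_mul_factorial_mul_factorial m n
  have hN : ((m + n).factorial : ℝ≥0∞) ≠ 0 := by exact_mod_cast (m + n).factorial_ne_zero
  have hm : (m.factorial : ℝ≥0∞) ≠ 0 := by exact_mod_cast m.factorial_ne_zero
  have hn : (n.factorial : ℝ≥0∞) ≠ 0 := by exact_mod_cast n.factorial_ne_zero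
  have ht : ∀ k : ℕ, (k : ℝ≥0∞) ≠ ∞ := ENNReal.natCast_ne_top
  have h2 : ((m + n).factorial : ℝ≥0∞) = (m + n).choose n * m.factorial * n.factorial := by
    rw [← h]; push_cast; rfl
  rw [← ENNReal.mul_inv (Or.inl hm) (Or.inl (ht _)), Nat.choose_symm_add]
  refine (ENNReal.eq_inv_of_mul_eq_one_left ?_)
  rw [mul_assoc, ← mul_assoc (((m + n).choose n : ℕ) : ℝ≥0∞), ← h2,
    ENNReal.inv_mul_cancel hN (ht _)]

/-- Pairs of configurations are splittings of configurations. -/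
theorem confMeasure_prod [SigmaFinite ν] : (confMeasure ν).prod (confMeasure ν) =
    Measure.sum fun N : ℕ => Measure.sum fun S : Finset (Fin N) =>
      (N.factorial : ℝ≥0∞)⁻¹ • (Measure.pi fun _ : Fin N => ν).map (confSplit S) := by
  refine Measure.ext_of_lintegral _ fun f hf => ?_
  let K : ℕ → ℕ → ℝ≥0∞ := fun m n => ∫⁻ s, ∫⁻ s', f (⟨m, s⟩, ⟨n, s'⟩)
    ∂(Measure.pi fun _ : Fin n => ν) ∂(Measure.pi fun _ : Fin m => ν)
  have hL : ∫⁻ z, f z ∂(confMeasure ν).prod (confMeasure ν) =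
      ∑' p : ℕ × ℕ, (p.1.factorial : ℝ≥0∞)⁻¹ * (p.2.factorial : ℝ≥0∞)⁻¹ * K p.1 p.2 := by
    rw [lintegral_prod _ hf.aemeasurable, lintegral_conf,
      ENNReal.tsum_prod (f := fun m n : ℕ =>
        (m.factorial : ℝ≥0∞)⁻¹ * (n.factorial : ℝ≥0∞)⁻¹ * K m n)]
    congr 1; ext m
    simp_rw [lintegral_conf]
    rw [lintegral_tsum, ← ENNReal.tsum_mul_left]
    · congr 1; ext n
      rw [lintegral_const_mul', mul_assoc]
      exact factorial_inv_ne_top n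
    · intro n
      refine Measurable.aemeasurable (Measurable.const_mul ?_ _)
      refine Measurable.lintegral_prod_right' (f := fun z : (Fin m → ℝ) × (Fin n → ℝ) =>
        f (⟨m, z.1⟩, ⟨n, z.2⟩)) (hf.comp (Measurable.prodMk ?_ ?_))
      · exact (measurableEmbedding_confMk m).measurable.comp measurable_fst
      · exact (measurableEmbedding_confMk n).measurable.comp measurable_snd
  have hS : ∀ (N : ℕ) (S : Finset (Fin N)),
      ∫⁻ s, f (confSplit S s) ∂(Measure.pi fun _ : Fin N => ν) = K S.card (N - S.card) := by
    intro N S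
    have h1 := (measurePreserving_confSplit (ν := ν) S).lintegral_comp
      (f := fun z => f (⟨S.card, z.1⟩, ⟨Sᶜ.card, z.2⟩)) (hf.comp (Measurable.prodMk
        ((measurableEmbedding_confMk _).measurable.comp measurable_fst)
        ((measurableEmbedding_confMk _).measurable.comp measurable_snd)))
    have h2 : Sᶜ.card = N - S.card := by rw [Finset.card_compl, Fintype.card_fin]
    rw [← h2]
    refine h1.trans ?_
    rw [lintegral_prod]
    exact (hf.comp (Measurable.prodMk
        ((measurableEmbedding_confMk _).measurable.comp measurable_fst)
        ((measurableEmbedding_confMk _).measurable.comp measurable_snd))).aemeasurable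
  rw [hL, lintegral_sum_measure, ← Finset.HasAntidiagonal.sigmaAntidiagonalEquivProd.tsum_eq, ENNReal.tsum_sigma']
  congr 1; ext N
  rw [lintegral_sum_measure]
  simp_rw [lintegral_smul_measure, lintegral_map hf (measurable_confSplit _), hS]
  rw [tsum_fintype, tsum_fintype]
  -- The integral over a splitting depends on `S` only through its size, so the sum over `S`
  -- collapses to a binomial sum.
  have h3 := Finset.sum_powerset_apply_card (fun m => (N.factorial : ℝ≥0∞)⁻¹ • K m (N - m))
    (x := (Finset.univ : Finset (Fin N)))
  rw [Finset.powerset_univ, Finset.card_univ, Fintype.card_fin] at h3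
  rw [h3, Finset.univ_eq_attach]
  simp only [Finset.HasAntidiagonal.sigmaAntidiagonalEquivProd_apply]
  rw [Finset.sum_attach (Finset.HasAntidiagonal.antidiagonal N)
    (fun p => (p.1.factorial : ℝ≥0∞)⁻¹ * (p.2.factorial : ℝ≥0∞)⁻¹ * K p.1 p.2),
    Finset.Nat.sum_antidiagonal_eq_sum_range_succ
      (fun m n => (m.factorial : ℝ≥0∞)⁻¹ * (n.factorial : ℝ≥0∞)⁻¹ * K m n)]
  refine Finset.sum_congr rfl fun m hm => ?_
  have hmN : m ≤ N := Nat.lt_succ_iff.1 (Finset.mem_range.1 hm)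
  obtain ⟨n, rfl⟩ := Nat.exists_eq_add_of_le hmN
  rw [Nat.add_sub_cancel_left, ← factorial_inv_mul_choose, nsmul_eq_mul, smul_eq_mul]
  ring

end

noncomputable section

open MeasureTheory
open scoped ENNReal

/-! ### Measurable functions of configurations -/

theorem measurableSet_conf {T : Set Conf} (h : ∀ n, MeasurableSet (confMk n ⁻¹' T)) :
    MeasurableSet T := MeasurableSpace.measurableSet_iInf.2 h

theorem measurableSet_conf_prod {T : Set (Conf × Conf)}
    (h : ∀ m n, MeasurableSet (Prod.map (confMk m) (confMk n) ⁻¹' T)) : MeasurableSet T := by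
  have : T = ⋃ m, ⋃ n, Prod.map (confMk m) (confMk n) '' (Prod.map (confMk m) (confMk n) ⁻¹' T) := by
    ext ⟨⟨m, s⟩, ⟨n, s'⟩⟩
    simp only [Set.mem_iUnion, Set.mem_image, Set.mem_preimage]
    constructor
    · exact fun h => ⟨m, n, (s, s'), h, rfl⟩
    · rintro ⟨m', n', z, hz, h⟩
      exact h ▸ hz
  rw [this]
  refine MeasurableSet.iUnion fun m => MeasurableSet.iUnion fun n => ?_
  exact ((measurableEmbedding_confMk m).prodMap
    (measurableEmbedding_confMk n)).measurableSet_image.2 (h m n)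

theorem stronglyMeasurable_conf {X : Type*} [TopologicalSpace X]
    [TopologicalSpace.PseudoMetrizableSpace X] {G : Conf → X}
    (h : ∀ n, StronglyMeasurable fun s => G (confMk n s)) : StronglyMeasurable G := by
  borelize X
  rw [stronglyMeasurable_iff_measurable_separable]
  constructor
  · intro T hT
    exact measurableSet_conf fun n => (h n).measurable hT
  · have : Set.range G = ⋃ n, Set.range fun s => G (confMk n s) := by
      ext x
      simp only [Set.mem_range, Set.mem_iUnion]
      exact ⟨fun ⟨⟨n, s⟩, h⟩ => ⟨n, s, h⟩, fun ⟨n, s, h⟩ => ⟨_, h⟩⟩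
    rw [this]
    exact TopologicalSpace.IsSeparable.iUnion fun n => (h n).isSeparable_range

/-- Concatenation of configurations. -/
def Conf.append (c c' : Conf) : Conf := ⟨c.1 + c'.1, Fin.append c.2 c'.2⟩

theorem Conf.mem_times {c : Conf} {x : ℝ} : x ∈ c.times ↔ ∃ i, c.2 i = x := by
  simp [Conf.times]

theorem Conf.times_append (c c' : Conf) : (c.append c').times = c.times ∪ c'.times := by
  ext x
  rw [Finset.mem_union, Conf.mem_times, Conf.mem_times, Conf.mem_times]
  constructor
  · rintro ⟨i, rfl⟩
    change Fin (c.1 + c'.1) at i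
    change (∃ j, c.2 j = Fin.append c.2 c'.2 i) ∨ ∃ j, c'.2 j = Fin.append c.2 c'.2 i
    induction i using Fin.addCases with
    | left i => exact Or.inl ⟨i, by simp⟩
    | right i => exact Or.inr ⟨i, by simp⟩
  · rintro (⟨i, rfl⟩ | ⟨i, rfl⟩)
    · exact ⟨Fin.castAdd _ i, Fin.append_left _ _ _⟩
    · exact ⟨Fin.natAdd _ i, Fin.append_right _ _ _⟩

theorem Conf.measurable_append : Measurable fun z : Conf × Conf => z.1.append z.2 := by
  intro T hT
  refine measurableSet_conf_prod fun m n => ?_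
  have : Measurable fun z : (Fin m → ℝ) × (Fin n → ℝ) => confMk (m + n) (Fin.append z.1 z.2) := by
    refine (measurableEmbedding_confMk _).measurable.comp (measurable_pi_lambda _ fun i => ?_)
    induction i using Fin.addCases with
    | left i =>
      simp only [Fin.append_left]
      exact (measurable_pi_apply i).comp measurable_fst
    | right i =>
      simp only [Fin.append_right]
      exact (measurable_pi_apply i).comp measurable_snd
  exact this hT

/-- The configuration enumerating a finite set. -/
def confOf (A : Finset ℝ) : Conf := ⟨A.card, A.orderEmbOfFin rfl⟩

theorem times_confOf (A : Finset ℝ) : (confOf A).times = A := by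
  ext x
  simp only [Conf.times, confOf, Finset.mem_image]
  constructor
  · rintro ⟨i, -, rfl⟩
    exact Finset.orderEmbOfFin_mem A rfl i
  · intro hi
    have : x ∈ Set.range (A.orderEmbOfFin rfl) := by rwa [Finset.range_orderEmbOfFin]
    obtain ⟨k, hk⟩ := this
    exact ⟨k, Finset.mem_univ _, hk⟩

theorem Conf.append_injective {c c' : Conf} (h : Function.Injective c.2)
    (h' : Function.Injective c'.2) (hd : Disjoint c.times c'.times) :
    Function.Injective (c.append c').2 := by
  refine Fin.append_injective_iff.2 ⟨h, h', fun i j hij => ?_⟩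
  exact Finset.disjoint_left.1 hd (Conf.mem_times.2 ⟨i, rfl⟩) (Conf.mem_times.2 ⟨j, hij.symm⟩)

theorem measurableSet_timeSimplex (m : ℕ) (si sf : ℝ) : MeasurableSet (timeSimplex m si sf) := by
  have : timeSimplex m si sf = (⋂ i, ⋂ j, ⋂ _ : i < j, {s : Fin m → ℝ | s i < s j}) ∩
      ⋂ i, (fun s : Fin m → ℝ => s i) ⁻¹' Set.Ioo si sf := by
    ext s
    simp only [timeSimplex, Set.mem_ofPred_eq, Set.mem_inter_iff, Set.mem_iInter, Set.mem_preimage]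
    exact Iff.rfl
  rw [this]
  refine MeasurableSet.inter ?_ (MeasurableSet.iInter fun i => measurable_pi_apply i measurableSet_Ioo)
  refine MeasurableSet.iInter fun i => MeasurableSet.iInter fun j => MeasurableSet.iInter fun _ => ?_
  exact measurableSet_lt (measurable_pi_apply i) (measurable_pi_apply j)

/-- A function of finite sets of times that is measurable on every time simplex. -/
def TimeMeasurable {X : Type*} [TopologicalSpace X] (si sf : ℝ) (f : Finset ℝ → X) : Prop :=
  ∀ n, ∃ g : (Fin n → ℝ) → X, StronglyMeasurable g ∧
    ∀ s ∈ timeSimplex n si sf, f (Finset.univ.image s) = g s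

theorem image_comp_perm {n : ℕ} (s : Fin n → ℝ) (σ : Equiv.Perm (Fin n)) :
    Finset.univ.image (fun i => s (σ i)) = Finset.univ.image s := by
  ext x
  simp only [Finset.mem_image, Finset.mem_univ, true_and]
  exact ⟨fun ⟨i, h⟩ => ⟨σ i, h⟩, fun ⟨i, h⟩ => ⟨σ.symm i, by simpa using h⟩⟩

/-- An injective tuple is the rearrangement of exactly one increasing tuple. -/
theorem sum_perm_timeSimplex {X : Type*} [AddCommMonoid X] {si sf : ℝ} {n : ℕ} {s : Fin n → ℝ}
    (hs : Function.Injective s) (hI : ∀ i, s i ∈ Set.Ioo si sf) (x : X) :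
    ∑ σ : Equiv.Perm (Fin n), (timeSimplex n si sf).indicator (fun _ => x) (fun i => s (σ i)) =
      x := by
  classical
  have hmono : StrictMono fun i => s (Tuple.sort s i) :=
    (Tuple.monotone_sort s).strictMono_of_injective (hs.comp (Equiv.injective _))
  rw [Finset.sum_eq_single (Tuple.sort s)]
  · exact Set.indicator_of_mem (s := timeSimplex n si sf) ⟨hmono, fun i => hI _⟩ _
  · intro σ _ hσ
    refine Set.indicator_of_notMem (fun h => hσ ?_) _
    have h1 : (fun i => s (σ i)) = fun i => s (Tuple.sort s i) := by
      have hr : (Finset.univ.image s).card = n := by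
        rw [Finset.card_image_of_injective _ hs, Finset.card_univ, Fintype.card_fin]
      rw [Finset.orderEmbOfFin_unique hr (fun i => Finset.mem_image_of_mem _ (Finset.mem_univ _))
        h.1, Finset.orderEmbOfFin_unique hr
        (fun i => Finset.mem_image_of_mem _ (Finset.mem_univ _)) hmono]
    exact Equiv.ext fun i => hs (congrFun h1 i)
  · simp

/-- Summing over all permutations the function cut off to the simplex picks exactly one nonzero term
for an injective tuple. This extends measurability from increasing tuples to arbitrary ones. -/
theorem TimeMeasurable.exists_conf {X : Type*} [NormedAddCommGroup X] {si sf : ℝ}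
    {f : Finset ℝ → X} (hf : TimeMeasurable si sf f) : ∃ G : Conf → X, StronglyMeasurable G ∧
      ∀ c : Conf, Function.Injective c.2 → (∀ x ∈ c.times, x ∈ Set.Ioo si sf) →
        f c.times = G c := by
  choose g hg hfg using hf
  refine ⟨fun c => ∑ σ : Equiv.Perm (Fin c.1),
    (timeSimplex c.1 si sf).indicator (g c.1) (fun i => c.2 (σ i)), ?_, ?_⟩
  · refine stronglyMeasurable_conf fun n => ?_
    change StronglyMeasurable fun s : Fin n → ℝ => ∑ σ : Equiv.Perm (Fin n),
      (timeSimplex n si sf).indicator (g n) (fun i => s (σ i))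
    refine Finset.stronglyMeasurable_fun_sum _ fun σ _ => ?_
    exact ((hg n).indicator (measurableSet_timeSimplex n si sf)).comp_measurable
      (measurable_pi_lambda _ fun i => measurable_pi_apply _)
  · rintro ⟨n, s⟩ hs hI
    have hI' : ∀ i, s i ∈ Set.Ioo si sf := fun i =>
      hI _ (Finset.mem_image_of_mem _ (Finset.mem_univ _))
    rw [← sum_perm_timeSimplex hs hI' (f (Conf.times ⟨n, s⟩))]
    refine Finset.sum_congr rfl fun σ _ => ?_
    by_cases h : (fun i => s (σ i)) ∈ timeSimplex n si sf
    · rw [Set.indicator_of_mem h, Set.indicator_of_mem h, ← hfg n _ h, image_comp_perm]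
      rfl
    · rw [Set.indicator_of_notMem h, Set.indicator_of_notMem h]

/-- Lebesgue measure on configurations of times in an interval. -/
def timeMeasure (si sf : ℝ) : Measure Conf := confMeasure (volume.restrict (Set.Ioo si sf))

instance timeMeasure.sFinite (si sf : ℝ) : SFinite (timeMeasure si sf) :=
  confMeasure.sFinite

theorem ae_timeMeasure_mem (si sf : ℝ) :
    ∀ᵐ c ∂timeMeasure si sf, ∀ x ∈ c.times, x ∈ Set.Ioo si sf :=
  ae_conf_forall (ae_restrict_mem measurableSet_Ioo)

theorem ae_timeMeasure_injective (si sf : ℝ) : ∀ᵐ c ∂timeMeasure si sf, Function.Injective c.2 :=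
  ae_conf_injective

theorem ae_timeMeasure_disjoint (si sf : ℝ) (A : Finset ℝ) :
    ∀ᵐ c ∂timeMeasure si sf, Disjoint A c.times := ae_conf_disjoint A

theorem ae_timeMeasure_notMem (si sf x : ℝ) : ∀ᵐ c ∂timeMeasure si sf, x ∉ c.times :=
  ae_conf_notMem x

theorem ae_timeMeasure_prod_disjoint (si sf : ℝ) :
    ∀ᵐ z ∂(timeMeasure si sf).prod (timeMeasure si sf), Disjoint z.1.times z.2.times := by
  have hm : MeasurableSet {z : Conf × Conf | Disjoint z.1.times z.2.times} := by
    refine measurableSet_conf_prod fun m n => ?_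
    have : Prod.map (confMk m) (confMk n) ⁻¹' {z : Conf × Conf | Disjoint z.1.times z.2.times} =
        ⋂ i, ⋂ j, {z : (Fin m → ℝ) × (Fin n → ℝ) | z.1 i ≠ z.2 j} := by
      ext z
      simp [Conf.times, confMk, Finset.disjoint_left, eq_comm]
    rw [this]
    refine MeasurableSet.iInter fun i => MeasurableSet.iInter fun j => MeasurableSet.compl ?_
    exact measurableSet_eq_fun ((measurable_pi_apply i).comp measurable_fst)
      ((measurable_pi_apply j).comp measurable_snd)
  rw [Measure.ae_prod_iff_ae_ae hm]
  exact Filter.Eventually.of_forall fun c => ae_timeMeasure_disjoint si sf c.times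

section

variable {X : Type*} [NormedAddCommGroup X] {si sf : ℝ} {f : Finset ℝ → X}

/-- Almost every configuration is disjoint from `A`, and then the union is realized by concatenating
tuples, which is a measurable operation. -/
theorem TimeMeasurable.union_left (hf : TimeMeasurable si sf f) {A : Finset ℝ}
    (hA : ∀ x ∈ A, x ∈ Set.Ioo si sf) :
    AEStronglyMeasurable (fun c : Conf => f (A ∪ c.times)) (timeMeasure si sf) := by
  obtain ⟨G, hG, hfG⟩ := hf.exists_conf
  refine ⟨fun c => G ((confOf A).append c), hG.comp_measurable
    (Conf.measurable_append.comp (measurable_const.prodMk measurable_id)), ?_⟩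
  filter_upwards [ae_timeMeasure_mem si sf, ae_timeMeasure_injective si sf,
    ae_timeMeasure_disjoint si sf A] with c h1 h2 h3
  have h4 : ((confOf A).append c).times = A ∪ c.times := by
    rw [Conf.times_append, times_confOf]
  rw [← h4]
  refine hfG _ (Conf.append_injective (A.orderEmbOfFin rfl).injective h2
    (by rwa [times_confOf])) fun x hx => ?_
  rw [h4, Finset.mem_union] at hx
  exact hx.elim (hA x) (h1 x)

theorem TimeMeasurable.aestronglyMeasurable (hf : TimeMeasurable si sf f) :
    AEStronglyMeasurable (fun c : Conf => f c.times) (timeMeasure si sf) := by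
  simpa using hf.union_left (A := ∅) (by simp)

theorem TimeMeasurable.union (hf : TimeMeasurable si sf f) :
    AEStronglyMeasurable (fun z : Conf × Conf => f (z.1.times ∪ z.2.times))
      ((timeMeasure si sf).prod (timeMeasure si sf)) := by
  obtain ⟨G, hG, hfG⟩ := hf.exists_conf
  refine ⟨fun z => G (z.1.append z.2), hG.comp_measurable Conf.measurable_append, ?_⟩
  have e1 := Measure.quasiMeasurePreserving_fst (μ := timeMeasure si sf) (ν := timeMeasure si sf)
  have e2 := Measure.quasiMeasurePreserving_snd (μ := timeMeasure si sf) (ν := timeMeasure si sf)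
  filter_upwards [e1.ae (ae_timeMeasure_mem si sf), e1.ae (ae_timeMeasure_injective si sf),
    e2.ae (ae_timeMeasure_mem si sf), e2.ae (ae_timeMeasure_injective si sf),
    ae_timeMeasure_prod_disjoint si sf] with z h1 h2 h3 h4 h5
  rw [← Conf.times_append]
  refine hfG _ (Conf.append_injective h2 h4 h5) fun x hx => ?_
  rw [Conf.times_append, Finset.mem_union] at hx
  exact hx.elim (h1 x) (h3 x)

end

/-! ### Integrals over configurations -/

section

variable {X : Type*} [NormedAddCommGroup X]

theorem integrable_smul_map_confSplit_iff {ν : Measure ℝ} {N : ℕ} {S : Finset (Fin N)}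
    {Φ : Conf × Conf → X} :
    Integrable Φ ((N.factorial : ℝ≥0∞)⁻¹ • (Measure.pi fun _ : Fin N => ν).map (confSplit S)) ↔
      Integrable Φ ((Measure.pi fun _ : Fin N => ν).map (confSplit S)) :=
  integrable_smul_measure (factorial_inv_ne_zero N) (factorial_inv_ne_top N)

theorem integral_sum_confSplit [NormedSpace ℝ X] {ν : Measure ℝ} {N : ℕ}
    {Φ : Conf × Conf → X} (h : Integrable Φ (Measure.sum fun S : Finset (Fin N) =>
      (N.factorial : ℝ≥0∞)⁻¹ • (Measure.pi fun _ : Fin N => ν).map (confSplit S))) :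
    (∀ S, Integrable (fun s => Φ (confSplit S s)) (Measure.pi fun _ : Fin N => ν)) ∧
    ∫ z, Φ z ∂(Measure.sum fun S : Finset (Fin N) =>
      (N.factorial : ℝ≥0∞)⁻¹ • (Measure.pi fun _ : Fin N => ν).map (confSplit S)) =
      (N.factorial : ℝ)⁻¹ • ∫ s, ∑ S, Φ (confSplit S s) ∂(Measure.pi fun _ : Fin N => ν) := by
  have h1 : ∀ S, Integrable Φ ((Measure.pi fun _ : Fin N => ν).map (confSplit S)) := fun S =>
    integrable_smul_map_confSplit_iff.1 ((integrable_sum_measure_iff.1 h).1 S)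
  have h2 : ∀ S : Finset (Fin N), Integrable (fun s => Φ (confSplit S s))
      (Measure.pi fun _ : Fin N => ν) := fun S => (h1 S).comp_measurable (measurable_confSplit S)
  refine ⟨h2, ?_⟩
  rw [(hasSum_integral_measure h).tsum_eq.symm.trans (tsum_fintype _),
    integral_finsetSum _ fun S _ => h2 S, Finset.smul_sum]
  refine Finset.sum_congr rfl fun S _ => ?_
  rw [integral_smul_measure, integral_map (measurable_confSplit S).aemeasurable
    (h1 S).aestronglyMeasurable]
  simp

theorem integrable_confSplit {ν : Measure ℝ} [SigmaFinite ν] {Φ : Conf × Conf → X}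
    (h : Integrable Φ ((confMeasure ν).prod (confMeasure ν))) :
    Integrable (fun c : Conf => ∑ S : Finset (Fin c.1), Φ (confSplit S c.2)) (confMeasure ν) := by
  rw [confMeasure_prod, integrable_sum_measure_iff] at h
  obtain ⟨h1, h2⟩ := h
  have h3 : ∀ (N : ℕ) (S : Finset (Fin N)), Integrable (fun s => Φ (confSplit S s))
      (Measure.pi fun _ : Fin N => ν) := by
    intro N S
    exact ((integrable_smul_map_confSplit_iff).1
      ((integrable_sum_measure_iff.1 (h1 N)).1 S)).comp_measurable (measurable_confSplit S)
  rw [integrable_conf_iff]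
  constructor
  · intro N
    change Integrable (fun s => ∑ S : Finset (Fin N), Φ (confSplit S s)) _
    exact integrable_finsetSum _ fun S _ => h3 N S
  · refine Summable.of_nonneg_of_le (fun N => by positivity) (fun N => ?_) h2
    rw [(integral_sum_confSplit (h1 N).norm).2, smul_eq_mul]
    refine mul_le_mul_of_nonneg_left ?_ (by positivity)
    change ∫ s, ‖∑ S : Finset (Fin N), Φ (confSplit S s)‖ ∂_ ≤ _
    have h4 : Integrable (fun s => ∑ S : Finset (Fin N), Φ (confSplit S s))
      (Measure.pi fun _ : Fin N => ν) := integrable_finsetSum _ fun S _ => h3 N S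
    have h5 : Integrable (fun s => ∑ S : Finset (Fin N), ‖Φ (confSplit S s)‖)
      (Measure.pi fun _ : Fin N => ν) := integrable_finsetSum _ fun S _ => (h3 N S).norm
    exact integral_mono h4.norm h5 fun s => norm_sum_le _ _

/-- The norms stand inside the sum over splittings, so nothing cancels. Integrability in two
configurations can therefore be tested on their union. -/
theorem integrable_of_confSplit {ν : Measure ℝ} [SigmaFinite ν] {Φ : Conf × Conf → X}
    (hm : AEStronglyMeasurable Φ ((confMeasure ν).prod (confMeasure ν)))
    (h : Integrable (fun c : Conf => ∑ S : Finset (Fin c.1), ‖Φ (confSplit S c.2)‖)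
      (confMeasure ν)) : Integrable Φ ((confMeasure ν).prod (confMeasure ν)) := by
  rw [confMeasure_prod] at hm ⊢
  rw [integrable_conf_iff] at h
  have hm' : ∀ (N : ℕ) (S : Finset (Fin N)), AEStronglyMeasurable Φ
      ((Measure.pi fun _ : Fin N => ν).map (confSplit S)) := by
    intro N S
    have := aestronglyMeasurable_sum_measure_iff.1 (aestronglyMeasurable_sum_measure_iff.1 hm N) S
    exact ⟨this.mk Φ, this.stronglyMeasurable_mk,
      (Measure.ae_ennreal_smul_measure_iff (factorial_inv_ne_zero N)).1 this.ae_eq_mk⟩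
  have h3 : ∀ (N : ℕ) (S : Finset (Fin N)), Integrable (fun s => Φ (confSplit S s))
      (Measure.pi fun _ : Fin N => ν) := by
    intro N S
    refine (h.1 N).mono ((hm' N S).comp_measurable (measurable_confSplit S))
      (Filter.Eventually.of_forall fun s => ?_)
    rw [Real.norm_of_nonneg (Finset.sum_nonneg fun _ _ => norm_nonneg _)]
    exact Finset.single_le_sum (f := fun S : Finset (Fin N) => ‖Φ (confSplit S s)‖)
      (fun _ _ => norm_nonneg _) (Finset.mem_univ S)
  have h4 : ∀ (N : ℕ) (S : Finset (Fin N)), Integrable Φ ((N.factorial : ℝ≥0∞)⁻¹ •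
      (Measure.pi fun _ : Fin N => ν).map (confSplit S)) := by
    intro N S
    rw [integrable_smul_measure (factorial_inv_ne_zero N) (factorial_inv_ne_top N),
      integrable_map_measure (hm' N S) (measurable_confSplit S).aemeasurable]
    exact h3 N S
  have h5 : ∀ N : ℕ, Integrable Φ (Measure.sum fun S : Finset (Fin N) =>
      (N.factorial : ℝ≥0∞)⁻¹ • (Measure.pi fun _ : Fin N => ν).map (confSplit S)) := fun N =>
    integrable_sum_measure_iff.2 ⟨h4 N, (hasSum_fintype _).summable⟩
  refine integrable_sum_measure_iff.2 ⟨h5, h.2.congr fun N => ?_⟩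
  rw [(integral_sum_confSplit (h5 N).norm).2, smul_eq_mul]
  simp only [Real.norm_of_nonneg (Finset.sum_nonneg fun _ _ => norm_nonneg _)]

theorem integral_confSplit [NormedSpace ℝ X] {ν : Measure ℝ} [SigmaFinite ν]
    {Φ : Conf × Conf → X} (h : Integrable Φ ((confMeasure ν).prod (confMeasure ν))) :
    ∫ c, ∑ S : Finset (Fin c.1), Φ (confSplit S c.2) ∂confMeasure ν =
      ∫ z, Φ z ∂(confMeasure ν).prod (confMeasure ν) := by
  have hI := integrable_confSplit h
  rw [confMeasure_prod] at h ⊢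
  have h1 := (integrable_sum_measure_iff.1 h).1
  refine (hasSum_integral_conf hI).unique ?_
  convert hasSum_integral_measure h using 2 with N
  rw [(integral_sum_confSplit (h1 N)).2]

end

end

noncomputable section

open MeasureTheory
open scoped ENNReal

/-! ### Splitting a configuration, its last time, and the passage to simplices -/

section

variable {X : Type*} [NormedAddCommGroup X] {si sf : ℝ}

theorem sum_finset_image {N : ℕ} {s : Fin N → ℝ} (hs : Function.Injective s)
    (Φ : Finset ℝ → Finset ℝ → X) : ∑ S : Finset (Fin N), Φ (S.image s) (Sᶜ.image s) =
      ∑ A ∈ (Finset.univ.image s).powerset, Φ A (Finset.univ.image s \ A) := by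
  refine Finset.sum_bij (fun S _ => S.image s) ?_ ?_ ?_ ?_
  · exact fun S _ => Finset.mem_powerset.2 (Finset.image_subset_image (Finset.subset_univ _))
  · exact fun S _ S' _ h => Finset.image_injective hs h
  · intro A hA
    obtain ⟨S, -, rfl⟩ := Finset.subset_image_iff.1 (Finset.mem_powerset.1 hA)
    exact ⟨S, Finset.mem_univ _, rfl⟩
  · intro S _
    rw [← Finset.image_sdiff _ _ hs, Finset.compl_eq_univ_sdiff]

theorem times_confSplit {N : ℕ} (S : Finset (Fin N)) (s : Fin N → ℝ) :
    (confSplit S s).1.times = S.image s ∧ (confSplit S s).2.times = Sᶜ.image s :=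
  ⟨times_confRestrict _ _, times_confRestrict _ _⟩

/-- Integrating over two configurations is integrating over their union, summed over all ways to
split the union. -/
theorem integral_prod_times [NormedSpace ℝ X] {Φ : Finset ℝ → Finset ℝ → X}
    (h : Integrable (fun z : Conf × Conf => Φ z.1.times z.2.times)
      ((timeMeasure si sf).prod (timeMeasure si sf))) :
    ∫ z : Conf × Conf, Φ z.1.times z.2.times ∂(timeMeasure si sf).prod (timeMeasure si sf) =
      ∫ c : Conf, ∑ A ∈ c.times.powerset, Φ A (c.times \ A) ∂timeMeasure si sf := by
  refine (integral_confSplit h).symm.trans (integral_congr_ae ?_)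
  filter_upwards [ae_timeMeasure_injective si sf] with c hc
  simp only [times_confSplit]
  exact sum_finset_image hc Φ

/-- The empty configuration is an atom of mass one: it is the whole sector n = 0, with weight 1/0!.
-/
theorem integral_timeMeasure_empty [NormedSpace ℝ X] [CompleteSpace X] (x : X) :
    Integrable (fun c : Conf => if c.times = ∅ then x else 0) (timeMeasure si sf) ∧
    ∫ c : Conf, (if c.times = ∅ then x else 0) ∂timeMeasure si sf = x := by
  have h0 : ∀ (n : ℕ) (s : Fin n → ℝ), (Conf.times ⟨n, s⟩ = ∅) ↔ n = 0 := by
    intro n s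
    simp only [Conf.times, Finset.image_eq_empty]
    constructor
    · intro h
      by_contra hn
      have : Nonempty (Fin n) := ⟨⟨0, Nat.pos_of_ne_zero hn⟩⟩
      exact Finset.univ_nonempty.ne_empty h
    · rintro rfl
      rfl
  have hi : Integrable (fun c : Conf => if c.times = ∅ then x else 0) (timeMeasure si sf) := by
    refine integrable_conf_iff.2 ⟨fun n => ?_, summable_of_ne_finset_zero (s := {0}) fun n hn => ?_⟩
    · simp only [h0]
      exact integrable_const _
    · simp only [h0]
      simp [Finset.mem_singleton.not.1 hn]
  refine ⟨hi, ?_⟩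
  refine (hasSum_integral_conf hi).unique ?_
  simp only [h0]
  convert hasSum_single (f := fun n : ℕ => ((n.factorial : ℝ)⁻¹ • ∫ _ : Fin n → ℝ,
    (if n = 0 then x else 0) ∂(Measure.pi fun _ : Fin n => volume.restrict (Set.Ioo si sf)))) 0
    (fun n hn => by simp [hn]) using 1
  simp [Measure.real]

/-- Indicator that the first configuration is a single time that is later than all times of the
second one. -/
def lastTimeSet : Set (Conf × Conf) := {z | z.1.1 = 1 ∧ ∀ i j, z.2.2 j < z.1.2 i}

theorem measurableSet_lastTimeSet : MeasurableSet lastTimeSet := by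
  refine measurableSet_conf_prod fun m n => ?_
  by_cases hm : m = 1
  · have : Prod.map (confMk m) (confMk n) ⁻¹' lastTimeSet =
        ⋂ i, ⋂ j, {z : (Fin m → ℝ) × (Fin n → ℝ) | z.2 j < z.1 i} := by
      ext z
      simp [lastTimeSet, confMk, hm]
    rw [this]
    refine MeasurableSet.iInter fun i => MeasurableSet.iInter fun j => ?_
    exact measurableSet_lt ((measurable_pi_apply j).comp measurable_snd)
      ((measurable_pi_apply i).comp measurable_fst)
  · have : Prod.map (confMk m) (confMk n) ⁻¹' lastTimeSet = ∅ := by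
      ext z
      simp [lastTimeSet, confMk, hm]
    rw [this]
    exact MeasurableSet.empty

theorem confSplit_mem_lastTimeSet_iff {N : ℕ} {S : Finset (Fin N)} {s : Fin N → ℝ} :
    confSplit S s ∈ lastTimeSet ↔ ∃ i, S = {i} ∧ ∀ j, j ≠ i → s j < s i := by
  have h : confSplit S s ∈ lastTimeSet ↔ S.card = 1 ∧
      ∀ x ∈ (confSplit S s).1.times, ∀ y ∈ (confSplit S s).2.times, y < x := by
    simp only [Conf.mem_times]
    constructor
    · rintro ⟨h1, h2⟩
      refine ⟨h1, ?_⟩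
      rintro x ⟨i, rfl⟩ y ⟨j, rfl⟩
      exact h2 i j
    · rintro ⟨h1, h2⟩
      exact ⟨h1, fun i j => h2 _ ⟨i, rfl⟩ _ ⟨j, rfl⟩⟩
  rw [h, (times_confSplit S s).1, (times_confSplit S s).2]
  constructor
  · rintro ⟨h1, h2⟩
    obtain ⟨i, rfl⟩ := Finset.card_eq_one.1 h1
    exact ⟨i, rfl, fun j hj => h2 _ (by simp) _ (Finset.mem_image_of_mem _ (by simpa using hj))⟩
  · rintro ⟨i, rfl, hi⟩
    refine ⟨Finset.card_singleton _, ?_⟩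
    intro x hx y hy
    simp only [Finset.image_singleton, Finset.mem_singleton] at hx
    obtain ⟨j, hj, rfl⟩ := Finset.mem_image.1 hy
    rw [hx]
    exact hi j (by simpa using hj)

/-- Among all splittings of a nonempty injective tuple, exactly the one that isolates the maximum
lies in `lastTimeSet`. -/
theorem sum_lastTimeSet {N : ℕ} {s : Fin N → ℝ} (hs : Function.Injective s) (x : X) :
    ∑ S : Finset (Fin N), lastTimeSet.indicator (fun _ => x) (confSplit S s) =
      if Finset.univ.image s = ∅ then 0 else x := by
  classical
  rcases Nat.eq_zero_or_pos N with rfl | hN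
  · rw [if_pos (by simp)]
    refine Finset.sum_eq_zero fun S _ => Set.indicator_of_notMem (fun h => ?_) _
    obtain ⟨i, -⟩ := confSplit_mem_lastTimeSet_iff.1 h
    exact i.elim0
  · have : Nonempty (Fin N) := ⟨⟨0, hN⟩⟩
    rw [if_neg (by simp [Finset.image_eq_empty, Finset.univ_nonempty.ne_empty])]
    obtain ⟨i, hi⟩ := Finite.exists_max s
    have hi' : ∀ j, j ≠ i → s j < s i := fun j hj => (hi j).lt_of_ne fun h => hj (hs h)
    rw [Finset.sum_eq_single {i}]
    · exact Set.indicator_of_mem (confSplit_mem_lastTimeSet_iff.2 ⟨i, rfl, hi'⟩) _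
    · intro S _ hS
      refine Set.indicator_of_notMem (fun h => hS ?_) _
      obtain ⟨k, rfl, hk⟩ := confSplit_mem_lastTimeSet_iff.1 h
      by_contra hne
      have hki : i ≠ k := fun h => hne (by rw [h])
      exact absurd (hk i hki) (not_lt.2 (hi k))
    · simp

/-- Integrating over configurations by integrating over the last time and the earlier ones. -/
theorem integral_times_last [NormedSpace ℝ X] [CompleteSpace X] {f : Finset ℝ → X}
    (hm : TimeMeasurable si sf f)
    (h : Integrable (fun c : Conf => f c.times) (timeMeasure si sf)) :
    ∫ c : Conf, f c.times ∂timeMeasure si sf = f ∅ + ∫ x in Set.Ioo si sf, ∫ c : Conf,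
      (if ∀ y ∈ c.times, y < x then f (insert x c.times) else 0) ∂timeMeasure si sf := by
  classical
  set μ := timeMeasure si sf with hμ
  -- Summed over all splittings of a configuration, `Φ` returns `f` there, except at the empty
  -- configuration, where it returns 0; hence the separate term `f ∅`.
  let Φ : Conf × Conf → X := lastTimeSet.indicator fun z => f (z.1.times ∪ z.2.times)
  have hsplit : ∀ c : Conf, ∀ S : Finset (Fin c.1), Φ (confSplit S c.2) =
      lastTimeSet.indicator (fun _ => f c.times) (confSplit S c.2) := by
    intro c S
    by_cases hS : confSplit S c.2 ∈ lastTimeSet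
    · simp only [Φ, Set.indicator_of_mem hS]
      rw [(times_confSplit S c.2).1, (times_confSplit S c.2).2, ← Finset.image_union,
        Finset.union_compl, Conf.times]
    · simp only [Φ, Set.indicator_of_notMem hS]
  have hΦm : AEStronglyMeasurable Φ (μ.prod μ) := hm.union.indicator measurableSet_lastTimeSet
  have hΦ : Integrable Φ (μ.prod μ) := by
    refine integrable_of_confSplit hΦm ?_
    refine h.norm.mono' ?_ ?_
    · have h1 : Integrable (fun c : Conf => if c.times = ∅ then ‖f ∅‖ else 0) μ :=
        (integral_timeMeasure_empty _).1
      refine ((h.norm.sub h1).aestronglyMeasurable).congr ?_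
      filter_upwards [ae_timeMeasure_injective si sf] with c hc
      have := sum_lastTimeSet hc ‖f c.times‖
      rw [← Conf.times] at this
      simp only [hsplit, norm_indicator_eq_indicator_norm, Pi.sub_apply]
      rw [this]
      split_ifs with h2
      · simp [h2]
      · simp
    · filter_upwards [ae_timeMeasure_injective si sf] with c hc
      have := sum_lastTimeSet hc ‖f c.times‖
      simp only [hsplit, norm_indicator_eq_indicator_norm]
      rw [this]
      split_ifs <;> simp
  have h1 := integral_confSplit hΦ
  have h2 : ∫ c : Conf, f c.times ∂μ = f ∅ + ∫ z, Φ z ∂μ.prod μ := by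
    have h3 := integral_timeMeasure_empty (si := si) (sf := sf) (f ∅)
    have h4 : ∫ c : Conf, f c.times ∂μ = ∫ c : Conf, ((if c.times = ∅ then f ∅ else 0) +
        ∑ S : Finset (Fin c.1), Φ (confSplit S c.2)) ∂μ := by
      refine integral_congr_ae ?_
      filter_upwards [ae_timeMeasure_injective si sf] with c hc
      have := sum_lastTimeSet hc (f c.times)
      rw [← Conf.times] at this
      simp only [hsplit]
      rw [this]
      split_ifs with h2
      · simp [h2]
      · simp
    rw [h4, integral_add h3.1 (integrable_confSplit hΦ), h3.2]
    exact congrArg _ h1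
  rw [h2, integral_prod _ hΦ]
  congr 1
  refine (hasSum_integral_conf hΦ.integral_prod_left).unique ?_
  -- Only one-point first configurations contribute; their weight is 1/1! and their measure is the
  -- measure on the line.
  convert hasSum_single (f := fun n : ℕ => ((n.factorial : ℝ)⁻¹ • ∫ s : Fin n → ℝ,
    ∫ c', Φ (⟨n, s⟩, c') ∂μ ∂(Measure.pi fun _ : Fin n => volume.restrict (Set.Ioo si sf)))) 1
    (fun n hn => ?_) using 1
  · have hmp := measurePreserving_funUnique (volume.restrict (Set.Ioo si sf)) (Fin 1)
    rw [Nat.factorial_one, Nat.cast_one, inv_one, one_smul]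
    rw [← hmp.integral_comp' (g := fun x => ∫ c : Conf,
      (if ∀ y ∈ c.times, y < x then f (insert x c.times) else 0) ∂μ)]
    refine integral_congr_ae (Filter.Eventually.of_forall fun s => ?_)
    refine integral_congr_ae (Filter.Eventually.of_forall fun c => ?_)
    have ht : Conf.times ⟨1, s⟩ = {s 0} := by simp [Conf.times]
    have hs0 : MeasurableEquiv.funUnique (Fin 1) ℝ s = s 0 := rfl
    simp only [Φ, Set.indicator, lastTimeSet, Set.mem_ofPred_eq, true_and, ht, hs0,
      Finset.singleton_union]
    have : (∀ y ∈ c.times, y < s 0) ↔ ∀ (i : Fin 1) j, c.2 j < s i := by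
      constructor
      · intro h i j
        rw [Subsingleton.elim i 0]
        exact h _ (Conf.mem_times.2 ⟨j, rfl⟩)
      · intro h y hy
        obtain ⟨j, rfl⟩ := Conf.mem_times.1 hy
        exact h 0 j
    by_cases h3 : ∀ y ∈ c.times, y < s 0
    · rw [if_pos (this.1 h3)]
      exact if_pos h3
    · rw [if_neg fun h => h3 (this.2 h)]
      exact if_neg h3
  · have : ∀ s : Fin n → ℝ, ∫ c', Φ (⟨n, s⟩, c') ∂μ = 0 := fun s => by
      simp [Φ, lastTimeSet, hn]
    simp [this]

/-- Integrals over configurations are sums of integrals over simplices. -/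
theorem hasSum_integral_timeSimplex [NormedSpace ℝ X] {f : Finset ℝ → X}
    (h : Integrable (fun c : Conf => f c.times) (timeMeasure si sf)) :
    (∀ n, IntegrableOn (fun s : Fin n → ℝ => f (Finset.univ.image s)) (timeSimplex n si sf)) ∧
    HasSum (fun n : ℕ => ∫ s in timeSimplex n si sf, f (Finset.univ.image s))
      (∫ c : Conf, f c.times ∂timeMeasure si sf) := by
  classical
  have hr : ∀ n : ℕ, (Measure.pi fun _ : Fin n => (volume : Measure ℝ).restrict (Set.Ioo si sf)) =
      (volume : Measure (Fin n → ℝ)).restrict (Set.univ.pi fun _ => Set.Ioo si sf) := fun n => by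
    rw [volume_pi, Measure.restrict_pi_pi]
  have hsub : ∀ n, timeSimplex n si sf ⊆ Set.univ.pi fun _ => Set.Ioo si sf :=
    fun n s hs i _ => hs.2 i
  have h1 := (integrable_conf_iff.1 h).1
  have h2 : ∀ n, IntegrableOn (fun s : Fin n → ℝ => f (Finset.univ.image s))
      (timeSimplex n si sf) := by
    intro n
    have := h1 n
    rw [hr] at this
    exact this.mono_measure (Measure.restrict_mono (hsub n) le_rfl)
  refine ⟨h2, ?_⟩
  have hsum := hasSum_integral_conf h
  rw [← timeMeasure] at hsum
  refine hsum.congr_fun fun n => ?_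
  set π := Measure.pi fun _ : Fin n => (volume : Measure ℝ).restrict (Set.Ioo si sf) with hπ
  -- The cube is, up to a null set, the union of the n! images of the simplex under permutations.
  -- They contribute equally, which cancels the factor 1/n!.
  let g : (Fin n → ℝ) → X := (timeSimplex n si sf).indicator fun s => f (Finset.univ.image s)
  have hg : Integrable g π := (h1 n).indicator (measurableSet_timeSimplex n si sf)
  have h3 : ∫ s, f (Conf.times ⟨n, s⟩) ∂π =
      ∫ s, ∑ σ : Equiv.Perm (Fin n), g (fun i => s (σ i)) ∂π := by
    refine integral_congr_ae ?_
    have hin : ∀ᵐ s ∂π, s ∈ Set.univ.pi fun _ : Fin n => Set.Ioo si sf := by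
      rw [hπ, hr]
      exact ae_restrict_mem (MeasurableSet.univ_pi fun _ => measurableSet_Ioo)
    filter_upwards [ae_pi_injective n, hin] with s hs hsI
    rw [← sum_perm_timeSimplex hs (fun i => hsI i trivial) (f (Conf.times ⟨n, s⟩))]
    refine Finset.sum_congr rfl fun σ _ => ?_
    simp only [g, Set.indicator, image_comp_perm]
    rfl
  rw [h3, integral_finsetSum]
  · have h4 : ∀ σ : Equiv.Perm (Fin n), ∫ s, g (fun i => s (σ i)) ∂π = ∫ s, g s ∂π := by
      intro σ
      have hmp : MeasurePreserving _ π π := measurePreserving_comp_equiv σ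
      have := integral_map hmp.measurable.aemeasurable (f := g)
        (by rw [hmp.map_eq]; exact hg.aestronglyMeasurable)
      rw [hmp.map_eq] at this
      exact this.symm
    simp_rw [h4]
    rw [Finset.sum_const, Finset.card_univ, Fintype.card_perm, Fintype.card_fin,
      ← Nat.cast_smul_eq_nsmul ℝ, smul_smul, inv_mul_cancel₀ (by positivity), one_smul,
      integral_indicator (measurableSet_timeSimplex n si sf), hπ, hr,
      Measure.restrict_restrict (measurableSet_timeSimplex n si sf),
      Set.inter_eq_left.2 (hsub n)]
  · intro σ _
    have hmp : MeasurePreserving _ π π := measurePreserving_comp_equiv σ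
    exact hmp.integrable_comp_of_integrable hg

end

/-! ### Reflecting configurations -/

/-- The reflection of a configuration that exchanges the endpoints of the interval. -/
def confReflect (r : ℝ) (c : Conf) : Conf := ⟨c.1, fun i => r - c.2 i⟩

theorem times_confReflect (r : ℝ) (c : Conf) :
    (confReflect r c).times = c.times.image fun x => r - x := by
  ext x
  rw [Conf.mem_times, Finset.mem_image]
  constructor
  · rintro ⟨i, rfl⟩
    exact ⟨_, Conf.mem_times.2 ⟨i, rfl⟩, rfl⟩
  · rintro ⟨y, hy, rfl⟩
    obtain ⟨i, rfl⟩ := Conf.mem_times.1 hy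
    exact ⟨i, rfl⟩

theorem measurePreserving_confReflect (si sf : ℝ) :
    MeasurePreserving (confReflect (si + sf)) (timeMeasure si sf) (timeMeasure si sf) := by
  have hm : Measurable (confReflect (si + sf)) := by
    intro T hT
    refine measurableSet_conf fun n => ?_
    have : Measurable fun s : Fin n → ℝ => confMk n fun i => si + sf - s i :=
      (measurableEmbedding_confMk n).measurable.comp
        (measurable_pi_lambda _ fun i => (measurable_pi_apply i).const_sub _)
    exact this hT
  have h1 : MeasurePreserving (fun x : ℝ => si + sf - x) (volume.restrict (Set.Ioo si sf))
      (volume.restrict (Set.Ioo si sf)) := by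
    have := (Measure.measurePreserving_sub_left (volume : Measure ℝ) (si + sf)).restrict_preimage
      (measurableSet_Ioo (a := si) (b := sf))
    simpa [Set.preimage_const_sub_Ioo] using this
  refine ⟨hm, Measure.ext_of_lintegral _ fun f hf => ?_⟩
  rw [lintegral_map hf hm, timeMeasure, lintegral_conf, lintegral_conf]
  congr 1
  ext n
  congr 1
  exact (measurePreserving_pi (fun _ : Fin n => volume.restrict (Set.Ioo si sf))
    (fun _ : Fin n => volume.restrict (Set.Ioo si sf)) fun _ => h1).lintegral_comp
    (f := fun s => f ⟨n, s⟩) (hf.comp (measurableEmbedding_confMk n).measurable)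

end

noncomputable section

/-! ### Elementary tensors and traces -/

section Tensor

variable {E F : Type*} [NormedAddCommGroup E] [InnerProductSpace ℂ E]
  [NormedAddCommGroup F] [InnerProductSpace ℂ F]

theorem inner_elemTensor (x x' : E) (y y' : F) :
    ⟪elemTensor x y, elemTensor x' y'⟫_ℂ = ⟪x, x'⟫_ℂ * ⟪y, y'⟫_ℂ := by
  rw [elemTensor, elemTensor, UniformSpace.Completion.inner_coe, TensorProduct.inner_tmul]

theorem norm_elemTensor (x : E) (y : F) : ‖elemTensor x y‖ = ‖x‖ * ‖y‖ := by
  rw [elemTensor, UniformSpace.Completion.norm_coe, TensorProduct.norm_tmul]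

/-- The elementary tensor as a continuous bilinear map. -/
def elemTensorL : E →L[ℂ] F →L[ℂ] HilbertTensor E F :=
  (ContinuousLinearMap.compL ℂ F (E ⊗[ℂ] F) (HilbertTensor E F)
    (UniformSpace.Completion.toComplL (𝕜 := ℂ) (E := E ⊗[ℂ] F))).comp (TensorProduct.mkL ℂ E F)

theorem elemTensorL_apply (x : E) (y : F) : elemTensorL x y = elemTensor x y := rfl

theorem elemTensor_smul_left (c : ℂ) (x : E) (y : F) :
    elemTensor (c • x) y = c • elemTensor x y := by
  simp only [← elemTensorL_apply, map_smul, _root_.smul_apply]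

theorem elemTensor_smul_right (c : ℂ) (x : E) (y : F) :
    elemTensor x (c • y) = c • elemTensor x y := by
  simp only [← elemTensorL_apply, map_smul]

theorem continuous_elemTensor : Continuous fun z : E × F => elemTensor z.1 z.2 :=
  (UniformSpace.Completion.continuous_coe _).comp TensorProduct.continuous_tmul

theorem tensorOp_elemTensor (A : E →L[ℂ] E) (B : F →L[ℂ] F) (x : E) (y : F) :
    tensorOp A B (elemTensor x y) = elemTensor (A x) (B y) := by
  rw [tensorOp, elemTensor, ContinuousLinearMap.completion_apply_coe, elemTensor]
  rfl

theorem hilbertTensor_ext {G : Type*} [NormedAddCommGroup G] [NormedSpace ℂ G]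
    {A B : HilbertTensor E F →L[ℂ] G}
    (h : ∀ x y, A (elemTensor x y) = B (elemTensor x y)) : A = B := by
  ext z
  refine UniformSpace.Completion.induction_on z (isClosed_eq A.continuous B.continuous) fun w => ?_
  induction w using TensorProduct.induction_on with
  | zero => rw [UniformSpace.Completion.coe_zero, map_zero, map_zero]
  | tmul x y => exact h x y
  | add x y hx hy => rw [UniformSpace.Completion.coe_add, map_add, map_add, hx, hy]

theorem tensorOp_mul (A A' : E →L[ℂ] E) (B B' : F →L[ℂ] F) :
    tensorOp A B * tensorOp A' B' = tensorOp (A * A') (B * B') :=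
  hilbertTensor_ext fun x y => by
    simp only [mul_apply_eq_comp, tensorOp_elemTensor]

end Tensor

section Trace

variable {E : Type*} [NormedAddCommGroup E] [InnerProductSpace ℂ E] [CompleteSpace E]

theorem HilbertBasis.hasSum_norm_inner_sq {ι : Type*} (b : HilbertBasis ι ℂ E) (x : E) :
    HasSum (fun i => ‖⟪b i, x⟫_ℂ‖ ^ 2) (‖x‖ ^ 2) := by
  have h := b.hasSum_inner_mul_inner x x
  rw [inner_self_eq_norm_sq_to_K] at h
  have h2 := Complex.hasSum_re h
  convert h2 using 1
  · ext i
    rw [← inner_conj_symm x (b i), ← Complex.normSq_eq_conj_mul_self, Complex.ofReal_re,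
      Complex.normSq_eq_norm_sq]
  · norm_cast

/-- The trace of `T X` for `T = ∑ i, |w i⟩⟨w i|`. -/
theorem hasSum_hilbertTrace {ι : Type*} {w : ι → E} (hw : Summable fun i => ‖w i‖ ^ 2)
    {T : E →L[ℂ] E} (hT : ∀ x, HasSum (fun i => ⟪w i, x⟫_ℂ • w i) (T x)) (X : E →L[ℂ] E) :
    HasSum (fun i => ⟪w i, X (w i)⟫_ℂ) (hilbertTrace (T * X)) := by
  set b := (exists_hilbertBasis ℂ E).choose_spec.choose with hb
  let X' := ContinuousLinearMap.adjoint X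
  have hsum : ∀ v : ι → E, (Summable fun i => ‖v i‖ ^ 2) →
      Summable fun z : ι × (exists_hilbertBasis ℂ E).choose => ‖⟪b z.2, v z.1⟫_ℂ‖ ^ 2 := by
    intro v hv
    refine (summable_prod_of_nonneg fun z => by positivity).2
      ⟨fun i => (b.hasSum_norm_inner_sq (v i)).summable, ?_⟩
    simp only [(b.hasSum_norm_inner_sq _).tsum_eq]
    exact hv
  have h1 := hsum w hw
  have h2 := hsum (fun i => X' (w i)) (by
    refine Summable.of_nonneg_of_le (fun i => by positivity) (fun i => ?_)
      (hw.mul_left (‖X'‖ ^ 2))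
    rw [← mul_pow]
    gcongr
    exact X'.le_opNorm _)
  -- The double family is dominated by half the sum of two squares. Absolute summability allows both
  -- orders: over the basis first it gives Σ ⟪w i, X (w i)⟫, over `ι` first the diagonal of `T * X`.
  have h3 : Summable fun z : ι × (exists_hilbertBasis ℂ E).choose =>
      ⟪X' (w z.1), b z.2⟫_ℂ * ⟪b z.2, w z.1⟫_ℂ := by
    refine Summable.of_norm_bounded ((h1.add h2).mul_left (1 / 2)) fun z => ?_
    rw [norm_mul, norm_inner_symm (X' (w z.1))]
    nlinarith [sq_nonneg (‖⟪b z.2, X' (w z.1)⟫_ℂ‖ - ‖⟪b z.2, w z.1⟫_ℂ‖)]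
  have h4 : HasSum (fun i => ⟪w i, X (w i)⟫_ℂ) (∑' z : ι × (exists_hilbertBasis ℂ E).choose,
      ⟪X' (w z.1), b z.2⟫_ℂ * ⟪b z.2, w z.1⟫_ℂ) := by
    refine h3.hasSum.prod_fiberwise fun i => ?_
    have := b.hasSum_inner_mul_inner (X' (w i)) (w i)
    rwa [ContinuousLinearMap.adjoint_inner_left] at this
  have h5 : HasSum (fun j => ⟪b j, (T * X) (b j)⟫_ℂ)
      (∑' z : ι × (exists_hilbertBasis ℂ E).choose,
        ⟪X' (w z.1), b z.2⟫_ℂ * ⟪b z.2, w z.1⟫_ℂ) := by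
    have h6 := (Equiv.prodComm _ _).hasSum_iff.2 h3.hasSum
    refine h6.prod_fiberwise fun j => ?_
    have := (hT (X (b j))).mapL (innerSL ℂ (b j))
    simp only [innerSL_apply_apply, inner_smul_right] at this
    simpa [X', ContinuousLinearMap.adjoint_inner_left, Function.comp_def] using this
  rw [hilbertTrace, h5.tsum_eq]
  exact h4

/-- A density operator is a countable sum of rank one operators. -/
theorem IsDensity.exists_decomposition {ρ : E →L[ℂ] E} (hρ : IsDensity ρ) :
    ∃ (ι : Set (exists_hilbertBasis ℂ E).choose) (w : ι → E), ι.Countable ∧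
      (Summable fun i => ‖w i‖ ^ 2) ∧ ∀ x, HasSum (fun i => ⟪w i, x⟫_ℂ • w i) (ρ x) := by
  set b := (exists_hilbertBasis ℂ E).choose_spec.choose with hb
  have hpos : 0 ≤ ρ := (ContinuousLinearMap.nonneg_iff_isPositive ρ).2 hρ.1
  -- The vectors are the images S b_j of the basis under S = √ρ: expanding S x in the basis and
  -- applying S gives ρ x = Σ ⟪S b_j, x⟫ S b_j.
  let S := CFC.sqrt ρ
  have hSS : S * S = ρ := CFC.sqrt_mul_sqrt_self ρ hpos
  have hSpos : S.IsPositive :=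
    (ContinuousLinearMap.nonneg_iff_isPositive _).1 (CFC.sqrt_nonneg ρ)
  have hS : ∀ x y, ⟪S x, y⟫_ℂ = ⟪x, S y⟫_ℂ := fun x y => hSpos.1 x y
  have hnorm : ∀ j, ⟪b j, ρ (b j)⟫_ℂ = ((‖S (b j)‖ ^ 2 : ℝ) : ℂ) := by
    intro j
    rw [← hSS, mul_apply_eq_comp, ← hS, inner_self_eq_norm_sq_to_K]
    norm_cast
  -- A divergent trace has the default value 0, which is not 1.
  have hsumm : Summable fun j => ‖S (b j)‖ ^ 2 := by
    by_contra hns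
    have h1 := hρ.2
    rw [hilbertTrace, ← hb] at h1
    simp only [hnorm] at h1
    rw [← Complex.ofReal_tsum, tsum_eq_zero_of_not_summable hns] at h1
    norm_num at h1
  have hsum : ∀ x, HasSum (fun j => ⟪S (b j), x⟫_ℂ • S (b j)) (ρ x) := by
    intro x
    have := (b.hasSum_repr (S x)).mapL S
    simp only [map_smul, HilbertBasis.repr_apply_apply, ← hS] at this
    rw [← hSS]
    exact this
  -- The space need not be separable. Only countably many of the vectors are nonzero, and the index
  -- set is cut down to these so that series of measurable functions stay measurable.
  refine ⟨Function.support fun j => ‖S (b j)‖ ^ 2, fun j => S (b j), hsumm.countable_support,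
    hsumm.subtype _, fun x => ?_⟩
  refine (hasSum_subtype_iff_of_support_subset (s := Function.support fun j => ‖S (b j)‖ ^ 2)
    (f := fun j => ⟪S (b j), x⟫_ℂ • S (b j)) ?_).2 (hsum x)
  intro j hj
  simp only [Function.mem_support] at hj ⊢
  intro h
  have : S (b j) = 0 := by simpa using h
  exact hj (by rw [this, smul_zero])

end Trace

/-! ### The thermal state and traces against product states -/

section Thermal

variable {κ E F : Type*} [NormedAddCommGroup E] [InnerProductSpace ℂ E] [CompleteSpace E]
  [NormedAddCommGroup F] [InnerProductSpace ℂ F] [CompleteSpace F]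

/-- The occupation probabilities of the thermal state. -/
def ThermalBath.prob (bath : ThermalBath κ F) (k : κ) : ℝ :=
  Real.exp (-(bath.β * bath.energy k)) / bath.partitionFn

theorem ThermalBath.prob_pos (bath : ThermalBath κ F) (k : κ) : 0 < bath.prob k :=
  div_pos (Real.exp_pos _)
    (bath.summable_boltzmann.tsum_pos (fun _ => (Real.exp_pos _).le) k (Real.exp_pos _))

theorem ThermalBath.summable_prob (bath : ThermalBath κ F) : Summable bath.prob :=
  bath.summable_boltzmann.div_const _

theorem ThermalBath.countable (bath : ThermalBath κ F) : Countable κ := by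
  have h := bath.summable_prob.countable_support
  have : Function.support bath.prob = Set.univ :=
    Set.eq_univ_of_forall fun k => (bath.prob_pos k).ne'
  rw [this] at h
  exact Set.countable_univ_iff.1 h

theorem ThermalBath.hasSum_state (bath : ThermalBath κ F) (y : F) :
    HasSum (fun k => (bath.prob k : ℂ) • ⟪bath.eigenvector k, y⟫_ℂ • bath.eigenvector k)
      (bath.state y) := by
  have h : Summable fun k => (bath.prob k : ℂ) •
      InnerProductSpace.rankOne ℂ (bath.eigenvector k) (bath.eigenvector k) := by
    refine Summable.of_norm_bounded bath.summable_prob fun k => ?_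
    rw [norm_smul, InnerProductSpace.norm_rankOne]
    simp [bath.eigenvector.orthonormal.norm_eq_one, abs_of_pos (bath.prob_pos k)]
  have h2 := h.hasSum.mapL (ContinuousLinearMap.apply ℂ F y)
  simpa [Function.comp_def, ThermalBath.state, ThermalBath.prob] using h2

theorem ThermalBath.inner_state (bath : ThermalBath κ F) (k : κ) (y : F) :
    ⟪bath.eigenvector k, bath.state y⟫_ℂ = bath.prob k * ⟪bath.eigenvector k, y⟫_ℂ := by
  classical
  have h := (bath.hasSum_state y).mapL (innerSL ℂ (bath.eigenvector k))
  have hne : ∀ j, j ≠ k → ⟪bath.eigenvector k, bath.eigenvector j⟫_ℂ = 0 := fun j hj =>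
    bath.eigenvector.orthonormal.2 hj.symm
  have h2 := hasSum_single (f := fun j => innerSL ℂ (bath.eigenvector k)
    ((bath.prob j : ℂ) • ⟪bath.eigenvector j, y⟫_ℂ • bath.eigenvector j)) k fun j hj => by
      simp [hne j hj]
  have h3 := h.unique h2
  simpa [inner_smul_right, inner_self_eq_norm_sq_to_K,
    bath.eigenvector.orthonormal.norm_eq_one] using h3

/-- The trace of `(ρ ⊗ ρ_b) X`, for `ρ = ∑ i, |w i⟩⟨w i|`. -/
theorem hasSum_hilbertTrace_tensor (bath : ThermalBath κ F) {ι : Type*} {w : ι → E}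
    (hw : Summable fun i => ‖w i‖ ^ 2) {ρ : E →L[ℂ] E}
    (hρ : ∀ x, HasSum (fun i => ⟪w i, x⟫_ℂ • w i) (ρ x))
    (X : HilbertTensor E F →L[ℂ] HilbertTensor E F) :
    HasSum (fun z : ι × κ => (bath.prob z.2 : ℂ) *
        ⟪elemTensor (w z.1) (bath.eigenvector z.2),
          X (elemTensor (w z.1) (bath.eigenvector z.2))⟫_ℂ)
      (hilbertTrace (tensorOp ρ bath.state * X)) := by
  -- Absorbing √p_k into the vectors writes ρ ⊗ ρ_b in the form Σ |v⟩⟨v| required by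
  -- `hasSum_hilbertTrace`.
  let v : ι × κ → HilbertTensor E F := fun z =>
    ((Real.sqrt (bath.prob z.2) : ℝ) : ℂ) • elemTensor (w z.1) (bath.eigenvector z.2)
  have hsq : ∀ k, ((Real.sqrt (bath.prob k) : ℝ) : ℂ) * ((Real.sqrt (bath.prob k) : ℝ) : ℂ) =
      bath.prob k := fun k => by
    rw [← Complex.ofReal_mul, Real.mul_self_sqrt (bath.prob_pos k).le]
  have hvn : ∀ z, ‖v z‖ ^ 2 = ‖w z.1‖ ^ 2 * bath.prob z.2 := by
    intro z
    rw [norm_smul, norm_elemTensor, bath.eigenvector.orthonormal.norm_eq_one, mul_one, mul_pow,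
      Complex.norm_real, Real.norm_of_nonneg (Real.sqrt_nonneg _),
      Real.sq_sqrt (bath.prob_pos _).le, mul_comm]
  have hv : Summable fun z => ‖v z‖ ^ 2 := by
    simp only [hvn]
    exact hw.mul_of_nonneg bath.summable_prob (fun _ => by positivity)
      fun k => (bath.prob_pos k).le
  have hR : Summable fun z => InnerProductSpace.rankOne ℂ (v z) (v z) := by
    refine Summable.of_norm_bounded hv fun z => ?_
    rw [InnerProductSpace.norm_rankOne, sq]
  have hT : tensorOp ρ bath.state = ∑' z, InnerProductSpace.rankOne ℂ (v z) (v z) := by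
    refine hilbertTensor_ext fun x y => ?_
    have h1 := hR.hasSum.mapL (ContinuousLinearMap.apply ℂ (HilbertTensor E F) (elemTensor x y))
    have h2 : HasSum (fun i => elemTensor (⟪w i, x⟫_ℂ • w i) (bath.state y))
        ((∑' z, InnerProductSpace.rankOne ℂ (v z) (v z)) (elemTensor x y)) := by
      refine h1.prod_fiberwise fun i => ?_
      have := (bath.hasSum_state y).mapL (elemTensorL (⟪w i, x⟫_ℂ • w i))
      simp only [elemTensorL_apply] at this
      convert this using 1
      ext k
      simp only [ContinuousLinearMap.apply_apply,
        InnerProductSpace.rankOne_apply, v, inner_smul_left, inner_elemTensor,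
        elemTensor_smul_left, elemTensor_smul_right, smul_smul, Complex.conj_ofReal]
      congr 1
      rw [← hsq]
      ring
    have h3 := (hρ x).mapL (elemTensorL.flip (bath.state y))
    simp only [ContinuousLinearMap.flip_apply, elemTensorL_apply] at h3
    rw [tensorOp_elemTensor]
    exact h3.unique h2
  have h := hasSum_hilbertTrace hv (T := tensorOp ρ bath.state) (fun z => ?_) X
  · convert h using 2 with z
    simp only [v, map_smul, inner_smul_left, inner_smul_right, Complex.conj_ofReal]
    rw [← mul_assoc, hsq]
  · rw [hT]
    have h1 := hR.hasSum.mapL (ContinuousLinearMap.apply ℂ (HilbertTensor E F) z)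
    simpa [Function.comp_def] using h1

end Thermal

end

noncomputable section

open MeasureTheory Filter

/-! ### Unitary groups -/

namespace Hamiltonian

variable {E : Type*} [NormedAddCommGroup E] [InnerProductSpace ℂ E] [CompleteSpace E]
  (H : Hamiltonian E)

theorem evol_add_apply (s r : ℝ) (x : E) : H.evol (s + r) x = H.evol s (H.evol r x) := by
  rw [H.evol_add]; rfl

theorem evol_zero_apply (x : E) : H.evol 0 x = x := by rw [H.evol_zero]; rfl

theorem inner_evol (s : ℝ) (x y : E) : ⟪H.evol s x, H.evol s y⟫_ℂ = ⟪x, y⟫_ℂ := by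
  have h := (Unitary.mem_iff.1 (H.evol_unitary s)).1
  rw [← ContinuousLinearMap.adjoint_inner_right, ← ContinuousLinearMap.star_eq_adjoint,
    ← mul_apply_eq_comp, h, one_apply_eq_self]

theorem norm_evol (s : ℝ) (x : E) : ‖H.evol s x‖ = ‖x‖ := by
  have h := H.inner_evol s x x
  rw [inner_self_eq_norm_sq_to_K, inner_self_eq_norm_sq_to_K] at h
  have h2 : ‖H.evol s x‖ ^ 2 = ‖x‖ ^ 2 := by exact_mod_cast h
  exact (sq_eq_sq₀ (norm_nonneg _) (norm_nonneg _)).1 h2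

theorem inner_evol_neg (s : ℝ) (x y : E) : ⟪H.evol (-s) x, y⟫_ℂ = ⟪x, H.evol s y⟫_ℂ := by
  rw [← H.inner_evol s (H.evol (-s) x), ← H.evol_add_apply, add_neg_cancel, H.evol_zero_apply]

theorem evol_evol_neg (s : ℝ) (x : E) : H.evol s (H.evol (-s) x) = x := by
  rw [← H.evol_add_apply, add_neg_cancel, H.evol_zero_apply]

/-- Strong continuity becomes joint continuity because the evolution is isometric, hence
equicontinuous in the vector. -/
theorem continuous_evol : Continuous fun z : ℝ × E => H.evol z.1 z.2 := by
  rw [continuous_iff_continuousAt]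
  rintro ⟨s, x⟩
  have h1 : Tendsto (fun z : ℝ × E => H.evol z.1 x) (nhds (s, x)) (nhds (H.evol s x)) :=
    ((H.evol_continuous x).tendsto s).comp (continuous_fst.tendsto (s, x))
  have h2 : Tendsto (fun z : ℝ × E => H.evol z.1 (z.2 - x)) (nhds (s, x)) (nhds 0) := by
    rw [tendsto_zero_iff_norm_tendsto_zero]
    simp only [H.norm_evol]
    have : Tendsto (fun z : ℝ × E => ‖z.2 - x‖) (nhds (s, x)) (nhds ‖x - x‖) :=
      (((continuous_snd.sub continuous_const).norm).tendsto (s, x))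
    simpa using this
  simpa [ContinuousAt] using h1.add h2

theorem hasDerivAt_evol {x y : E} (h : (x, y) ∈ H.op.graph) (r : ℝ) :
    HasDerivAt (fun s => H.evol s x) (-(Complex.I • H.evol r y)) r := by
  have h0 := (H.mem_graph_iff x y).1 h
  have h1 : HasDerivAt (fun s : ℝ => H.evol (s - r) x) (-(Complex.I • y)) r := by
    have := HasDerivAt.comp_sub_const (f := fun s => H.evol s x) r r (by simpa using h0)
    exact this
  have h2 := ((H.evol r).restrictScalars ℝ).hasFDerivAt.comp_hasDerivAt r h1
  convert h2 using 1
  · ext s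
    simp [← H.evol_add_apply]
  · simp

theorem evol_mem_graph {x y : E} (h : (x, y) ∈ H.op.graph) (r : ℝ) :
    (H.evol r x, H.evol r y) ∈ H.op.graph := by
  rw [H.mem_graph_iff]
  have h2 := ((H.evol r).restrictScalars ℝ).hasFDerivAt.comp_hasDerivAt (0 : ℝ)
    ((H.mem_graph_iff x y).1 h)
  convert h2 using 1
  · ext s
    simp [← H.evol_add_apply, add_comm]
  · simp

theorem dense_domain : Dense (H.op.domain : Set E) := H.isSelfAdjoint.dense_domain

/-- The vector exp(iεs) exp(-isH) x has zero derivative in s, so it stays equal to x. -/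
theorem evol_eigenvector {x : E} {ε : ℝ} (h : (x, (ε : ℂ) • x) ∈ H.op.graph) (s : ℝ) :
    H.evol s x = Complex.exp (-(Complex.I * ε * s)) • x := by
  have hd : ∀ r : ℝ, HasDerivAt (fun s : ℝ => Complex.exp (Complex.I * ε * s) • H.evol s x) 0 r := by
    intro r
    have h1 := H.hasDerivAt_evol h r
    have h2 : HasDerivAt (fun s : ℝ => Complex.exp (Complex.I * ε * s))
        (Complex.exp (Complex.I * ε * r) * (Complex.I * ε)) r := by
      have h3 : HasDerivAt (fun s : ℝ => Complex.I * ε * (s : ℂ)) (Complex.I * ε) r := by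
        simpa using (Complex.ofRealCLM.hasDerivAt (x := r)).const_mul (Complex.I * (ε : ℂ))
      exact h3.cexp
    refine (h2.smul h1).congr_deriv ?_
    rw [map_smul, smul_neg, smul_smul, smul_smul, ← neg_smul, ← add_smul]
    simp [mul_assoc]
  have hc := is_const_of_deriv_eq_zero (fun r => (hd r).differentiableAt) (fun r => (hd r).deriv) s 0
  simp only [Complex.ofReal_zero, mul_zero, Complex.exp_zero, one_smul, H.evol_zero_apply] at hc
  rw [← hc, smul_smul, ← Complex.exp_add]
  simp [hc]

end Hamiltonian

/-! ### Measurability of time-ordered products -/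

section Measurability

variable {E : Type*} [NormedAddCommGroup E] [InnerProductSpace ℂ E] [CompleteSpace E]
  (H : Hamiltonian E) {α : Type*} [MeasurableSpace α]

theorem Hamiltonian.stronglyMeasurable_evol {f : α → ℝ} (hf : Measurable f) {x : α → E}
    (hx : StronglyMeasurable x) : StronglyMeasurable fun a => H.evol (f a) (x a) :=
  H.continuous_evol.comp_stronglyMeasurable (hf.stronglyMeasurable.prodMk hx)

theorem Hamiltonian.stronglyMeasurable_keldyshPropagator (O : E →L[ℂ] E) (t : ℝ) {f i : α → ℝ}
    (hf : Measurable f) (hi : Measurable i) {x : α → E} (hx : StronglyMeasurable x) :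
    StronglyMeasurable fun a => keldyshPropagator H.evol O t (f a) (i a) (x a) := by
  classical
  have : (fun a => keldyshPropagator H.evol O t (f a) (i a) (x a)) = fun a =>
      if f a < t then H.evol (f a - i a) (x a) else if t ≤ i a then H.evol (i a - f a) (x a)
      else H.evol (t - f a) (O (H.evol (t - i a) (x a))) := by
    ext a
    simp only [keldyshPropagator]
    split_ifs <;> rfl
  rw [this]
  refine StronglyMeasurable.ite (measurableSet_lt hf measurable_const)
    (H.stronglyMeasurable_evol (hf.sub hi) hx) ?_
  refine StronglyMeasurable.ite (measurableSet_le measurable_const hi)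
    (H.stronglyMeasurable_evol (hi.sub hf) hx) ?_
  exact H.stronglyMeasurable_evol (hf.const_sub t)
    (O.continuous.comp_stronglyMeasurable (H.stronglyMeasurable_evol (hi.const_sub t) hx))

theorem Hamiltonian.stronglyMeasurable_orderedChain (O W : E →L[ℂ] E) (t i : ℝ) (x : E) {m : ℕ}
    {s : α → Fin m → ℝ} (hs : Measurable s) {f : α → ℝ} (hf : Measurable f) :
    StronglyMeasurable fun a => orderedChain (keldyshPropagator H.evol O t) W i m (s a) (f a) x := by
  induction m generalizing f with
  | zero =>
    exact H.stronglyMeasurable_keldyshPropagator O t hf (measurable_const (a := i))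
      (stronglyMeasurable_const (b := x))
  | succ m ih =>
    have hl : Measurable fun a => s a (Fin.last m) := (measurable_pi_apply _).comp hs
    have hi : Measurable fun a => Fin.init (s a) :=
      measurable_pi_lambda _ fun j => (measurable_pi_apply j.castSucc).comp hs
    exact H.stronglyMeasurable_keldyshPropagator O t hf hl
      (W.continuous.comp_stronglyMeasurable (ih hi hl))

theorem Hamiltonian.timeMeasurable_timeProd (W : E →L[ℂ] E) (x : E) (si sf : ℝ) :
    TimeMeasurable si sf fun A => timeProd (heisenberg H.evol W) A x := by
  intro n
  induction n with
  | zero => exact ⟨fun _ => x, stronglyMeasurable_const, fun s _ => by simp⟩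
  | succ n ih =>
    obtain ⟨g, hg, hgf⟩ := ih
    have hi : Measurable fun s : Fin (n + 1) → ℝ => Fin.init s :=
      measurable_pi_lambda _ fun j => measurable_pi_apply j.castSucc
    have hl : Measurable fun s : Fin (n + 1) → ℝ => s (Fin.last n) := measurable_pi_apply _
    refine ⟨fun s => H.evol (-s (Fin.last n)) (W (H.evol (s (Fin.last n)) (g (Fin.init s)))),
      H.stronglyMeasurable_evol hl.neg (W.continuous.comp_stronglyMeasurable
        (H.stronglyMeasurable_evol hl (hg.comp_measurable hi))), fun s hs => ?_⟩
    simp only [timeProd_image_succ _ hs.1]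
    rw [← hgf _ ⟨strictMono_init hs.1, fun j => hs.2 _⟩]
    rfl

/-- The vector is the pointwise limit of its finite Fourier sums, along a filter that is countably
generated because the basis is countable. -/
theorem HilbertBasis.stronglyMeasurable_of_inner {κ : Type*} [Countable κ]
    (b : HilbertBasis κ ℂ E) {v : α → E} (h : ∀ k, StronglyMeasurable fun a => ⟪b k, v a⟫_ℂ) :
    StronglyMeasurable v := by
  refine stronglyMeasurable_of_tendsto (f := fun (S : Finset κ) a => ∑ k ∈ S, ⟪b k, v a⟫_ℂ • b k)
    atTop (fun S => Finset.stronglyMeasurable_fun_sum _ fun k _ => (h k).smul_const _) ?_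
  rw [tendsto_pi_nhds]
  intro a
  have := b.hasSum_repr (v a)
  simp only [HilbertBasis.repr_apply_apply] at this
  exact this

end Measurability

/-! ### The bath coupling on energy eigenvectors -/

namespace BathCoupling

variable {κ F : Type*} [NormedAddCommGroup F] [InnerProductSpace ℂ F] [CompleteSpace F]
  {bath : ThermalBath κ F} (V : BathCoupling bath)

theorem coe_evol (s : ℝ) (x : V.dom) : ((V.evol s x : V.dom) : F) = bath.ham.evol s x := rfl

theorem evol_add (s r : ℝ) : V.evol (s + r) = V.evol s * V.evol r := by
  ext x
  exact bath.ham.evol_add_apply s r x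

theorem evol_zero : V.evol 0 = 1 := by
  ext x
  exact bath.ham.evol_zero_apply x

/-- The energy eigenvectors as elements of the domain of the coupling. -/
def eigenvec (V : BathCoupling bath) (k : κ) : V.dom :=
  ⟨bath.eigenvector k, V.eigenvector_mem k⟩

/-- The phase of an energy eigenvector under time evolution. -/
def phase (bath : ThermalBath κ F) (k : κ) (s : ℝ) : ℂ :=
  Complex.exp (-(Complex.I * bath.energy k * s))

theorem evol_eigenvector (k : κ) (s : ℝ) :
    bath.ham.evol s (bath.eigenvector k) = phase bath k s • bath.eigenvector k :=
  bath.ham.evol_eigenvector (bath.eigen k) s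

theorem evol_eigenvec (k : κ) (s : ℝ) : V.evol s (V.eigenvec k) = phase bath k s • V.eigenvec k :=
  Subtype.ext (evol_eigenvector k s)

theorem norm_phase (k : κ) (s : ℝ) : ‖phase bath k s‖ = 1 := by
  rw [phase, Complex.norm_exp]
  simp

theorem continuous_phase (k : κ) : Continuous (phase bath k) := by
  unfold phase
  fun_prop

/-- The adjointness relation between operators on the domain of the coupling. -/
def IsAdjoint (V : BathCoupling bath) (A A' : Module.End ℂ V.dom) : Prop :=
  ∀ x y : V.dom, ⟪((A x : V.dom) : F), (y : F)⟫_ℂ = ⟪(x : F), ((A' y : V.dom) : F)⟫_ℂ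

theorem isAdjoint_one : V.IsAdjoint 1 1 := fun _ _ => rfl

theorem IsAdjoint.mul {V : BathCoupling bath} {A A' B B' : Module.End ℂ V.dom}
    (hA : V.IsAdjoint A A') (hB : V.IsAdjoint B B') : V.IsAdjoint (A * B) (B' * A') := by
  intro x y
  exact (hA (B x) y).trans (hB x (A' y))

theorem isAdjoint_evol (s : ℝ) : V.IsAdjoint (V.evol s) (V.evol (-s)) := by
  intro x y
  have := bath.ham.inner_evol_neg (-s) x y
  rwa [neg_neg] at this

theorem isAdjoint_heisenberg (s : ℝ) :
    V.IsAdjoint (heisenberg V.evol V.op s) (heisenberg V.evol V.op s) := by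
  have h1 : V.IsAdjoint V.op V.op := V.symmetric
  have h2 := ((V.isAdjoint_evol (-s)).mul h1).mul (V.isAdjoint_evol s)
  rw [neg_neg, ← mul_assoc] at h2
  exact h2

/-- The time-ordered product of the coupling applied to an energy eigenvector. -/
def timeVec (V : BathCoupling bath) (k : κ) (A : Finset ℝ) : F :=
  (timeProd (heisenberg V.evol V.op) A (V.eigenvec k) : V.dom)

theorem timeVec_empty (k : κ) : V.timeVec k ∅ = bath.eigenvector k := by
  simp [timeVec, eigenvec]

theorem coe_heisenberg_eigenvec (k : κ) (x : ℝ) :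
    ((heisenberg V.evol V.op x (V.eigenvec k) : V.dom) : F) =
      phase bath k x • bath.ham.evol (-x) (V.op (V.eigenvec k) : V.dom) := by
  change ((V.evol (-x) (V.op (V.evol x (V.eigenvec k))) : V.dom) : F) = _
  rw [V.evol_eigenvec, map_smul, map_smul, Submodule.coe_smul, V.coe_evol]

/-- Continuity of the coupling is not available, as it may be unbounded. Instead the vector is
paired with each e_j: symmetry moves the latest Heisenberg operator onto e_j, where it becomes a
phase times a continuous orbit of a fixed vector. -/
theorem timeMeasurable_timeVec (k : κ) (si sf : ℝ) : TimeMeasurable si sf (V.timeVec k) := by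
  have := bath.countable
  intro n
  -- The representative must stay in the domain of the coupling, since the induction step applies
  -- the coupling to it again.
  suffices h : ∃ g : (Fin n → ℝ) → V.dom, StronglyMeasurable (fun s => (g s : F)) ∧
      ∀ s ∈ timeSimplex n si sf, timeProd (heisenberg V.evol V.op) (Finset.univ.image s)
        (V.eigenvec k) = g s by
    obtain ⟨g, hg, hgf⟩ := h
    exact ⟨fun s => g s, hg, fun s hs => congrArg Subtype.val (hgf s hs)⟩
  induction n with
  | zero => exact ⟨fun _ => V.eigenvec k, stronglyMeasurable_const, fun s _ => by simp⟩
  | succ n ih =>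
    obtain ⟨g, hg, hgf⟩ := ih
    have hi : Measurable fun s : Fin (n + 1) → ℝ => Fin.init s :=
      measurable_pi_lambda _ fun j => measurable_pi_apply j.castSucc
    have hl : Measurable fun s : Fin (n + 1) → ℝ => s (Fin.last n) := measurable_pi_apply _
    refine ⟨fun s => heisenberg V.evol V.op (s (Fin.last n)) (g (Fin.init s)), ?_, fun s hs => ?_⟩
    · refine bath.eigenvector.stronglyMeasurable_of_inner fun j => ?_
      have h1 : (fun s : Fin (n + 1) → ℝ => ⟪bath.eigenvector j,
          ((heisenberg V.evol V.op (s (Fin.last n)) (g (Fin.init s)) : V.dom) : F)⟫_ℂ) =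
          fun s => ⟪phase bath j (s (Fin.last n)) • bath.ham.evol (-s (Fin.last n))
            (V.op (V.eigenvec j) : V.dom), (g (Fin.init s) : F)⟫_ℂ := by
        ext s
        rw [← coe_heisenberg_eigenvec]
        exact (V.isAdjoint_heisenberg _ (V.eigenvec j) _).symm
      rw [h1]
      refine StronglyMeasurable.inner ?_ (hg.comp_measurable hi)
      exact ((continuous_phase j).measurable.comp hl).stronglyMeasurable.smul
        (bath.ham.stronglyMeasurable_evol hl.neg stronglyMeasurable_const)
    · rw [timeProd_image_succ _ hs.1, Module.End.mul_apply,
        hgf _ ⟨strictMono_init hs.1, fun j => hs.2 _⟩]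

end BathCoupling

/-! ### Operations on measurable functions of finite sets of times -/

section

variable {X : Type*} [TopologicalSpace X]

/-- As `p` is inherited by earlier times, filtering only removes a final stretch of the times, which
can be dropped one by one from the end. -/
theorem TimeMeasurable.filter {si sf : ℝ} {f : Finset ℝ → X} (hf : TimeMeasurable si sf f)
    (p : ℝ → Prop) [DecidablePred p] (hp : ∀ x y, x < y → p y → p x)
    (hpm : MeasurableSet {x | p x}) : TimeMeasurable si sf fun A => f (A.filter p) := by
  intro n
  induction n with
  | zero =>
    obtain ⟨g, hg, hgf⟩ := hf 0
    exact ⟨g, hg, fun s hs => by rw [← hgf s hs]; simp⟩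
  | succ n ih =>
    obtain ⟨g, hg, hgf⟩ := hf (n + 1)
    obtain ⟨g', hg', hgf'⟩ := ih
    have hi : Measurable fun s : Fin (n + 1) → ℝ => Fin.init s :=
      measurable_pi_lambda _ fun j => measurable_pi_apply j.castSucc
    have hl : Measurable fun s : Fin (n + 1) → ℝ => s (Fin.last n) := measurable_pi_apply _
    refine ⟨fun s => if p (s (Fin.last n)) then g s else g' (Fin.init s),
      StronglyMeasurable.ite (hl hpm) hg (hg'.comp_measurable hi), fun s hs => ?_⟩
    by_cases h : p (s (Fin.last n))
    · simp only [if_pos h]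
      rw [← hgf s hs, Finset.filter_true_of_mem]
      intro x hx
      rw [image_univ_succ, Finset.mem_insert] at hx
      rcases hx with rfl | hx
      exacts [h, hp _ _ (lt_last_of_mem_image_init hs.1 x hx) h]
    · simp only [if_neg h]
      rw [image_univ_succ, Finset.filter_insert, if_neg h,
        ← hgf' _ ⟨strictMono_init hs.1, fun j => hs.2 _⟩]

theorem TimeMeasurable.reflect {si sf r : ℝ} {f : Finset ℝ → X}
    (hf : TimeMeasurable (r - sf) (r - si) f) :
    TimeMeasurable si sf fun A => f (A.image fun x => r - x) := by
  intro n
  obtain ⟨g, hg, hgf⟩ := hf n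
  refine ⟨fun s => g fun i => r - s i.rev, hg.comp_measurable
    (measurable_pi_lambda _ fun i => (measurable_pi_apply _).const_sub _), fun s hs => ?_⟩
  have h1 : (fun i => r - s i.rev) ∈ timeSimplex n (r - sf) (r - si) := by
    refine ⟨fun i j h => ?_, fun i => ?_⟩
    · have := hs.1 (Fin.rev_lt_rev.2 h)
      simp only
      linarith
    · have := hs.2 i.rev
      constructor <;> linarith [this.1, this.2]
  · simp only
    rw [← hgf _ h1]
    congr 1
    ext x
    simp only [Finset.mem_image, Finset.mem_univ, true_and]
    constructor
    · rintro ⟨_, ⟨i, rfl⟩, rfl⟩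
      exact ⟨i.rev, by simp⟩
    · rintro ⟨i, rfl⟩
      exact ⟨_, ⟨i.rev, rfl⟩, rfl⟩

theorem timeMeasurable_onFinset {si sf : ℝ} {F : (m : ℕ) → (Fin m → ℝ) → X}
    (h : ∀ n, ∃ g : (Fin n → ℝ) → X, StronglyMeasurable g ∧ ∀ s ∈ timeSimplex n si sf,
      F n s = g s) : TimeMeasurable si sf (onFinset F) := by
  intro n
  obtain ⟨g, hg, hgf⟩ := h n
  exact ⟨g, hg, fun s hs => by rw [onFinset_image F hs.1, hgf s hs]⟩

end

theorem stronglyMeasurable_of_hasSum {α ι X : Type*} [MeasurableSpace α] [Countable ι]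
    [NormedAddCommGroup X] {f : ι → α → X} {F : α → X} (hf : ∀ i, StronglyMeasurable (f i))
    (h : ∀ a, HasSum (fun i => f i a) (F a)) : StronglyMeasurable F :=
  stronglyMeasurable_of_tendsto (f := fun (S : Finset ι) a => ∑ i ∈ S, f i a) atTop
    (fun _ => Finset.stronglyMeasurable_fun_sum _ fun i _ => hf i)
    (tendsto_pi_nhds.2 fun a => h a)

theorem TimeMeasurable.of_hasSum {ι X : Type*} [Countable ι] [NormedAddCommGroup X] {si sf : ℝ}
    {f : ι → Finset ℝ → X} {F : Finset ℝ → X} (hf : ∀ i, TimeMeasurable si sf (f i))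
    (h : ∀ A : Finset ℝ, (∀ x ∈ A, x ∈ Set.Ioo si sf) → HasSum (fun i => f i A) (F A)) :
    TimeMeasurable si sf F := by
  intro n
  choose g hg hgf using fun i => hf i n
  refine ⟨(timeSimplex n si sf).indicator fun s => F (Finset.univ.image s), ?_, fun s hs => by
    rw [Set.indicator_of_mem hs]⟩
  refine stronglyMeasurable_of_hasSum (f := fun i => (timeSimplex n si sf).indicator (g i))
    (fun i => (hg i).indicator (measurableSet_timeSimplex n si sf)) fun s => ?_
  by_cases hs : s ∈ timeSimplex n si sf
  · simp only [Set.indicator_of_mem hs, ← hgf _ s hs]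
    exact h _ (mem_Ioo_of_mem_image hs)
  · simp only [Set.indicator_of_notMem hs]
    exact hasSum_zero

end

noncomputable section

open MeasureTheory Filter

/-! ### Wick's theorem on finite sets of times -/

namespace BathCoupling

variable {κ F : Type*} [NormedAddCommGroup F] [InnerProductSpace ℂ F] [CompleteSpace F]
  {bath : ThermalBath κ F} {V : BathCoupling bath} {t : ℝ}

/-- The diagonal element of a contour ordered product of couplings in an energy eigenvector. -/
def wickTerm (V : BathCoupling bath) (t : ℝ) (k : κ) (C : Finset ℝ) : ℂ :=
  bath.prob k * ⟪V.timeVec k ((C.filter fun x => t ≤ x).image fun x => 2 * t - x),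
    V.timeVec k (C.filter fun x => x < t)⟫_ℂ

/-- For the contour [0, 2t] the outer propagators are trivial and the tip carries the identity. The
backward half of the chain is the adjoint of a time-ordered product at the reflected times, so it
moves to the left side of the inner product. -/
theorem traceTerm_bathChain (ht : 0 < t) {m : ℕ} {s : Fin m → ℝ}
    (hs : s ∈ timeSimplex m 0 (2 * t)) (k : κ) :
    V.traceTerm (V.bathChain t s) k = V.wickTerm t k (Finset.univ.image s) := by
  have hone : heisenberg V.evol 1 t = 1 := by
    rw [heisenberg, mul_one, ← V.evol_add, neg_add_cancel, V.evol_zero]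
  have hadj := timeProd_reflect V.IsAdjoint V.isAdjoint_one (fun a b c d h h' => h.mul h')
    (heisenberg V.evol V.op) (heisenberg V.evol V.op) V.isAdjoint_heisenberg (2 * t)
    ((Finset.univ.image s).filter fun x => t ≤ x)
  rw [traceTerm, bath.inner_state, wickTerm]
  congr 1
  have hchain : V.bathChain t s = timeProd (fun x => heisenberg V.evol V.op (2 * t - x))
        ((Finset.univ.image s).filter fun x => t ≤ x) *
      timeProd (heisenberg V.evol V.op) ((Finset.univ.image s).filter fun x => x < t) := by
    have := orderedChain_keldysh_ge V.evol_add 1 V.op ht hs.1 (f := 2 * t)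
      (fun j => (hs.2 j).2) (by linarith)
    rw [sub_self, V.evol_zero, neg_zero, V.evol_zero, one_mul, mul_one, hone, mul_one] at this
    exact this
  rw [hchain]
  exact (hadj (V.eigenvec k) _).symm

/-- The parity distinction disappears here, because pairing sums over sets of odd size are empty. -/
theorem Wick.summable_hasSum (hV : V.Wick t) (ht : 0 < t) {C : Finset ℝ}
    (hC : ∀ x ∈ C, x ∈ Set.Ioo 0 (2 * t)) :
    HasSum (fun k => V.wickTerm t k C) (pairSum (V.corr t) C) := by
  have himg : Finset.univ.image (C.orderEmbOfFin rfl) = C := times_confOf C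
  have hs : (⇑(C.orderEmbOfFin rfl) : Fin C.card → ℝ) ∈ timeSimplex C.card 0 (2 * t) :=
    ⟨(C.orderEmbOfFin rfl).strictMono, fun i => hC _ (Finset.orderEmbOfFin_mem C rfl i)⟩
  obtain ⟨h1, h2⟩ := hV C.card _ hs
  have h3 : HasSum (fun k => V.wickTerm t k C) 
      (V.thermalTrace (V.bathChain t (C.orderEmbOfFin rfl : Fin C.card → ℝ))) := by
    refine h1.hasSum.congr_fun ?_
    intro k
    rw [traceTerm_bathChain ht hs, himg]
  rw [h2, sum_orderedPairings hs.1, himg] at h3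
  split_ifs at h3 with h4
  · exact h3
  · rwa [pairSum_odd h4]

theorem filter_contour {B B' : Finset ℝ} (hB : ∀ x ∈ B, x < t) (hB' : ∀ x ∈ B', x < t) :
    ((B ∪ B'.image fun x => 2 * t - x).filter fun x => x < t) = B ∧
    (((B ∪ B'.image fun x => 2 * t - x).filter fun x => t ≤ x).image fun x => 2 * t - x) = B' := by
  constructor
  · rw [Finset.filter_union, Finset.filter_true_of_mem hB, Finset.filter_false_of_mem,
      Finset.union_empty]
    intro x hx
    obtain ⟨y, hy, rfl⟩ := Finset.mem_image.1 hx
    linarith [hB' y hy]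
  · rw [Finset.filter_union, Finset.filter_false_of_mem fun x hx => not_le.2 (hB x hx),
      Finset.empty_union, Finset.filter_true_of_mem, Finset.image_image]
    · ext x
      simp
    · intro x hx
      obtain ⟨y, hy, rfl⟩ := Finset.mem_image.1 hx
      linarith [hB' y hy]

/-- Two time-ordered products on (0, t) are glued to one contour by reflecting the left one. Wick's
theorem on this contour thus computes thermal averages of overlaps. -/
theorem Wick.hasSum_inner (hV : V.Wick t) (ht : 0 < t) {B B' : Finset ℝ}
    (hB : ∀ x ∈ B, x ∈ Set.Ioo 0 t) (hB' : ∀ x ∈ B', x ∈ Set.Ioo 0 t) :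
    HasSum (fun k => (bath.prob k : ℂ) * ⟪V.timeVec k B', V.timeVec k B⟫_ℂ)
      (pairSum (V.corr t) (B ∪ B'.image fun x => 2 * t - x)) := by
  have h := hV.summable_hasSum ht (C := B ∪ B'.image fun x => 2 * t - x) ?_
  · obtain ⟨h1, h2⟩ := filter_contour (fun x hx => (hB x hx).2) (fun x hx => (hB' x hx).2)
    simpa only [wickTerm, h1, h2] using h
  · intro x hx
    rcases Finset.mem_union.1 hx with hx | hx
    · have := hB x hx
      exact ⟨this.1, by linarith [this.2]⟩
    · obtain ⟨y, hy, rfl⟩ := Finset.mem_image.1 hx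
      have := hB' y hy
      constructor <;> linarith [this.1, this.2]

/-- With both halves of the contour equal, the overlap is a squared norm, and the pairing sum runs
over 2 |B| times. This is the only quantitative control of the unbounded coupling. -/
theorem Wick.hasSum_norm_sq (hV : V.Wick t) (ht : 0 < t) {K : ℝ} (hK : 0 ≤ K)
    (hVK : ∀ τ₁ τ₂, 0 ≤ τ₁ → τ₁ ≤ τ₂ → τ₂ ≤ 2 * t → ‖V.corr t τ₁ τ₂‖ ≤ K) {B : Finset ℝ}
    (hB : ∀ x ∈ B, x ∈ Set.Ioo 0 t) :
    (Summable fun k => bath.prob k * ‖V.timeVec k B‖ ^ 2) ∧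
    ∑' k, bath.prob k * ‖V.timeVec k B‖ ^ 2 ≤ (2 * K) ^ B.card * B.card.factorial := by
  have h := hV.hasSum_inner ht hB hB
  have h1 : HasSum (fun k => ((bath.prob k * ‖V.timeVec k B‖ ^ 2 : ℝ) : ℂ))
      (pairSum (V.corr t) (B ∪ B.image fun x => 2 * t - x)) := by
    convert h using 2 with k
    rw [inner_self_eq_norm_sq_to_K]
    push_cast
    rfl
  have h2 := Complex.hasSum_re h1
  simp only [Complex.ofReal_re] at h2
  refine ⟨h2.summable, ?_⟩
  rw [h2.tsum_eq]
  refine (Complex.re_le_norm _).trans (norm_pairSum_le hK ?_ ?_)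
  · intro x hx y hy hxy
    have hmem : ∀ x ∈ B ∪ B.image (fun x => 2 * t - x), 0 ≤ x ∧ x ≤ 2 * t := by
      intro x hx
      rcases Finset.mem_union.1 hx with hx | hx
      · have := hB x hx
        exact ⟨this.1.le, by linarith [this.2]⟩
      · obtain ⟨y, hy, rfl⟩ := Finset.mem_image.1 hx
        have := hB y hy
        constructor <;> linarith [this.1, this.2]
    exact hVK x y (hmem x hx).1 hxy.le (hmem y hy).2
  · rw [Finset.card_union_of_disjoint, Finset.card_image_of_injective _ sub_right_injective, two_mul]
    rw [Finset.disjoint_left]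
    intro x hx hx'
    obtain ⟨y, hy, rfl⟩ := Finset.mem_image.1 hx'
    linarith [(hB _ hx).2, (hB y hy).2]

/-- One term of a nonnegative series is at most the sum. The division by p_k makes this bound
unsuitable for summing over the levels. -/
theorem Wick.norm_timeVec_le (hV : V.Wick t) (ht : 0 < t) {K : ℝ} (hK : 0 ≤ K)
    (hVK : ∀ τ₁ τ₂, 0 ≤ τ₁ → τ₁ ≤ τ₂ → τ₂ ≤ 2 * t → ‖V.corr t τ₁ τ₂‖ ≤ K) {B : Finset ℝ}
    (hB : ∀ x ∈ B, x ∈ Set.Ioo 0 t) (k : κ) :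
    ‖V.timeVec k B‖ ≤ Real.sqrt ((2 * K) ^ B.card * B.card.factorial / bath.prob k) := by
  obtain ⟨h1, h2⟩ := hV.hasSum_norm_sq ht hK hVK hB
  refine Real.le_sqrt_of_sq_le ?_
  rw [le_div_iff₀ (bath.prob_pos k), mul_comm]
  exact (h1.le_tsum k fun j _ => mul_nonneg (bath.prob_pos j).le (sq_nonneg _)).trans h2

/-- Cauchy–Schwarz in the level index, with p_k shared between the two factors. No inverse
probability appears, so the sum over levels can be exchanged with time integrals. -/
theorem Wick.sum_norm_mul_le (hV : V.Wick t) (ht : 0 < t) {K : ℝ} (hK : 0 ≤ K)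
    (hVK : ∀ τ₁ τ₂, 0 ≤ τ₁ → τ₁ ≤ τ₂ → τ₂ ≤ 2 * t → ‖V.corr t τ₁ τ₂‖ ≤ K) {B B' : Finset ℝ}
    (hB : ∀ x ∈ B, x ∈ Set.Ioo 0 t) (hB' : ∀ x ∈ B', x ∈ Set.Ioo 0 t) :
    (Summable fun k => bath.prob k * (‖V.timeVec k B'‖ * ‖V.timeVec k B‖)) ∧
    ∑' k, bath.prob k * (‖V.timeVec k B'‖ * ‖V.timeVec k B‖) ≤
      Real.sqrt ((2 * K) ^ B'.card * B'.card.factorial) *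
        Real.sqrt ((2 * K) ^ B.card * B.card.factorial) := by
  obtain ⟨h1, h2⟩ := hV.hasSum_norm_sq ht hK hVK hB
  obtain ⟨h1', h2'⟩ := hV.hasSum_norm_sq ht hK hVK hB'
  have hsq : ∀ (C : Finset ℝ) k, (Real.sqrt (bath.prob k) * ‖V.timeVec k C‖) ^ (2 : ℝ) =
      bath.prob k * ‖V.timeVec k C‖ ^ 2 := fun C k => by
    rw [Real.rpow_two, mul_pow, Real.sq_sqrt (bath.prob_pos k).le]
  have h := Real.inner_le_Lp_mul_Lq_tsum_of_nonneg (p := 2) (q := 2) ⟨by norm_num, by norm_num,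
    by norm_num⟩ (f := fun k => Real.sqrt (bath.prob k) * ‖V.timeVec k B'‖)
    (g := fun k => Real.sqrt (bath.prob k) * ‖V.timeVec k B‖)
    (fun k => by positivity) (fun k => by positivity)
    (by simpa only [hsq] using h1') (by simpa only [hsq] using h1)
  have heq : ∀ k, Real.sqrt (bath.prob k) * ‖V.timeVec k B'‖ *
      (Real.sqrt (bath.prob k) * ‖V.timeVec k B‖) =
      bath.prob k * (‖V.timeVec k B'‖ * ‖V.timeVec k B‖) := fun k => by
    nth_rewrite 3 [← Real.mul_self_sqrt (bath.prob_pos k).le]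
    ring
  simp only [hsq, heq] at h
  refine ⟨?_, h.trans ?_⟩
  · refine Summable.of_nonneg_of_le (fun k => mul_nonneg (bath.prob_pos k).le (by positivity))
      (fun k => ?_) (h1'.add h1)
    have := bath.prob_pos k
    nlinarith [mul_nonneg this.le (sq_nonneg (‖V.timeVec k B'‖ - ‖V.timeVec k B‖)),
      mul_nonneg this.le (sq_nonneg (‖V.timeVec k B'‖)),
      mul_nonneg this.le (sq_nonneg (‖V.timeVec k B‖))]
  rw [← Real.sqrt_eq_rpow, ← Real.sqrt_eq_rpow]
  gcongr

theorem timeMeasurable_wickTerm (V : BathCoupling bath) (t : ℝ) (k : κ) (si sf : ℝ) :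
    TimeMeasurable si sf (V.wickTerm t k) := by
  have h1 : TimeMeasurable si sf fun C : Finset ℝ => V.timeVec k (C.filter fun x => x < t) :=
    (V.timeMeasurable_timeVec k si sf).filter _ (fun x y h h' => h.trans h') measurableSet_Iio
  have h2 : TimeMeasurable si sf fun C : Finset ℝ =>
      V.timeVec k ((C.filter fun x => t ≤ x).image fun x => 2 * t - x) := by
    -- The times after the tip form a final segment; after reflection they form an initial one, to
    -- which `TimeMeasurable.filter` applies.
    have h3 := ((V.timeMeasurable_timeVec k (2 * t - sf) (2 * t - si)).filter (fun x => x ≤ t)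
      (fun x y h h' => h.le.trans h') measurableSet_Iic).reflect
    have h4 : ∀ C : Finset ℝ, (C.image fun x => 2 * t - x).filter (fun x => x ≤ t) =
        (C.filter fun x => t ≤ x).image fun x => 2 * t - x := by
      intro C
      rw [Finset.filter_image]
      congr 2
      ext x
      constructor <;> intro h <;> linarith
    simpa only [h4] using h3
  intro n
  obtain ⟨g1, hg1, hgf1⟩ := h1 n
  obtain ⟨g2, hg2, hgf2⟩ := h2 n
  refine ⟨fun s => bath.prob k * ⟪g2 s, g1 s⟫_ℂ, (hg2.inner hg1).const_mul _, fun s hs => ?_⟩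
  simp only [wickTerm]
  rw [← hgf1 s hs, ← hgf2 s hs]

theorem Wick.timeMeasurable_pairSum_corr (hV : V.Wick t) (ht : 0 < t) :
    TimeMeasurable 0 (2 * t) (pairSum (V.corr t)) := by
  have := bath.countable
  exact TimeMeasurable.of_hasSum (fun k => V.timeMeasurable_wickTerm t k 0 (2 * t))
    fun A hA => hV.summable_hasSum ht hA

theorem pairSum_pair (B : ℝ → ℝ → ℂ) {x y : ℝ} (h : x < y) : pairSum B {x, y} = B x y := by
  have : finsetPairings ({x, y} : Finset ℝ) = {{(x, y)}} := by
    ext q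
    rw [mem_finsetPairings, Finset.mem_singleton]
    constructor
    · rintro ⟨h1, h2⟩
      obtain ⟨p, ⟨hp, -⟩, -⟩ := h2 x (by simp)
      have hall : ∀ p ∈ q, p = (x, y) := by
        intro p hp
        obtain ⟨a, b, c⟩ := h1 p hp
        simp only [Finset.mem_insert, Finset.mem_singleton] at a b
        rcases a with a | a <;> rcases b with b | b
        · exact absurd c (by rw [a, b]; exact lt_irrefl _)
        · exact Prod.ext a b
        · exact absurd c (by rw [a, b]; exact h.asymm)
        · exact absurd c (by rw [a, b]; exact lt_irrefl _)
      ext p'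
      rw [Finset.mem_singleton]
      exact ⟨hall p', fun h => h ▸ hall p hp ▸ hp⟩
    · rintro rfl
      refine ⟨by simpa using h, fun i hi => ⟨(x, y), ?_, ?_⟩⟩
      · simp only [Finset.mem_insert, Finset.mem_singleton] at hi
        simpa [eq_comm] using hi
      · rintro p ⟨hp, -⟩
        exact Finset.mem_singleton.1 hp
  simp [pairSum, this]

/-- The correlation function is the pairing sum of a two-point set, so Wick's theorem for two times
writes it as a convergent series of measurable functions. -/
theorem Wick.exists_measurable_corr (hV : V.Wick t) (ht : 0 < t) :
    ∃ g : ℝ × ℝ → ℂ, StronglyMeasurable g ∧ ∀ x y, 0 < x → x < y → y < 2 * t →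
      V.corr t x y = g (x, y) := by
  obtain ⟨g, hg, hgf⟩ := hV.timeMeasurable_pairSum_corr ht 2
  refine ⟨fun z => g ![z.1, z.2], hg.comp_measurable (measurable_pi_lambda _ fun i => ?_), ?_⟩
  · fin_cases i
    exacts [measurable_fst, measurable_snd]
  · intro x y hx hxy hy
    change V.corr t x y = g ![x, y]
    rw [← hgf]
    · have : Finset.univ.image ![x, y] = {x, y} := by ext; simp [Fin.exists_fin_two, eq_comm]
      rw [this, pairSum_pair _ hxy]
    · constructor
      · intro i j hij
        fin_cases i <;> fin_cases j <;> simp_all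
      · intro i
        fin_cases i
        exacts [⟨hx, hxy.trans hy⟩, ⟨hx.trans hxy, hy⟩]

end BathCoupling

theorem timeMeasurable_pairSum {si sf : ℝ} {B : ℝ → ℝ → ℂ} {g : ℝ × ℝ → ℂ}
    (hg : StronglyMeasurable g) (h : ∀ x y, si < x → x < y → y < sf → B x y = g (x, y)) :
    TimeMeasurable si sf (pairSum B) := by
  intro n
  refine ⟨fun s => ∑ q ∈ orderedPairings n, ∏ p ∈ q, g (s p.1, s p.2),
    Finset.stronglyMeasurable_fun_sum _ fun q _ => Finset.stronglyMeasurable_fun_prod _ fun p _ =>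
      hg.comp_measurable ((measurable_pi_apply _).prodMk (measurable_pi_apply _)), fun s hs => ?_⟩
  rw [← sum_orderedPairings hs.1]
  refine Finset.sum_congr rfl fun q hq => Finset.prod_congr rfl fun p hp => ?_
  simp only [orderedPairings, Finset.mem_filter] at hq
  exact h _ _ (hs.2 _).1 (hs.1 (hq.2.1 p hp)) (hs.2 _).2

end

noncomputable section

open MeasureTheory Filter

/-! ### Uniqueness of weak solutions of the Schrödinger equation -/

namespace Hamiltonian

variable {E : Type*} [NormedAddCommGroup E] [InnerProductSpace ℂ E] [CompleteSpace E]
  (H : Hamiltonian E)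

theorem hasDerivAt_inner_evol {x y : E} (h : (x, y) ∈ H.op.graph) (w : E) (r : ℝ) :
    HasDerivAt (fun s => ⟪x, H.evol s w⟫_ℂ) (-(Complex.I * ⟪y, H.evol r w⟫_ℂ)) r := by
  have h1 : HasDerivAt (fun s : ℝ => H.evol (-s) x) (Complex.I • H.evol (-r) y) r := by
    have := (H.hasDerivAt_evol h (-r)).scomp r (hasDerivAt_neg r)
    simpa [Function.comp_def] using this
  have h2 := h1.inner ℂ (hasDerivAt_const r w)
  simp only [inner_smul_left, Complex.conj_I, H.inner_evol_neg] at h2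
  simpa using h2

theorem inner_evol_sub {x y : E} (h : (x, y) ∈ H.op.graph) (w : E) (a r : ℝ) :
    ⟪x, H.evol (r - a) w⟫_ℂ = ⟪x, w⟫_ℂ - Complex.I * ∫ s in a..r, ⟪y, H.evol (s - a) w⟫_ℂ := by
  have hd : ∀ s, HasDerivAt (fun s => ⟪x, H.evol (s - a) w⟫_ℂ)
      (-(Complex.I * ⟪y, H.evol (s - a) w⟫_ℂ)) s := fun s =>
    (H.hasDerivAt_inner_evol h w (s - a)).comp_sub_const s a
  have hc : Continuous fun s => ⟪y, H.evol (s - a) w⟫_ℂ :=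
    continuous_const.inner ((H.evol_continuous w).comp (continuous_id.sub continuous_const))
  have := intervalIntegral.integral_eq_sub_of_hasDerivAt (a := a) (b := r) (fun s _ => hd s)
    ((continuous_const.mul hc).neg.intervalIntegrable a r)
  rw [intervalIntegral.integral_neg, intervalIntegral.integral_const_mul, sub_self,
    H.evol_zero_apply] at this
  linear_combination -this

theorem eq_zero_of_inner_domain {w : E} (h : ∀ p ∈ H.op.graph, ⟪p.1, w⟫_ℂ = 0) : w = 0 := by
  refine H.dense_domain.eq_zero_of_inner_right ℂ fun x hx => ?_
  exact h (x, H.op ⟨x, hx⟩) (H.op.mem_graph ⟨x, hx⟩)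

/-- The primitive X(r) = ∫ χ solves the equation weakly with X(a) = 0. Pairing it with the orbit of
a domain vector gives a function with zero derivative, hence X vanishes by density, and the equation
then forces χ = 0. -/
theorem eq_zero_of_weak_solution {a b : ℝ} {χ : ℝ → E} (hχ : Continuous χ)
    (h : ∀ p ∈ H.op.graph, ∀ r ∈ Set.Icc a b,
      ⟪p.1, χ r⟫_ℂ = -(Complex.I * ⟪p.2, ∫ s in a..r, χ s⟫_ℂ)) {r : ℝ} (hr : r ∈ Set.Icc a b) :
    χ r = 0 := by
  have hX : ∀ r, HasDerivAt (fun r => ∫ s in a..r, χ s) (χ r) r := fun r =>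
    intervalIntegral.integral_hasDerivAt_right (hχ.intervalIntegrable _ _)
      hχ.aestronglyMeasurable.stronglyMeasurableAtFilter hχ.continuousAt
  have key : ∀ r ∈ Set.Icc a b, (∫ s in a..r, χ s) = 0 := by
    intro r hr
    have h1 : ∀ p ∈ H.op.graph, ⟪H.evol r p.1, ∫ s in a..r, χ s⟫_ℂ = 0 := by
      rintro ⟨x, y⟩ hp
      have hd : ∀ s ∈ Set.Icc a b,
          HasDerivAt (fun r => ⟪H.evol r x, ∫ s in a..r, χ s⟫_ℂ) 0 s := by
        intro s hs
        have h1 := (H.hasDerivAt_evol hp s).inner ℂ (hX s)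
        have h2 := h _ (H.evol_mem_graph hp s) s hs
        simp only at h2
        rw [h2, inner_neg_left, inner_smul_left, Complex.conj_I, neg_mul, neg_neg,
          neg_add_cancel] at h1
        exact h1
      have hconst := constant_of_has_deriv_right_zero (a := a) (b := b)
        (f := fun r => ⟪H.evol r x, ∫ s in a..r, χ s⟫_ℂ)
        (fun s hs => (hd s hs).continuousAt.continuousWithinAt)
        (fun s hs => (hd s ⟨hs.1, hs.2.le⟩).hasDerivWithinAt) r hr
      simpa using hconst
    refine H.eq_zero_of_inner_domain fun p hp => ?_
    have h2 := h1 (H.evol (-r) p.1, H.evol (-r) p.2) (H.evol_mem_graph hp (-r))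
    rwa [H.evol_evol_neg] at h2
  refine H.eq_zero_of_inner_domain fun p hp => ?_
  rw [h p hp r hr, key r hr, inner_zero_right, mul_zero, neg_zero]

/-- In integrated form the equation is a closed condition on the pair (x, y), and the pairs
satisfying it form a subspace. It therefore passes from `S` to the closed span, which is the whole
graph of H. This is where essential self-adjointness enters; uniqueness is then applied to the
difference with the true evolution. -/
theorem eq_evol_of_weak_solution {S : Set (E × E)}
    (hS : H.op.graph = (Submodule.span ℂ S).topologicalClosure) {a b : ℝ} {ψ : ℝ → E}
    (hψ : Continuous ψ)
    (h : ∀ p ∈ S, ∀ r ∈ Set.Icc a b,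
      ⟪p.1, ψ r⟫_ℂ = ⟪p.1, ψ a⟫_ℂ - Complex.I * ∫ s in a..r, ⟪p.2, ψ s⟫_ℂ)
    {r : ℝ} (hr : r ∈ Set.Icc a b) : ψ r = H.evol (r - a) (ψ a) := by
  have hI : ∀ (f : ℝ → E), Continuous f → ∀ (y : E) (r : ℝ),
      ∫ s in a..r, ⟪y, f s⟫_ℂ = ⟪y, ∫ s in a..r, f s⟫_ℂ := fun f hf y r =>
    (innerSL ℂ y).intervalIntegral_comp_comm (hf.intervalIntegrable a r)
  have hgraph : ∀ p ∈ H.op.graph, ∀ r ∈ Set.Icc a b,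
      ⟪p.1, ψ r - ψ a⟫_ℂ + Complex.I * ⟪p.2, ∫ s in a..r, ψ s⟫_ℂ = 0 := by
    intro p hp r hr
    rw [hS] at hp
    have hcl : IsClosed {p : E × E | ⟪p.1, ψ r - ψ a⟫_ℂ +
        Complex.I * ⟪p.2, ∫ s in a..r, ψ s⟫_ℂ = 0} :=
      isClosed_eq (by fun_prop) continuous_const
    refine closure_minimal ?_ hcl hp
    intro q hq
    induction hq using Submodule.span_induction with
    | mem q hq =>
      have := h q hq r hr
      rw [hI ψ hψ] at this
      change ⟪q.1, ψ r - ψ a⟫_ℂ + _ = _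
      rw [inner_sub_right, this]
      ring
    | zero => simp
    | add q q' _ _ h1 h2 =>
      change ⟪q.1 + q'.1, _⟫_ℂ + Complex.I * ⟪q.2 + q'.2, _⟫_ℂ = 0
      change ⟪q.1, _⟫_ℂ + Complex.I * ⟪q.2, _⟫_ℂ = 0 at h1
      change ⟪q'.1, _⟫_ℂ + Complex.I * ⟪q'.2, _⟫_ℂ = 0 at h2
      rw [inner_add_left, inner_add_left]
      linear_combination h1 + h2
    | smul c q _ h1 =>
      change ⟪c • q.1, _⟫_ℂ + Complex.I * ⟪c • q.2, _⟫_ℂ = 0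
      change ⟪q.1, _⟫_ℂ + Complex.I * ⟪q.2, _⟫_ℂ = 0 at h1
      rw [inner_smul_left, inner_smul_left]
      linear_combination (starRingEnd ℂ) c * h1
  have hU : Continuous fun s => H.evol (s - a) (ψ a) :=
    (H.evol_continuous _).comp (continuous_id.sub continuous_const)
  refine sub_eq_zero.1 (H.eq_zero_of_weak_solution
    (χ := fun r => ψ r - H.evol (r - a) (ψ a)) (hψ.sub hU) (fun p hp r hr => ?_) hr)
  have h1 := H.inner_evol_sub (x := p.1) (y := p.2) hp (ψ a) a r
  rw [hI _ hU] at h1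
  have h2 := hgraph p hp r hr
  rw [inner_sub_right] at h2
  rw [intervalIntegral.integral_sub (hψ.intervalIntegrable _ _) (hU.intervalIntegrable _ _),
    inner_sub_right, inner_sub_right, h1]
  linear_combination h2

end Hamiltonian

/-! ### Integrability criteria -/

/-- The term equals √((4x²y)^n / n!) · √(4^{-n}), and the product of two square roots is at most the
sum of the radicands: an exponential series plus a geometric one. -/
theorem summable_pow_mul_sqrt {x y : ℝ} (hx : 0 ≤ x) (hy : 0 ≤ y) :
    Summable fun n : ℕ => x ^ n * Real.sqrt (y ^ n * n.factorial) / n.factorial := by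
  have h1 : Summable fun n : ℕ => (4 * (x ^ 2 * y)) ^ n / (n.factorial : ℝ) :=
    Real.summable_pow_div_factorial _
  have h2 : Summable fun n : ℕ => (1 / 4 : ℝ) ^ n :=
    summable_geometric_of_lt_one (by norm_num) (by norm_num)
  refine Summable.of_nonneg_of_le (fun n => by positivity) (fun n => ?_) (h1.add h2)
  have hn : (0 : ℝ) < n.factorial := by positivity
  have h3 : x ^ n * Real.sqrt (y ^ n * n.factorial) / n.factorial =
      Real.sqrt ((4 * (x ^ 2 * y)) ^ n / (n.factorial : ℝ)) * Real.sqrt ((1 / 4 : ℝ) ^ n) := by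
    rw [← Real.sqrt_mul (by positivity)]
    symm
    rw [Real.sqrt_eq_iff_mul_self_eq (by positivity) (by positivity), div_mul_div_comm,
      mul_mul_mul_comm, Real.mul_self_sqrt (by positivity)]
    have h4 : (4 * (x ^ 2 * y)) ^ n / (n.factorial : ℝ) * (1 / 4) ^ n =
        (x ^ n) * (x ^ n) * y ^ n / n.factorial := by
      rw [div_mul_eq_mul_div, ← mul_pow, ← mul_pow, ← mul_pow]
      congr 2
      ring
    rw [h4]
    field_simp
  rw [h3]
  nlinarith [sq_nonneg (Real.sqrt ((4 * (x ^ 2 * y)) ^ n / (n.factorial : ℝ)) -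
    Real.sqrt ((1 / 4 : ℝ) ^ n)), Real.sq_sqrt (show 0 ≤ (4 * (x ^ 2 * y)) ^ n /
      (n.factorial : ℝ) by positivity), Real.sq_sqrt (show (0 : ℝ) ≤ (1 / 4) ^ n by positivity)]

/-- The growth rate allowed for functions of a finite set of times. -/
def growth (x y : ℝ) (n : ℕ) : ℝ := x ^ n * Real.sqrt (y ^ n * n.factorial)

theorem growth_nonneg {x : ℝ} (hx : 0 ≤ x) (y : ℝ) (n : ℕ) : 0 ≤ growth x y n :=
  mul_nonneg (pow_nonneg hx n) (Real.sqrt_nonneg _)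

/-- The sector of n times has mass T^n / n!, which beats a growth of order √(n!). All integrability
claims for the Dyson series and the resummation rest on this. -/
theorem integrable_of_growth {X : Type*} [NormedAddCommGroup X] {si sf : ℝ} {f : Conf → X}
    (hf : AEStronglyMeasurable f (timeMeasure si sf)) {C x y : ℝ} (hx : 0 ≤ x) (hy : 0 ≤ y)
    (h : ∀ c : Conf, (∀ x ∈ c.times, x ∈ Set.Ioo si sf) →
      ‖f c‖ ≤ C * growth x y c.times.card) : Integrable f (timeMeasure si sf) := by
  refine integrable_conf_of_le (b := fun n => C * growth x y n) hf ?_ ?_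
  · set T := ((volume : Measure ℝ).restrict (Set.Ioo si sf)).real Set.univ
    have := (summable_pow_mul_sqrt (x := x * T) (y := y)
      (mul_nonneg hx measureReal_nonneg) hy).mul_left C
    refine this.congr fun n => ?_
    rw [growth, mul_pow]
    ring
  · filter_upwards [ae_timeMeasure_mem si sf, ae_timeMeasure_injective si sf] with c h1 h2
    refine (h c h1).trans_eq ?_
    rw [Conf.times, Finset.card_image_of_injective _ h2, Finset.card_univ, Fintype.card_fin]

/-- For 2n times there are at most 2^n n! pairings, and (n!)² ≤ (2n)! turns n! into the square root
of the factorial of the number of times. -/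
theorem norm_pairSum_le_growth {B : ℝ → ℝ → ℂ} {K : ℝ} (hK : 0 ≤ K) {A : Finset ℝ}
    (hB : ∀ x ∈ A, ∀ y ∈ A, x < y → ‖B x y‖ ≤ K) : ‖pairSum B A‖ ≤ growth 1 (2 * K) A.card := by
  rcases Nat.even_or_odd' A.card with ⟨n, hn | hn⟩
  · refine (norm_pairSum_le hK hB hn).trans ?_
    rw [growth, one_pow, one_mul]
    refine Real.le_sqrt_of_sq_le ?_
    rw [hn, mul_pow, ← pow_mul, mul_comm n 2]
    gcongr
    have := Nat.factorial_mul_factorial_dvd_factorial_add n n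
    rw [sq, two_mul]
    exact_mod_cast Nat.le_of_dvd (Nat.factorial_pos _) this
  · rw [pairSum_odd (by rw [hn]; exact Nat.not_even_two_mul_add_one n), norm_zero]
    exact growth_nonneg zero_le_one _ _

end

noncomputable section

open MeasureTheory Filter

/-! ### Operations on measurable functions of finite sets of times -/

section TimeMeasurable

variable {X Y Z : Type*} [TopologicalSpace X] [TopologicalSpace Y] [TopologicalSpace Z] {si sf : ℝ}

theorem TimeMeasurable.map₂ {f : Finset ℝ → X} {g : Finset ℝ → Y} (hf : TimeMeasurable si sf f)
    (hg : TimeMeasurable si sf g) {op : X → Y → Z} (hop : Continuous fun z : X × Y => op z.1 z.2) :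
    TimeMeasurable si sf fun A => op (f A) (g A) := by
  intro n
  obtain ⟨f', hf', hff⟩ := hf n
  obtain ⟨g', hg', hgg⟩ := hg n
  exact ⟨fun s => op (f' s) (g' s), hop.comp_stronglyMeasurable (hf'.prodMk hg'), fun s hs => by
    simp only [hff s hs, hgg s hs]⟩

theorem timeMeasurable_card (c : ℕ → X) : TimeMeasurable si sf fun A => c A.card := fun n =>
  ⟨fun _ => c n, stronglyMeasurable_const, fun s hs => by
    simp only [Finset.card_image_of_injective _ hs.1.injective, Finset.card_univ, Fintype.card_fin]⟩

theorem TimeMeasurable.ite [Zero X] {f : Finset ℝ → X} (hf : TimeMeasurable si sf f)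
    {p : Finset ℝ → Prop} [DecidablePred p]
    (hp : ∀ n, MeasurableSet {s : Fin n → ℝ | p (Finset.univ.image s)}) :
    TimeMeasurable si sf fun A => if p A then f A else 0 := by
  intro n
  obtain ⟨g, hg, hgf⟩ := hf n
  exact ⟨fun s => if p (Finset.univ.image s) then g s else 0,
    hg.ite (hp n) stronglyMeasurable_const, fun s hs => by simp only [hgf s hs]⟩

theorem TimeMeasurable.mono {f : Finset ℝ → X} (hf : TimeMeasurable si sf f) {a b : ℝ}
    (ha : si ≤ a) (hb : b ≤ sf) : TimeMeasurable a b f := by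
  intro n
  obtain ⟨g, hg, hgf⟩ := hf n
  exact ⟨g, hg, fun s hs => hgf s ⟨hs.1, fun i => ⟨ha.trans_lt (hs.2 i).1, (hs.2 i).2.trans_le hb⟩⟩⟩

/-- A representative is required on the whole simplex, so the null set of tuples that already
contain `x` has to be treated separately. -/
theorem TimeMeasurable.insert_const {X : Type*} [NormedAddCommGroup X] {f : Finset ℝ → X}
    (hf : TimeMeasurable si sf f) {x : ℝ} (hx : x ∈ Set.Ioo si sf) :
    TimeMeasurable si sf fun A => f (insert x A) := by
  classical
  intro n
  obtain ⟨g, hg, hgf⟩ := hf n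
  obtain ⟨G, hG, hfG⟩ := hf.exists_conf
  have hm : MeasurableSet {s : Fin n → ℝ | ∃ j, s j = x} := by
    have : {s : Fin n → ℝ | ∃ j, s j = x} = ⋃ j, (fun s => s j) ⁻¹' {x} := by
      ext s
      simp
    rw [this]
    exact MeasurableSet.iUnion fun j => measurable_pi_apply j (measurableSet_singleton x)
  refine ⟨fun s => if ∃ j, s j = x then g s else G ((confOf {x}).append (confMk n s)),
    hg.ite hm (hG.comp_measurable (Conf.measurable_append.comp (measurable_const.prodMk
      (measurableEmbedding_confMk n).measurable))), fun s hs => ?_⟩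
  have hmem : ∀ y, y ∈ (confMk n s).times ↔ ∃ j, s j = y := fun y => Conf.mem_times
  dsimp only
  split_ifs with h
  · obtain ⟨j, rfl⟩ := h
    rw [Finset.insert_eq_of_mem (Finset.mem_image_of_mem _ (Finset.mem_univ j)), hgf s hs]
  · have himg : insert x (Finset.univ.image s) = ((confOf {x}).append (confMk n s)).times := by
      rw [Conf.times_append, times_confOf]
      rfl
    rw [himg]
    refine hfG _ (Conf.append_injective (Finset.orderEmbOfFin _ rfl).injective hs.1.injective ?_) ?_
    · rw [times_confOf, Finset.disjoint_singleton_left, hmem]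
      exact h
    · rw [← himg]
      intro y hy
      rcases Finset.mem_insert.1 hy with rfl | hy
      · exact hx
      · exact mem_Ioo_of_mem_image hs y hy

theorem TimeMeasurable.union_const {X : Type*} [NormedAddCommGroup X] {f : Finset ℝ → X}
    (hf : TimeMeasurable si sf f) {A : Finset ℝ} (hA : ∀ x ∈ A, x ∈ Set.Ioo si sf) :
    TimeMeasurable si sf fun B => f (A ∪ B) := by
  induction A using Finset.induction_on generalizing f with
  | empty => simpa using hf
  | insert x A _ ih =>
    have := ih (hf.insert_const (hA x (Finset.mem_insert_self x A))) fun y hy =>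
      hA y (Finset.mem_insert_of_mem hy)
    simpa only [Finset.insert_union] using this

end TimeMeasurable

/-- The larger of `a` and the last time in `A`. -/
def lastTime (a : ℝ) (A : Finset ℝ) : ℝ := A.fold max a id

theorem lastTime_lt {a r : ℝ} {A : Finset ℝ} : lastTime a A < r ↔ a < r ∧ ∀ x ∈ A, x < r :=
  Finset.fold_max_lt r

theorem le_lastTime (a : ℝ) (A : Finset ℝ) : a ≤ lastTime a A :=
  (Finset.le_fold_max a).2 (Or.inl le_rfl)

theorem lastTime_insert {a x : ℝ} {A : Finset ℝ} (h : ∀ y ∈ A, y < x) (hx : a < x) :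
    lastTime a (insert x A) = x := by
  have hn : x ∉ A := fun h' => lt_irrefl _ (h x h')
  rw [lastTime, Finset.fold_insert hn]
  exact max_eq_left (lastTime_lt.2 ⟨hx, h⟩).le

theorem lastTime_insert_of_le {a x : ℝ} {A : Finset ℝ} (h : ∀ y ∈ A, y < x) (hx : x ≤ a) :
    lastTime a (insert x A) = a := by
  refine le_antisymm ((Finset.fold_max_le a).2 ⟨le_rfl, fun y hy => ?_⟩) (le_lastTime _ _)
  rcases Finset.mem_insert.1 hy with rfl | hy
  exacts [hx, (h y hy).le.trans hx]

theorem measurableSet_forall_lt (n : ℕ) (r : ℝ) :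
    MeasurableSet {s : Fin n → ℝ | ∀ x ∈ Finset.univ.image s, x < r} := by
  have : {s : Fin n → ℝ | ∀ x ∈ Finset.univ.image s, x < r} = ⋂ i, {s | s i < r} := by
    ext s
    simp
  rw [this]
  exact MeasurableSet.iInter fun i => measurable_pi_apply i measurableSet_Iio

theorem measurable_lastTime (a : ℝ) (n : ℕ) :
    Measurable fun s : Fin n → ℝ => lastTime a (Finset.univ.image s) := by
  refine measurable_of_Iio fun r => ?_
  have : (fun s : Fin n → ℝ => lastTime a (Finset.univ.image s)) ⁻¹' Set.Iio r =
      {_s : Fin n → ℝ | a < r} ∩ {s : Fin n → ℝ | ∀ x ∈ Finset.univ.image s, x < r} := by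
    ext s
    exact lastTime_lt
  rw [this]
  exact (MeasurableSet.const _).inter (measurableSet_forall_lt n r)

theorem timeMeasurable_lastTime (a si sf : ℝ) : TimeMeasurable si sf (lastTime a) := fun n =>
  ⟨_, (measurable_lastTime a n).stronglyMeasurable, fun _ _ => rfl⟩

theorem measurable_lastTime_times (a : ℝ) : Measurable fun c : Conf => lastTime a c.times :=
  (stronglyMeasurable_conf fun n => (measurable_lastTime a n).stronglyMeasurable).measurable

/-! ### The weak Schrödinger equation for a Dyson series -/

section WeakDyson

variable {G : Type*} [NormedAddCommGroup G] [InnerProductSpace ℂ G] [CompleteSpace G]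
  {si t : ℝ} {f : Finset ℝ → G}

/-- The part of the integral of `f` over finite sets of times before `r`. -/
def partialDyson (si t : ℝ) (f : Finset ℝ → G) (r : ℝ) : G :=
  ∫ c : Conf, (if ∀ x ∈ c.times, x < r then f c.times else 0) ∂timeMeasure si t

theorem TimeMeasurable.ite_lt (hm : TimeMeasurable si t f) (r : ℝ) :
    TimeMeasurable si t fun B => if ∀ x ∈ B, x < r then f B else 0 :=
  hm.ite fun n => measurableSet_forall_lt n r

theorem integrable_ite_lt (hm : TimeMeasurable si t f)
    (hi : Integrable (fun c : Conf => f c.times) (timeMeasure si t)) (r : ℝ) :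
    Integrable (fun c : Conf => if ∀ x ∈ c.times, x < r then f c.times else 0)
      (timeMeasure si t) := by
  refine hi.mono (hm.ite_lt r).aestronglyMeasurable (ae_of_all _ fun c => ?_)
  split_ifs <;> simp

/-- Dominated convergence: the integrand for a given configuration can jump at r only if r is one of
its times, and such configurations form a null set. -/
theorem continuous_partialDyson (hm : TimeMeasurable si t f)
    (hi : Integrable (fun c : Conf => f c.times) (timeMeasure si t)) :
    Continuous (partialDyson si t f) := by
  rw [continuous_iff_continuousAt]
  intro r
  refine continuousAt_of_dominated (bound := fun c : Conf => ‖f c.times‖)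
    (Eventually.of_forall fun s => (hm.ite_lt s).aestronglyMeasurable)
    (Eventually.of_forall fun s => ae_of_all _ fun c => ?_) hi.norm ?_
  · split_ifs <;> simp
  · filter_upwards [ae_timeMeasure_notMem si t r] with c hc
    have h : ∀ᶠ s in nhds r, ∀ x ∈ c.times, (x < s ↔ x < r) := by
      rw [Filter.eventually_all_finset]
      intro x hx
      rcases lt_trichotomy x r with h | h | h
      · filter_upwards [eventually_gt_nhds h] with s hs
        exact ⟨fun _ => h, fun _ => hs⟩
      · exact absurd (h ▸ hx) hc
      · filter_upwards [eventually_lt_nhds h] with s hs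
        exact ⟨fun h' => absurd h' hs.asymm, fun h' => absurd h' h.asymm⟩
    refine ContinuousAt.congr continuousAt_const (EventuallyEq.symm ?_)
      (f := fun _ => if ∀ x ∈ c.times, x < r then f c.times else 0)
    filter_upwards [h] with s hs
    have : (∀ x ∈ c.times, x < s) ↔ ∀ x ∈ c.times, x < r :=
      forall₂_congr hs
    simp only [this]

variable {U : ℝ → G →L[ℂ] G}

theorem inner_partialDyson (hm : TimeMeasurable si t f)
    (hi : Integrable (fun c : Conf => f c.times) (timeMeasure si t)) (z : G) (r : ℝ) :
    ⟪z, U r (partialDyson si t f r)⟫_ℂ =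
      ∫ c : Conf, (if ∀ x ∈ c.times, x < r then ⟪z, U r (f c.times)⟫_ℂ else 0)
        ∂timeMeasure si t := by
  have := ((innerSL ℂ z).comp (U r)).integral_comp_comm (integrable_ite_lt hm hi r)
  rw [partialDyson]
  refine this.symm.trans (integral_congr_ae (ae_of_all _ fun c => ?_))
  dsimp only
  split_ifs <;> simp

/-- Integrating over the last time x separately, hypothesis `hj` trades the insertion at x for the
vector ζ, and the earlier times integrate to `partialDyson` at x. This produces the interaction part
of the equation. -/
theorem integral_lastTime_jump (hm : TimeMeasurable si t f)
    (hi : Integrable (fun c : Conf => f c.times) (timeMeasure si t))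
    (hU : Continuous fun z : ℝ × G => U z.1 z.2) (hU1 : ∀ s z, ‖U s z‖ ≤ ‖z‖) {a : ℝ}
    (ha : si ≤ a) {φ ζ : G}
    (hj : ∀ x ∈ Set.Ioo a t, ∀ B : Finset ℝ, (∀ y ∈ B, y < x) →
      ⟪φ, U x (f (insert x B))⟫_ℂ = -(Complex.I * ⟪ζ, U x (f B)⟫_ℂ))
    {r : ℝ} (har : a ≤ r) (hrt : r ≤ t) :
    Integrable (fun c : Conf => if a < lastTime a c.times ∧ lastTime a c.times < r then
      ⟪φ, U (lastTime a c.times) (f c.times)⟫_ℂ else 0) (timeMeasure si t) ∧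
    ∫ c : Conf, (if a < lastTime a c.times ∧ lastTime a c.times < r then
      ⟪φ, U (lastTime a c.times) (f c.times)⟫_ℂ else 0) ∂timeMeasure si t =
      -(Complex.I * ∫ s in a..r, ⟪ζ, U s (partialDyson si t f s)⟫_ℂ) := by
  let J : Finset ℝ → ℂ := fun B =>
    if a < lastTime a B ∧ lastTime a B < r then ⟪φ, U (lastTime a B) (f B)⟫_ℂ else 0
  have hJm : TimeMeasurable si t J := by
    refine TimeMeasurable.ite ?_ fun n => ?_
    · exact (timeMeasurable_lastTime a si t).map₂ hm (op := fun s z => ⟪φ, U s z⟫_ℂ)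
        (continuous_const.inner hU)
    · exact (measurable_lastTime a n) measurableSet_Ioo
  have hJi : Integrable (fun c : Conf => J c.times) (timeMeasure si t) := by
    refine (hi.norm.const_mul ‖φ‖).mono' hJm.aestronglyMeasurable (ae_of_all _ fun c => ?_)
    simp only [J]
    split_ifs
    · exact (norm_inner_le_norm _ _).trans (by gcongr; exact hU1 _ _)
    · rw [norm_zero]; positivity
  refine ⟨hJi, (integral_times_last hJm hJi).trans ?_⟩
  have h0 : J ∅ = 0 := by simp [J, lastTime]
  rw [h0, zero_add, intervalIntegral.integral_of_le har, integral_Ioc_eq_integral_Ioo,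
    ← integral_const_mul, ← integral_neg]
  have h1 : ∀ x ∈ Set.Ioo si t, (∫ c : Conf, (if ∀ y ∈ c.times, y < x then
      J (insert x c.times) else 0) ∂timeMeasure si t) = (Set.Ioo a r).indicator
        (fun s => -(Complex.I * ⟪ζ, U s (partialDyson si t f s)⟫_ℂ)) x := by
    intro x hx
    by_cases hxa : x ∈ Set.Ioo a r
    · rw [Set.indicator_of_mem hxa, inner_partialDyson hm hi, ← integral_const_mul,
        ← integral_neg]
      refine integral_congr_ae (ae_of_all _ fun c => ?_)
      dsimp only
      split_ifs with h
      · simp only [J, lastTime_insert h hxa.1, hxa.1, hxa.2, and_self, if_true]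
        exact hj x ⟨hxa.1, hx.2⟩ _ h
      · simp
    · rw [Set.indicator_of_notMem hxa]
      refine integral_eq_zero_of_ae (ae_of_all _ fun c => ?_)
      dsimp only
      split_ifs with h
      · simp only [J]
        refine if_neg fun h' => hxa ?_
        rcases lt_or_ge a x with h2 | h2
        · rwa [lastTime_insert h h2] at h'
        · rw [lastTime_insert_of_le h h2] at h'
          exact absurd h'.1 (lt_irrefl _)
      · rfl
  rw [setIntegral_congr_fun measurableSet_Ioo h1, setIntegral_indicator measurableSet_Ioo,
    Set.inter_eq_right.2 (Set.Ioo_subset_Ioo ha hrt)]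

/-- Fubini for configurations and the running time s: at fixed s, the configurations whose last time
precedes s integrate to `partialDyson` at s. This produces the free part of the equation. -/
theorem integral_lastTime_drift (hm : TimeMeasurable si t f)
    (hi : Integrable (fun c : Conf => f c.times) (timeMeasure si t))
    (hU : Continuous fun z : ℝ × G => U z.1 z.2) (hU1 : ∀ s z, ‖U s z‖ ≤ ‖z‖) {a : ℝ}
    (η : G) {r : ℝ} (har : a ≤ r) :
    Integrable (fun c : Conf => ∫ s in Set.Ioc a r,
      (if lastTime a c.times < s then ⟪η, U s (f c.times)⟫_ℂ else 0)) (timeMeasure si t) ∧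
    ∫ c : Conf, (∫ s in Set.Ioc a r,
      (if lastTime a c.times < s then ⟪η, U s (f c.times)⟫_ℂ else 0)) ∂timeMeasure si t =
      ∫ s in a..r, ⟪η, U s (partialDyson si t f s)⟫_ℂ := by
  have hset : MeasurableSet {z : Conf × ℝ | lastTime a z.1.times < z.2} :=
    measurableSet_lt ((measurable_lastTime_times a).comp measurable_fst) measurable_snd
  have hη : Continuous fun z : ℝ × G => ⟪η, U z.1 z.2⟫_ℂ := continuous_const.inner hU
  have h2 : AEStronglyMeasurable (fun z : Conf × ℝ => f z.1.times)
      ((timeMeasure si t).prod (volume.restrict (Set.Ioc a r))) :=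
    hi.aestronglyMeasurable.comp_fst
  have h3 : AEStronglyMeasurable (fun z : Conf × ℝ => (z.2, f z.1.times))
      ((timeMeasure si t).prod (volume.restrict (Set.Ioc a r))) :=
    measurable_snd.aestronglyMeasurable.prodMk h2
  have h4 := (hη.comp_aestronglyMeasurable h3).indicator hset
  have hQi : Integrable (fun z : Conf × ℝ =>
      if lastTime a z.1.times < z.2 then ⟪η, U z.2 (f z.1.times)⟫_ℂ else 0)
      ((timeMeasure si t).prod (volume.restrict (Set.Ioc a r))) := by
    refine ((hi.comp_fst _).norm.const_mul ‖η‖).mono' h4 (ae_of_all _ fun z => ?_)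
    split_ifs
    · exact (norm_inner_le_norm _ _).trans (by gcongr; exact hU1 _ _)
    · rw [norm_zero]; positivity
  refine ⟨hQi.integral_prod_left, ?_⟩
  rw [integral_integral_swap (f := fun (c : Conf) (s : ℝ) =>
    if lastTime a c.times < s then ⟪η, U s (f c.times)⟫_ℂ else 0) hQi,
    intervalIntegral.integral_of_le har]
  refine setIntegral_congr_fun measurableSet_Ioc fun s hs => ?_
  rw [inner_partialDyson hm hi]
  refine integral_congr_ae (ae_of_all _ fun c => ?_)
  have : (∀ x ∈ c.times, x < s) ↔ lastTime a c.times < s :=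
    ⟨fun h => lastTime_lt.2 ⟨hs.1, h⟩, fun h => (lastTime_lt.1 h).2⟩
  simp only [this]

/-- A configuration with last time m is switched on at m and then moves only by the free evolution;
this is the fundamental theorem of calculus on [m, r]. -/
theorem eq_add_integral_drift (hU : Continuous fun z : ℝ × G => U z.1 z.2) {φ η : G}
    (hd : ∀ z s, HasDerivAt (fun s => ⟪φ, U s z⟫_ℂ) (-(Complex.I * ⟪η, U s z⟫_ℂ)) s) (z : G)
    {a m r : ℝ} (ham : a ≤ m) : (if m < r then ⟪φ, U r z⟫_ℂ else 0) =
      (if m < r then ⟪φ, U m z⟫_ℂ else 0) -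
        Complex.I * ∫ s in Set.Ioc a r, if m < s then ⟪η, U s z⟫_ℂ else 0 := by
  have hc : Continuous fun s => ⟪η, U s z⟫_ℂ :=
    continuous_const.inner (hU.comp (continuous_id.prodMk continuous_const))
  have h0 : ∫ s in Set.Ioc a r, (if m < s then ⟪η, U s z⟫_ℂ else 0) =
      ∫ s in Set.Ioc m r, ⟪η, U s z⟫_ℂ := by
    have h1 : (fun s => if m < s then ⟪η, U s z⟫_ℂ else 0) =
        (Set.Ioi m).indicator fun s => ⟪η, U s z⟫_ℂ := by
      ext s
      simp [Set.indicator]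
    have h2 : Set.Ioc a r ∩ Set.Ioi m = Set.Ioc m r := by
      ext s
      simp only [Set.mem_inter_iff, Set.mem_Ioc, Set.mem_Ioi]
      exact ⟨fun h => ⟨h.2, h.1.2⟩, fun h => ⟨⟨ham.trans_lt h.1, h.2⟩, h.1⟩⟩
    rw [h1, setIntegral_indicator measurableSet_Ioi, h2]
  rw [h0]
  split_ifs with h
  · have := intervalIntegral.integral_eq_sub_of_hasDerivAt (a := m) (b := r) (fun s _ => hd z s)
      ((continuous_const.mul hc).neg.intervalIntegrable m r)
    rw [intervalIntegral.integral_neg, intervalIntegral.integral_const_mul,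
      intervalIntegral.integral_of_le h.le] at this
    linear_combination -this
  · rw [Set.Ioc_eq_empty h]
    simp

/-- Each configuration enters at its last time and afterwards drifts freely. Integrated over
configurations, the entries give the coupling term ζ and the drift gives the free term η. Every
operator acts on test vectors, so `partialDyson` itself need not lie in any domain. -/
theorem partialDyson_weak_solution (hm : TimeMeasurable si t f)
    (hi : Integrable (fun c : Conf => f c.times) (timeMeasure si t))
    (hU : Continuous fun z : ℝ × G => U z.1 z.2) (hU1 : ∀ s z, ‖U s z‖ ≤ ‖z‖) {a : ℝ}
    (ha : si ≤ a) {φ η ζ : G}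
    (hd : ∀ z s, HasDerivAt (fun s => ⟪φ, U s z⟫_ℂ) (-(Complex.I * ⟪η, U s z⟫_ℂ)) s)
    (hj : ∀ x ∈ Set.Ioo a t, ∀ B : Finset ℝ, (∀ y ∈ B, y < x) →
      ⟪φ, U x (f (insert x B))⟫_ℂ = -(Complex.I * ⟪ζ, U x (f B)⟫_ℂ))
    {r : ℝ} (hr : r ∈ Set.Icc a t) :
    ⟪φ, U r (partialDyson si t f r)⟫_ℂ = ⟪φ, U a (partialDyson si t f a)⟫_ℂ -
      Complex.I * ∫ s in a..r, ⟪η + ζ, U s (partialDyson si t f s)⟫_ℂ := by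
  rcases hr.1.eq_or_lt with rfl | har
  · simp
  have hψ : Continuous fun s => U s (partialDyson si t f s) :=
    hU.comp (continuous_id.prodMk (continuous_partialDyson hm hi))
  obtain ⟨hJi, hJ⟩ := integral_lastTime_jump hm hi hU hU1 ha hj har.le hr.2
  obtain ⟨hQi, hQ⟩ := integral_lastTime_drift hm hi hU hU1 η har.le
  -- The starting value of a configuration is taken at max(a, last time): those complete before a
  -- contribute the initial value, the others jump in during (a, r).
  have hsplit : ∀ᵐ c ∂timeMeasure si t,
      (if lastTime a c.times < r then ⟪φ, U (lastTime a c.times) (f c.times)⟫_ℂ else 0) =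
      (if ∀ x ∈ c.times, x < a then ⟪φ, U a (f c.times)⟫_ℂ else 0) +
        if a < lastTime a c.times ∧ lastTime a c.times < r then
          ⟪φ, U (lastTime a c.times) (f c.times)⟫_ℂ else 0 := by
    filter_upwards [ae_timeMeasure_notMem si t a] with c hc
    by_cases h : ∀ x ∈ c.times, x < a
    · have h1 : lastTime a c.times = a :=
        le_antisymm ((Finset.fold_max_le a).2 ⟨le_rfl, fun x hx => (h x hx).le⟩) (le_lastTime _ _)
      rw [h1, if_pos har, if_pos h, if_neg (by simp), add_zero]
    · have h1 : a < lastTime a c.times := by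
        push Not at h
        obtain ⟨x, hx, hxa⟩ := h
        refine (Finset.lt_fold_max a).2 (Or.inr ⟨x, hx, lt_of_le_of_ne hxa ?_⟩)
        rintro rfl
        exact hc hx
      rw [if_neg h, zero_add]
      simp only [h1, true_and]
  have hI1 : Integrable (fun c : Conf =>
      if ∀ x ∈ c.times, x < a then ⟪φ, U a (f c.times)⟫_ℂ else 0) (timeMeasure si t) := by
    have := ((innerSL ℂ φ).comp (U a)).integrable_comp (integrable_ite_lt hm hi a)
    refine this.congr (ae_of_all _ fun c => ?_)
    dsimp only
    split_ifs <;> simp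
  have e1 : ⟪φ, U r (partialDyson si t f r)⟫_ℂ = ∫ c : Conf,
      ((if ∀ x ∈ c.times, x < a then ⟪φ, U a (f c.times)⟫_ℂ else 0) +
        if a < lastTime a c.times ∧ lastTime a c.times < r then
          ⟪φ, U (lastTime a c.times) (f c.times)⟫_ℂ else 0) -
        Complex.I * (∫ s in Set.Ioc a r,
          if lastTime a c.times < s then ⟪η, U s (f c.times)⟫_ℂ else 0) ∂timeMeasure si t := by
    rw [inner_partialDyson hm hi]
    refine integral_congr_ae ?_
    filter_upwards [hsplit] with c hc
    have hiff : (∀ x ∈ c.times, x < r) ↔ lastTime a c.times < r :=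
      ⟨fun h => lastTime_lt.2 ⟨har, h⟩, fun h => (lastTime_lt.1 h).2⟩
    rw [← hc, ← eq_add_integral_drift hU hd _ (le_lastTime a c.times)]
    simp only [hiff]
  have hadd : ∀ {p q k : Conf → ℂ}, Integrable p (timeMeasure si t) →
      Integrable q (timeMeasure si t) → Integrable k (timeMeasure si t) →
      ∫ c, (p c + q c) - Complex.I * k c ∂timeMeasure si t = ∫ c, p c ∂timeMeasure si t +
        ∫ c, q c ∂timeMeasure si t - Complex.I * ∫ c, k c ∂timeMeasure si t := by
    intro p q k hp hq hk
    rw [integral_sub (f := fun c => p c + q c) (hp.add hq) (hk.const_mul _), integral_add hp hq,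
      integral_const_mul]
  rw [e1, hadd hI1 hJi hQi, hJ, hQ, ← inner_partialDyson hm hi]
  simp only [inner_add_left]
  rw [intervalIntegral.integral_add]
  · ring
  · exact (continuous_const.inner hψ).intervalIntegrable _ _
  · exact (continuous_const.inner hψ).intervalIntegrable _ _

end WeakDyson

end

noncomputable section

open MeasureTheory Filter

/-! ### The Dyson series of the coupled system -/

section Free

variable {E F : Type*} [NormedAddCommGroup E] [InnerProductSpace ℂ E]
  [NormedAddCommGroup F] [InnerProductSpace ℂ F]

theorem norm_tensorOp_apply_le (A : E →L[ℂ] E) (B : F →L[ℂ] F) (z : HilbertTensor E F) :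
    ‖tensorOp A B z‖ ≤ ‖A‖ * ‖B‖ * ‖z‖ := by
  refine UniformSpace.Completion.induction_on z (isClosed_le (by fun_prop) (by fun_prop))
    fun w => ?_
  rw [tensorOp, ContinuousLinearMap.completion_apply_coe, UniformSpace.Completion.norm_coe,
    UniformSpace.Completion.norm_coe]
  exact ((TensorProduct.mapL A B).le_opNorm w).trans
    (mul_le_mul_of_nonneg_right (TensorProduct.norm_mapL_le A B) (norm_nonneg w))

variable [CompleteSpace E] [CompleteSpace F]

theorem Hamiltonian.opNorm_evol_le (H : Hamiltonian E) (s : ℝ) : ‖H.evol s‖ ≤ 1 :=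
  ContinuousLinearMap.opNorm_le_bound _ zero_le_one fun x => by rw [H.norm_evol, one_mul]

theorem Hamiltonian.hasDerivAt_evol_neg (H : Hamiltonian E) {x y : E} (h : (x, y) ∈ H.op.graph)
    (s : ℝ) : HasDerivAt (fun s : ℝ => H.evol (-s) x) (Complex.I • H.evol (-s) y) s := by
  have := (H.hasDerivAt_evol h (-s)).scomp s (hasDerivAt_neg s)
  simpa [Function.comp_def] using this

/-- The uncoupled evolution of two systems. -/
def freeEvol (Hs : Hamiltonian E) (Hb : Hamiltonian F) (s : ℝ) :
    HilbertTensor E F →L[ℂ] HilbertTensor E F := tensorOp (Hs.evol s) (Hb.evol s)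

variable (Hs : Hamiltonian E) (Hb : Hamiltonian F)

theorem norm_freeEvol_le (s : ℝ) (z : HilbertTensor E F) : ‖freeEvol Hs Hb s z‖ ≤ ‖z‖ := by
  refine (norm_tensorOp_apply_le _ _ z).trans ?_
  have := mul_le_mul (Hs.opNorm_evol_le s) (Hb.opNorm_evol_le s) (norm_nonneg _) zero_le_one
  rw [one_mul] at this
  exact mul_le_of_le_one_left (norm_nonneg z) this

theorem freeEvol_elemTensor (s : ℝ) (x : E) (y : F) :
    freeEvol Hs Hb s (elemTensor x y) = elemTensor (Hs.evol s x) (Hb.evol s y) :=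
  tensorOp_elemTensor _ _ _ _

theorem continuous_freeEvol_apply (z : HilbertTensor E F) :
    Continuous fun s => freeEvol Hs Hb s z := by
  have halg : ∀ w : E ⊗[ℂ] F, Continuous fun s => freeEvol Hs Hb s (w : HilbertTensor E F) := by
    intro w
    induction w using TensorProduct.induction_on with
    | zero =>
      simp only [UniformSpace.Completion.coe_zero, map_zero]
      exact continuous_const
    | tmul x y =>
      have : (fun s => freeEvol Hs Hb s ((x ⊗ₜ[ℂ] y : E ⊗[ℂ] F) : HilbertTensor E F)) =
          fun s => elemTensor (Hs.evol s x) (Hb.evol s y) :=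
        funext fun s => freeEvol_elemTensor Hs Hb s x y
      rw [this]
      exact continuous_elemTensor.comp ((Hs.evol_continuous x).prodMk (Hb.evol_continuous y))
    | add a b ha hb =>
      simp only [UniformSpace.Completion.coe_add, map_add]
      exact ha.add hb
  refine continuous_of_uniform_approx_of_continuous fun u hu => ?_
  obtain ⟨ε, hε, hεu⟩ := Metric.mem_uniformity_dist.1 hu
  obtain ⟨w, hw⟩ := (UniformSpace.Completion.denseRange_coe (α := E ⊗[ℂ] F)).exists_dist_lt z hε
  refine ⟨fun s => freeEvol Hs Hb s (w : HilbertTensor E F), halg w, fun s => hεu ?_⟩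
  rw [dist_eq_norm, ← map_sub]
  exact (norm_freeEvol_le Hs Hb s _).trans_lt (by rwa [← dist_eq_norm])

theorem continuous_freeEvol :
    Continuous fun z : ℝ × HilbertTensor E F => freeEvol Hs Hb z.1 z.2 := by
  rw [continuous_iff_continuousAt]
  rintro ⟨s, x⟩
  have h1 : Tendsto (fun z : ℝ × HilbertTensor E F => freeEvol Hs Hb z.1 x) (nhds (s, x))
      (nhds (freeEvol Hs Hb s x)) :=
    ((continuous_freeEvol_apply Hs Hb x).tendsto s).comp (continuous_fst.tendsto (s, x))
  have h2 : Tendsto (fun z : ℝ × HilbertTensor E F => freeEvol Hs Hb z.1 (z.2 - x)) (nhds (s, x))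
      (nhds 0) := by
    refine squeeze_zero_norm (a := fun z : ℝ × HilbertTensor E F => ‖z.2 - x‖)
      (fun z => norm_freeEvol_le Hs Hb z.1 _) ?_
    have : Continuous fun z : ℝ × HilbertTensor E F => ‖z.2 - x‖ := by fun_prop
    simpa using this.tendsto (s, x)
  have h3 := h1.add h2
  rw [add_zero] at h3
  refine h3.congr fun z => ?_
  rw [← map_add, add_sub_cancel]

theorem inner_freeEvol (s : ℝ) (x : E) (y : F) (z : HilbertTensor E F) :
    ⟪elemTensor x y, freeEvol Hs Hb s z⟫_ℂ =
      ⟪elemTensor (Hs.evol (-s) x) (Hb.evol (-s) y), z⟫_ℂ := by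
  have : (innerSL ℂ (elemTensor x y)).comp (freeEvol Hs Hb s) =
      innerSL ℂ (elemTensor (Hs.evol (-s) x) (Hb.evol (-s) y)) := by
    refine hilbertTensor_ext fun x' y' => ?_
    simp only [ContinuousLinearMap.comp_apply, innerSL_apply_apply, freeEvol_elemTensor,
      inner_elemTensor, Hamiltonian.inner_evol_neg]
  exact congrArg (fun L => L z) this

/-- The evolution is moved onto the elementary tensor, whose factors lie in the domains, so the
derivative exists for arbitrary `z`. -/
theorem hasDerivAt_inner_freeEvol {x x' : E} {y y' : F} (hx : (x, x') ∈ Hs.op.graph)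
    (hy : (y, y') ∈ Hb.op.graph) (z : HilbertTensor E F) (s : ℝ) :
    HasDerivAt (fun s => ⟪elemTensor x y, freeEvol Hs Hb s z⟫_ℂ)
      (-(Complex.I * ⟪elemTensor x' y + elemTensor x y', freeEvol Hs Hb s z⟫_ℂ)) s := by
  have h1 := ((elemTensorL (E := E) (F := F)).bilinearRestrictScalars ℝ).hasDerivAt_of_bilinear
    (fun _ => Hs.hasDerivAt_evol_neg hx s) (fun _ => Hb.hasDerivAt_evol_neg hy s)
  have h2 := h1.inner ℂ (hasDerivAt_const s z)
  simp only [ContinuousLinearMap.bilinearRestrictScalars_apply_apply, elemTensorL_apply,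
    elemTensor_smul_left, elemTensor_smul_right, inner_zero_right, zero_add, inner_add_left,
    inner_smul_left, Complex.conj_I] at h2
  simp only [inner_freeEvol, inner_add_left]
  refine h2.congr_deriv ?_
  ring

end Free

/-! ### The Dyson series with insertions and its sum -/

section Dyson

variable {κ E F : Type*} [NormedAddCommGroup E] [InnerProductSpace ℂ E] [CompleteSpace E]
  [NormedAddCommGroup F] [InnerProductSpace ℂ F] [CompleteSpace F]

theorem Hamiltonian.norm_timeProd_le (H : Hamiltonian E) (W : E →L[ℂ] E) (C : Finset ℝ) (v : E) :
    ‖timeProd (heisenberg H.evol W) C v‖ ≤ ‖W‖ ^ C.card * ‖v‖ := by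
  induction C using Finset.induction_on_max with
  | empty => simp
  | insert a C ha ih =>
    rw [timeProd_insert_max _ ha, Finset.card_insert_of_notMem fun h => lt_irrefl _ (ha a h)]
    change ‖H.evol (-a) (W (H.evol a (timeProd (heisenberg H.evol W) C v)))‖ ≤ _
    rw [H.norm_evol, pow_succ', mul_assoc]
    refine (W.le_opNorm _).trans ?_
    rw [H.norm_evol]
    gcongr

variable {bath : ThermalBath κ F} (Hs : Hamiltonian E) (V : BathCoupling bath) (Ws : E →L[ℂ] E)

/-- The term of the Dyson series with couplings at the times `B` and additional insertions of
the system operator at the times `A`. -/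
def dysonTerm (k : κ) (v : E) (A B : Finset ℝ) : HilbertTensor E F :=
  (-Complex.I) ^ B.card • elemTensor (timeProd (heisenberg Hs.evol Ws) (A ∪ B) v) (V.timeVec k B)

variable {Hs V Ws} {k : κ} {v : E} {si t : ℝ}

theorem timeMeasurable_dysonTerm {A : Finset ℝ} (hA : ∀ x ∈ A, x ∈ Set.Ioo si t) :
    TimeMeasurable si t (dysonTerm Hs V Ws k v A) := by
  have h1 := ((Hs.timeMeasurable_timeProd Ws v si t).union_const hA).map₂
    (V.timeMeasurable_timeVec k si t) continuous_elemTensor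
  exact (timeMeasurable_card fun n => (-Complex.I) ^ n).map₂ h1
    (op := fun (c : ℂ) (z : HilbertTensor E F) => c • z) continuous_smul

/-- The maximum with 1 makes powers monotone in the exponent, since A ∪ B may have fewer points than
A and B together. -/
theorem norm_dysonTerm_le (hV : V.Wick t) (ht : 0 < t) {K : ℝ} (hK : 0 ≤ K)
    (hVK : ∀ τ₁ τ₂, 0 ≤ τ₁ → τ₁ ≤ τ₂ → τ₂ ≤ 2 * t → ‖V.corr t τ₁ τ₂‖ ≤ K) (A : Finset ℝ)
    {B : Finset ℝ} (hB : ∀ x ∈ B, x ∈ Set.Ioo 0 t) :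
    ‖dysonTerm Hs V Ws k v A B‖ ≤ (max ‖Ws‖ 1 ^ A.card * ‖v‖ * Real.sqrt (bath.prob k)⁻¹) *
      growth (max ‖Ws‖ 1) (2 * K) B.card := by
  rw [dysonTerm, norm_smul, norm_pow, norm_neg, Complex.norm_I, one_pow, one_mul, norm_elemTensor]
  have h1 : ‖timeProd (heisenberg Hs.evol Ws) (A ∪ B) v‖ ≤
      max ‖Ws‖ 1 ^ A.card * max ‖Ws‖ 1 ^ B.card * ‖v‖ := by
    refine (Hs.norm_timeProd_le Ws _ v).trans ?_
    gcongr
    rw [← pow_add]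
    calc ‖Ws‖ ^ (A ∪ B).card ≤ max ‖Ws‖ 1 ^ (A ∪ B).card := by gcongr; exact le_max_left _ _
      _ ≤ _ := pow_le_pow_right₀ (le_max_right _ _) (Finset.card_union_le A B)
  have h2 := hV.norm_timeVec_le ht hK hVK hB k
  rw [div_eq_mul_inv, Real.sqrt_mul (by positivity)] at h2
  refine (mul_le_mul h1 h2 (norm_nonneg _) (by positivity)).trans_eq ?_
  rw [growth]
  ring

theorem integrable_dysonTerm (hV : V.Wick t) (ht : 0 < t) (hsi : 0 ≤ si)
    (hB : V.BoundedCorr t) {A : Finset ℝ} (hA : ∀ x ∈ A, x ∈ Set.Ioo si t) :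
    Integrable (fun c : Conf => dysonTerm Hs V Ws k v A c.times) (timeMeasure si t) := by
  obtain ⟨K, hK⟩ := hB
  have hK0 : 0 ≤ K := (norm_nonneg _).trans (hK 0 0 le_rfl le_rfl (by linarith))
  exact integrable_of_growth (timeMeasurable_dysonTerm hA).aestronglyMeasurable
    (le_max_of_le_right zero_le_one) (by positivity) fun c hc =>
      norm_dysonTerm_le hV ht hK0 hK A fun x hx => ⟨hsi.trans_lt (hc x hx).1, (hc x hx).2⟩

/-- The free evolution up to x cancels the outer half of the latest Heisenberg factor, which exposes
W_s ⊗ W_b. Both are symmetric and move to the test vector; the extra time supplies the factor -i. -/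
theorem inner_dysonTerm_insert (hWs : IsSelfAdjoint Ws) {A : Finset ℝ} {x : ℝ}
    (hA : ∀ y ∈ A, y < x) {B : Finset ℝ} (hB : ∀ y ∈ B, y < x) (φ : E) (χ : V.dom) :
    ⟪elemTensor φ (χ : F), freeEvol Hs bath.ham x (dysonTerm Hs V Ws k v A (insert x B))⟫_ℂ =
      -(Complex.I * ⟪elemTensor (Ws φ) ((V.op χ : V.dom) : F),
        freeEvol Hs bath.ham x (dysonTerm Hs V Ws k v A B)⟫_ℂ) := by
  have hAB : ∀ y ∈ A ∪ B, y < x := fun y hy =>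
    (Finset.mem_union.1 hy).elim (hA y) (hB y)
  have h1 : ∀ w, ⟪Ws φ, w⟫_ℂ = ⟪φ, Ws w⟫_ℂ := hWs.isSymmetric φ
  have h2 : Hs.evol x (timeProd (heisenberg Hs.evol Ws) (A ∪ insert x B) v) =
      Ws (Hs.evol x (timeProd (heisenberg Hs.evol Ws) (A ∪ B) v)) := by
    rw [Finset.union_insert, timeProd_insert_max _ hAB]
    exact Hs.evol_evol_neg x _
  have h3 : ⟪(χ : F), bath.ham.evol x (V.timeVec k (insert x B))⟫_ℂ =
      ⟪((V.op χ : V.dom) : F), bath.ham.evol x (V.timeVec k B)⟫_ℂ := by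
    have h4 : bath.ham.evol x (V.timeVec k (insert x B)) =
        (V.op (V.evol x (timeProd (heisenberg V.evol V.op) B (V.eigenvec k))) : V.dom) := by
      rw [BathCoupling.timeVec, timeProd_insert_max _ hB]
      exact bath.ham.evol_evol_neg x _
    rw [h4, ← V.symmetric]
    rfl
  rw [dysonTerm, dysonTerm, map_smul, map_smul, freeEvol_elemTensor, freeEvol_elemTensor,
    inner_smul_right, inner_smul_right, inner_elemTensor, inner_elemTensor, h2, h3, h1,
    Finset.card_insert_of_notMem fun h => lt_irrefl _ (hB x h), pow_succ]
  ring

/-- After the last insertion every new time comes from the coupling, so the partial sum solves the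
Schrödinger equation for H weakly on [a, t]; uniqueness identifies it. -/
theorem dyson_evolution {H : Hamiltonian (HilbertTensor E F)} (hH : IsTotalHamiltonian Hs V Ws H)
    (hWs : IsSelfAdjoint Ws) (hV : V.Wick t) (ht : 0 < t) (hsi : 0 ≤ si)
    (hB : V.BoundedCorr t) {A : Finset ℝ} (hA : ∀ x ∈ A, x ∈ Set.Ioo si t) {a r : ℝ}
    (ha : si ≤ a) (hAa : ∀ x ∈ A, x ≤ a) (hr : r ∈ Set.Icc a t) :
    freeEvol Hs bath.ham r (partialDyson si t (dysonTerm Hs V Ws k v A) r) = H.evol (r - a)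
      (freeEvol Hs bath.ham a (partialDyson si t (dysonTerm Hs V Ws k v A) a)) := by
  have hm := timeMeasurable_dysonTerm (Hs := Hs) (V := V) (Ws := Ws) (k := k) (v := v) hA
  have hi := integrable_dysonTerm (Hs := Hs) (Ws := Ws) (k := k) (v := v) hV ht hsi hB hA
  have hU := continuous_freeEvol Hs bath.ham
  have hψ := hU.comp (continuous_id.prodMk (continuous_partialDyson hm hi))
  have hS := hH
  rw [IsTotalHamiltonian, interactingGraph] at hS
  refine H.eq_evol_of_weak_solution hS hψ ?_ hr
  rintro p ⟨x, y, hy, rfl⟩ r hr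
  have hd := hasDerivAt_inner_freeEvol Hs bath.ham (Hs.op.mem_graph x) (bath.ham.op.mem_graph y)
  have hj : ∀ s ∈ Set.Ioo a t, ∀ B : Finset ℝ, (∀ z ∈ B, z < s) →
      ⟪elemTensor (x : E) (y : F),
        freeEvol Hs bath.ham s (dysonTerm Hs V Ws k v A (insert s B))⟫_ℂ =
      -(Complex.I * ⟪elemTensor (Ws x) ((V.op ⟨y, hy⟩ : V.dom) : F),
        freeEvol Hs bath.ham s (dysonTerm Hs V Ws k v A B)⟫_ℂ) := fun s hs B hBs =>
    inner_dysonTerm_insert hWs (fun z hz => (hAa z hz).trans_lt hs.1) hBs (x : E) ⟨(y : F), hy⟩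
  exact partialDyson_weak_solution hm hi hU (norm_freeEvol_le Hs bath.ham) ha hd hj hr

theorem partialDyson_dysonTerm_self :
    partialDyson si t (dysonTerm Hs V Ws k v ∅) si = elemTensor v (bath.eigenvector k) := by
  rw [partialDyson]
  refine Eq.trans (integral_congr_ae ?_)
    (integral_timeMeasure_empty (si := si) (sf := t) (elemTensor v (bath.eigenvector k))).2
  filter_upwards [ae_timeMeasure_mem si t] with c hc
  by_cases h : c.times = ∅
  · simp [h, dysonTerm, V.timeVec_empty]
  · obtain ⟨x, hx⟩ := Finset.nonempty_iff_ne_empty.2 h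
    rw [if_neg h, if_neg]
    exact fun h' => lt_asymm (h' x hx) (hc x hx).1

/-- Only times before x occur in the partial sum at x, so an insertion at x is the leftmost system
factor and can be pulled out of the integral. -/
theorem partialDyson_dysonTerm_insert (hi : ∀ {A : Finset ℝ}, (∀ x ∈ A, x ∈ Set.Ioo si t) →
      Integrable (fun c : Conf => dysonTerm Hs V Ws k v A c.times) (timeMeasure si t))
    {A : Finset ℝ} (hA : ∀ x ∈ A, x ∈ Set.Ioo si t) {x : ℝ} (hx : ∀ y ∈ A, y < x) :
    freeEvol Hs bath.ham x (partialDyson si t (dysonTerm Hs V Ws k v (insert x A)) x) =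
      tensorOp Ws 1 (freeEvol Hs bath.ham x (partialDyson si t (dysonTerm Hs V Ws k v A) x)) := by
  have h1 : partialDyson si t (dysonTerm Hs V Ws k v (insert x A)) x =
      tensorOp (heisenberg Hs.evol Ws x) 1 (partialDyson si t (dysonTerm Hs V Ws k v A) x) := by
    rw [partialDyson, partialDyson, ← ContinuousLinearMap.integral_comp_comm _
      (integrable_ite_lt (timeMeasurable_dysonTerm hA) (hi hA) x)]
    refine integral_congr_ae (ae_of_all _ fun c => ?_)
    dsimp only
    split_ifs with h
    · have hAB : ∀ y ∈ A ∪ c.times, y < x := fun y hy =>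
        (Finset.mem_union.1 hy).elim (hx y) (h y)
      rw [dysonTerm, dysonTerm, map_smul, tensorOp_elemTensor, Finset.insert_union,
        timeProd_insert_max _ hAB]
      rfl
    · rw [map_zero]
  have h2 : freeEvol Hs bath.ham x * tensorOp (heisenberg Hs.evol Ws x) 1 =
      tensorOp Ws 1 * freeEvol Hs bath.ham x := by
    rw [freeEvol, tensorOp_mul, tensorOp_mul, mul_one, one_mul, heisenberg, ← mul_assoc, ← mul_assoc,
      ← Hs.evol_add, add_neg_cancel, Hs.evol_zero, one_mul]
  rw [h1]
  exact congrArg (fun L => L (partialDyson si t (dysonTerm Hs V Ws k v A) x)) h2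

/-- Induction on the insertions: evolve with H from the latest one, remove it as a factor W_s ⊗ 1,
and continue. At the start si only the empty configuration contributes. -/
theorem dyson_series {H : Hamiltonian (HilbertTensor E F)} (hH : IsTotalHamiltonian Hs V Ws H)
    (hWs : IsSelfAdjoint Ws) (hV : V.Wick t) (ht : 0 < t) (hsi : 0 ≤ si)
    (hB : V.BoundedCorr t) {A : Finset ℝ} (hA : ∀ x ∈ A, x ∈ Set.Ioo si t) {r : ℝ}
    (hsr : si ≤ r) (hrt : r ≤ t) (hAr : ∀ x ∈ A, x ≤ r) :
    freeEvol Hs bath.ham r (partialDyson si t (dysonTerm Hs V Ws k v A) r) =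
      H.evol r (timeProd (heisenberg H.evol (tensorOp Ws 1)) A
        (H.evol (-si) (freeEvol Hs bath.ham si (elemTensor v (bath.eigenvector k))))) := by
  induction A using Finset.induction_on_max generalizing r with
  | empty =>
    rw [dyson_evolution hH hWs hV ht hsi hB hA le_rfl (by simp) ⟨hsr, hrt⟩,
      partialDyson_dysonTerm_self, sub_eq_add_neg, H.evol_add_apply, timeProd_empty]
    rfl
  | insert x A hx ih =>
    have hA' : ∀ y ∈ A, y ∈ Set.Ioo si t := fun y hy => hA y (Finset.mem_insert_of_mem hy)
    have hxm := hA x (Finset.mem_insert_self x A)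
    have hxr := hAr x (Finset.mem_insert_self x A)
    rw [dyson_evolution hH hWs hV ht hsi hB hA hxm.1.le (fun y hy => by
        rcases Finset.mem_insert.1 hy with rfl | hy
        exacts [le_rfl, (hx y hy).le]) ⟨hxr, hrt⟩,
      partialDyson_dysonTerm_insert (integrable_dysonTerm hV ht hsi hB) hA' hx,
      ih hA' hxm.1.le hxm.2.le fun y hy => (hx y hy).le, sub_eq_add_neg, H.evol_add_apply,
      timeProd_insert_max _ hx]
    rfl

theorem integral_dysonTerm {H : Hamiltonian (HilbertTensor E F)}
    (hH : IsTotalHamiltonian Hs V Ws H) (hWs : IsSelfAdjoint Ws) (hV : V.Wick t) (ht : 0 < t)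
    (hsi : 0 ≤ si) (hst : si ≤ t) (hB : V.BoundedCorr t) {A : Finset ℝ}
    (hA : ∀ x ∈ A, x ∈ Set.Ioo si t) :
    freeEvol Hs bath.ham t (∫ c : Conf, dysonTerm Hs V Ws k v A c.times ∂timeMeasure si t) =
      H.evol t (timeProd (heisenberg H.evol (tensorOp Ws 1)) A
        (H.evol (-si) (freeEvol Hs bath.ham si (elemTensor v (bath.eigenvector k))))) := by
  rw [← dyson_series hH hWs hV ht hsi hB hA hst le_rfl fun x hx => (hA x hx).2.le, partialDyson]
  congr 1
  refine integral_congr_ae ?_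
  filter_upwards [ae_timeMeasure_mem si t] with c hc
  rw [if_pos fun x hx => (hc x hx).2]

end Dyson

end

noncomputable section

open MeasureTheory Filter
open scoped ENNReal

/-! ### Splitting the contour at its tip -/

section Split

variable {si sf t : ℝ}

theorem measurableSet_times_lt (t : ℝ) : MeasurableSet {c : Conf | ∀ x ∈ c.times, x < t} :=
  measurableSet_conf fun n => measurableSet_forall_lt n t

theorem timeMeasure_eq_restrict (si : ℝ) (h : t ≤ sf) :
    timeMeasure si t = (timeMeasure si sf).restrict {c | ∀ x ∈ c.times, x < t} := by
  rw [timeMeasure, timeMeasure, confMeasure, confMeasure,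
    Measure.restrict_sum _ (measurableSet_times_lt t)]
  congr 1
  ext1 n
  rw [Measure.restrict_smul, (measurableEmbedding_confMk n).restrict_map]
  have h1 : confMk n ⁻¹' {c | ∀ x ∈ c.times, x < t} = Set.univ.pi fun _ => Set.Iio t := by
    ext s
    simp [confMk, Conf.times, Set.mem_pi]
  have h2 : Set.Iio t ∩ Set.Ioo si sf = Set.Ioo si t := by
    ext x
    simp only [Set.mem_inter_iff, Set.mem_Iio, Set.mem_Ioo]
    exact ⟨fun h => ⟨h.2.1, h.1⟩, fun h' => ⟨h'.2, h'.1, h'.2.trans_le h⟩⟩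
  rw [h1, Measure.restrict_pi_pi]
  simp only [Measure.restrict_restrict measurableSet_Iio, h2]

variable {X : Type*} [NormedAddCommGroup X] {Ψ : Finset ℝ → X}

theorem sum_powerset_split {C : Finset ℝ} (hC : t ∉ C) (x : X) :
    ∑ A ∈ C.powerset, (if (∀ y ∈ A, y < t) ∧ ∀ y ∈ C \ A, t < y then x else 0) = x := by
  rw [Finset.sum_eq_single (C.filter fun y => y < t)]
  · rw [if_pos]
    refine ⟨fun y hy => (Finset.mem_filter.1 hy).2, fun y hy => ?_⟩
    rw [Finset.mem_sdiff, Finset.mem_filter, not_and, not_lt] at hy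
    exact lt_of_le_of_ne (hy.2 hy.1) fun h => hC (h ▸ hy.1)
  · intro A hA hne
    refine if_neg fun h => hne ?_
    ext y
    rw [Finset.mem_filter]
    refine ⟨fun hy => ⟨Finset.mem_powerset.1 hA hy, h.1 y hy⟩, fun hy => ?_⟩
    by_contra hyA
    exact lt_asymm hy.2 (h.2 y (Finset.mem_sdiff.2 ⟨hy.1, hyA⟩))
  · exact fun h => absurd (Finset.mem_powerset.2 (Finset.filter_subset _ _)) h

/-- A configuration that avoids the tip splits in exactly one way into times before and times after
it. -/
theorem integral_split_at [NormedSpace ℝ X] (hm : TimeMeasurable si sf Ψ)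
    (hi : Integrable (fun c : Conf => Ψ c.times) (timeMeasure si sf)) (t : ℝ) :
    Integrable (fun z : Conf × Conf => if (∀ y ∈ z.1.times, y < t) ∧ ∀ y ∈ z.2.times, t < y then
      Ψ (z.1.times ∪ z.2.times) else 0) ((timeMeasure si sf).prod (timeMeasure si sf)) ∧
    ∫ z : Conf × Conf, (if (∀ y ∈ z.1.times, y < t) ∧ ∀ y ∈ z.2.times, t < y then
      Ψ (z.1.times ∪ z.2.times) else 0) ∂(timeMeasure si sf).prod (timeMeasure si sf) =
      ∫ c : Conf, Ψ c.times ∂timeMeasure si sf := by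
  let Φ : Finset ℝ → Finset ℝ → X := fun A A' =>
    if (∀ y ∈ A, y < t) ∧ ∀ y ∈ A', t < y then Ψ (A ∪ A') else 0
  have hsum : ∀ c : Conf, t ∉ c.times →
      ∑ A ∈ c.times.powerset, Φ A (c.times \ A) = Ψ c.times := by
    intro c hc
    rw [← sum_powerset_split hc (Ψ c.times)]
    refine Finset.sum_congr rfl fun A hA => ?_
    simp only [Φ, Finset.union_sdiff_of_subset (Finset.mem_powerset.1 hA)]
  have hset : MeasurableSet {z : Conf × Conf | (∀ y ∈ z.1.times, y < t) ∧
      ∀ y ∈ z.2.times, t < y} := by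
    have h1 : MeasurableSet {c : Conf | ∀ y ∈ c.times, t < y} := by
      refine measurableSet_conf fun n => ?_
      have : confMk n ⁻¹' {c | ∀ y ∈ c.times, t < y} = Set.univ.pi fun _ => Set.Ioi t := by
        ext s
        simp [confMk, Conf.times, Set.mem_pi]
      rw [this]
      exact MeasurableSet.univ_pi fun _ => measurableSet_Ioi
    exact ((measurableSet_times_lt t).preimage measurable_fst).inter (h1.preimage measurable_snd)
  have hΦm : AEStronglyMeasurable (fun z : Conf × Conf => Φ z.1.times z.2.times)
      ((timeMeasure si sf).prod (timeMeasure si sf)) := by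
    refine (hm.union.indicator hset).congr (ae_of_all _ fun z => ?_)
    simp [Φ, Set.indicator]
  have hΦ : Integrable (fun z : Conf × Conf => Φ z.1.times z.2.times)
      ((timeMeasure si sf).prod (timeMeasure si sf)) := by
    refine integrable_of_confSplit hΦm (hi.norm.congr ?_)
    filter_upwards [ae_timeMeasure_injective si sf, ae_timeMeasure_notMem si sf t] with c h1 h2
    simp only [times_confSplit]
    rw [sum_finset_image h1 fun A A' => ‖Φ A A'‖]
    change ‖Ψ c.times‖ = ∑ A ∈ c.times.powerset, ‖Φ A (c.times \ A)‖
    rw [← sum_powerset_split h2 ‖Ψ c.times‖]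
    refine Finset.sum_congr rfl fun A hA => ?_
    simp only [Φ, Finset.union_sdiff_of_subset (Finset.mem_powerset.1 hA)]
    split_ifs <;> simp
  refine ⟨hΦ, (integral_prod_times hΦ).trans (integral_congr_ae ?_)⟩
  filter_upwards [ae_timeMeasure_notMem si sf t] with c hc
  exact hsum c hc

/-- Because si + sf = 2t, the reflection maps the half (t, sf) onto (si, t), and both branches
become integrals over the same interval. -/
theorem integral_split_reflect [NormedSpace ℝ X] (hm : TimeMeasurable si sf Ψ)
    (hi : Integrable (fun c : Conf => Ψ c.times) (timeMeasure si sf)) (ht : si + sf = 2 * t)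
    (hts : t ≤ sf) : ∫ c : Conf, Ψ c.times ∂timeMeasure si sf =
      ∫ z : Conf × Conf, Ψ (z.1.times ∪ z.2.times.image fun x => 2 * t - x)
        ∂(timeMeasure si t).prod (timeMeasure si t) := by
  obtain ⟨h1, h2⟩ := integral_split_at hm hi t
  have hmp : MeasurePreserving (Prod.map id (confReflect (si + sf)))
      ((timeMeasure si sf).prod (timeMeasure si sf)) ((timeMeasure si sf).prod (timeMeasure si sf)) :=
    (MeasurePreserving.id _).prod (measurePreserving_confReflect si sf)
  have h3 := integral_map hmp.measurable.aemeasurable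
    (hmp.map_eq.symm ▸ h1.aestronglyMeasurable)
  rw [hmp.map_eq] at h3
  rw [← h2, h3, timeMeasure_eq_restrict si hts, Measure.prod_restrict, ← integral_indicator
    ((measurableSet_times_lt t).prod (measurableSet_times_lt t))]
  congr 1
  ext z
  have e1 : (confReflect (si + sf) z.2).times = z.2.times.image fun x => 2 * t - x := by
    rw [times_confReflect, ht]
  have e2 : (∀ y ∈ z.2.times.image fun x => 2 * t - x, t < y) ↔ ∀ y ∈ z.2.times, y < t := by
    rw [Finset.forall_mem_image]
    exact forall₂_congr fun x _ => ⟨fun h => by linarith, fun h => by linarith⟩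
  simp only [Prod.map_fst, Prod.map_snd, id_eq, e1, e2]
  simp only [Set.indicator, Set.mem_prod]
  rfl

end Split

/-! ### The form associated with a contour ordered product -/

section Form

variable {E : Type*} [NormedAddCommGroup E] [InnerProductSpace ℂ E] [CompleteSpace E]

/-- The diagonal element of a contour ordered product, with the part of the contour after its
tip moved to the left of the inner product. -/
def keldyshForm (H : Hamiltonian E) (O W : E →L[ℂ] E) (t : ℝ) (v : E) (C : Finset ℝ) : ℂ :=
  ⟪H.evol t (timeProd (heisenberg H.evol W) ((C.filter fun x => t ≤ x).image fun x => 2 * t - x) v),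
    O (H.evol t (timeProd (heisenberg H.evol W) (C.filter fun x => x < t) v))⟫_ℂ

variable {H : Hamiltonian E} {O W : E →L[ℂ] E} {t si sf : ℝ}

/-- The factors left of the tip are the adjoint of a time-ordered product at the reflected times.
With si + sf = 2t both branches start from the same vector, which gives a form in one vector. -/
theorem inner_orderedChain (hW : ∀ x y, ⟪W x, y⟫_ℂ = ⟪x, W y⟫_ℂ) (hsi : si < t)
    (hsum : si + sf = 2 * t) {m : ℕ} {s : Fin m → ℝ} (hs : s ∈ timeSimplex m si sf) (x : E) :
    ⟪x, orderedChain (keldyshPropagator H.evol O t) W si m s sf x⟫_ℂ =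
      keldyshForm H O W t (H.evol (-si) x) (Finset.univ.image s) := by
  let R : (E →L[ℂ] E) → (E →L[ℂ] E) → Prop := fun a b => ∀ x y, ⟪a x, y⟫_ℂ = ⟪x, b y⟫_ℂ
  have hU : ∀ s, R (H.evol (-s)) (H.evol s) := fun s x y => H.inner_evol_neg s x y
  have hmul : ∀ a b c d, R a b → R c d → R (a * c) (d * b) := fun a b c d h h' x y =>
    (h (c x) y).trans (h' x (b y))
  have hheis : ∀ s, R (heisenberg H.evol W s) (heisenberg H.evol W s) := fun s => by
    have h1 := hmul _ _ _ _ (hmul _ _ _ _ (hU s) hW) (hU (-s))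
    rwa [neg_neg, ← mul_assoc] at h1
  have hadj := timeProd_reflect R (fun _ _ => rfl) hmul (heisenberg H.evol W)
    (heisenberg H.evol W) hheis (2 * t) ((Finset.univ.image s).filter fun x => t ≤ x)
  rw [orderedChain_keldysh_ge H.evol_add O W hsi hs.1 (fun j => (hs.2 j).2) (by linarith),
    show 2 * t - sf = si by linarith]
  have hUt := hU (-t)
  rw [neg_neg] at hUt
  rw [keldyshForm, hUt, hadj, hU]
  rfl

theorem norm_keldyshForm_le (v : E) (C : Finset ℝ) :
    ‖keldyshForm H O W t v C‖ ≤ ‖O‖ * max ‖W‖ 1 ^ C.card * ‖v‖ ^ 2 := by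
  have hT : ∀ B : Finset ℝ, ‖H.evol t (timeProd (heisenberg H.evol W) B v)‖ ≤
      max ‖W‖ 1 ^ B.card * ‖v‖ := fun B => by
    rw [H.norm_evol]
    refine (H.norm_timeProd_le W B v).trans ?_
    gcongr
    exact le_max_left _ _
  refine (norm_inner_le_norm _ _).trans ?_
  refine (mul_le_mul (hT _) ((O.le_opNorm _).trans (mul_le_mul_of_nonneg_left (hT _)
    (norm_nonneg O))) (norm_nonneg _) (by positivity)).trans ?_
  rw [Finset.card_image_of_injective _ sub_right_injective]
  have hcard : (C.filter fun x => t ≤ x).card + (C.filter fun x => x < t).card = C.card := by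
    rw [add_comm, ← Finset.card_filter_add_card_filter_not (s := C) (fun x => x < t)]
    simp only [not_lt]
  rw [← hcard, pow_add]
  apply le_of_eq
  ring

theorem hasSum_keldyshForm (hW : ∀ x y, ⟪W x, y⟫_ℂ = ⟪x, W y⟫_ℂ) (hsi : si < t)
    (hsum : si + sf = 2 * t) {ι : Type*} {w : ι → E} (hw : Summable fun i => ‖w i‖ ^ 2)
    {ρ : E →L[ℂ] E} (hρ : ∀ x, HasSum (fun i => ⟪w i, x⟫_ℂ • w i) (ρ x)) {C : Finset ℝ}
    (hC : ∀ x ∈ C, x ∈ Set.Ioo si sf) :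
    HasSum (fun i => keldyshForm H O W t (H.evol (-si) (w i)) C) (onFinset (fun m s =>
      hilbertTrace (ρ * orderedChain (keldyshPropagator H.evol O t) W si m s sf)) C) := by
  have hs : (⇑(C.orderEmbOfFin rfl) : Fin C.card → ℝ) ∈ timeSimplex C.card si sf :=
    ⟨(C.orderEmbOfFin rfl).strictMono, fun i => hC _ (Finset.orderEmbOfFin_mem C rfl i)⟩
  have himg : Finset.univ.image (C.orderEmbOfFin rfl) = C := times_confOf C
  refine (hasSum_hilbertTrace hw hρ _).congr_fun fun i => ?_
  rw [inner_orderedChain hW hsi hsum hs, himg]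

theorem timeMeasurable_trace {ι : Type*} [Countable ι] {w : ι → E}
    (hw : Summable fun i => ‖w i‖ ^ 2)
    {ρ : E →L[ℂ] E} (hρ : ∀ x, HasSum (fun i => ⟪w i, x⟫_ℂ • w i) (ρ x)) (O W : E →L[ℂ] E)
    (t si sf : ℝ) : TimeMeasurable si sf (onFinset (fun m s =>
      hilbertTrace (ρ * orderedChain (keldyshPropagator H.evol O t) W si m s sf))) := by
  refine timeMeasurable_onFinset fun n => ⟨_, ?_, fun s _ => rfl⟩
  refine stronglyMeasurable_of_hasSum (f := fun i s =>
    ⟪w i, orderedChain (keldyshPropagator H.evol O t) W si n s sf (w i)⟫_ℂ) (fun i => ?_)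
    fun s => hasSum_hilbertTrace hw hρ _
  exact stronglyMeasurable_const.inner
    (H.stronglyMeasurable_orderedChain O W t si (w i) measurable_id measurable_const)

end Form

end

noncomputable section

open MeasureTheory Filter

/-! ### The Dyson series of the full trace -/

theorem integral_prod_inner {α β G : Type*} [MeasurableSpace α] [MeasurableSpace β]
    {μ : Measure α} {ν : Measure β} [SFinite μ] [SFinite ν] [NormedAddCommGroup G]
    [InnerProductSpace ℂ G] [CompleteSpace G] {f : α → G} {g : β → G} (hf : Integrable f μ)
    (hg : Integrable g ν) :
    Integrable (fun z : α × β => ⟪g z.2, f z.1⟫_ℂ) (μ.prod ν) ∧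
      ∫ z, ⟪g z.2, f z.1⟫_ℂ ∂μ.prod ν = ⟪∫ y, g y ∂ν, ∫ x, f x ∂μ⟫_ℂ := by
  have hi : Integrable (fun z : α × β => ⟪g z.2, f z.1⟫_ℂ) (μ.prod ν) := by
    refine (hf.norm.mul_prod hg.norm).mono'
      (hg.aestronglyMeasurable.comp_snd.inner hf.aestronglyMeasurable.comp_fst)
      (ae_of_all _ fun z => ?_)
    rw [mul_comm]
    exact norm_inner_le_norm _ _
  refine ⟨hi, ?_⟩
  rw [integral_prod _ hi, ← integral_inner hf]
  congr 1
  ext x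
  calc ∫ y, ⟪g y, f x⟫_ℂ ∂ν = ∫ y, (starRingEnd ℂ) ⟪f x, g y⟫_ℂ ∂ν := by
        simp only [inner_conj_symm]
    _ = _ := by rw [integral_conj, integral_inner hg, inner_conj_symm]

theorem hasSum_mul_of_hasSum {ι κ : Type*} {f : ι → ℂ} {g : κ → ℂ} {a b : ℂ} (hf : HasSum f a)
    (hg : HasSum g b) (c : ℂ) :
    HasSum (fun z : ι × κ => c * (f z.1 * g z.2)) (c * a * b) := by
  have h := (hf.mul hg (summable_mul_of_summable_norm hf.summable.norm hg.summable.norm)).mul_left c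
  rwa [← mul_assoc] at h

/-- The phase `i ^ m (-1) ^ #{s < t}` of a set of times. -/
def contourPhase (t : ℝ) (C : Finset ℝ) : ℂ :=
  Complex.I ^ C.card * (-1) ^ (C.filter fun x => x < t).card

theorem norm_contourPhase (t : ℝ) (C : Finset ℝ) : ‖contourPhase t C‖ = 1 := by
  simp [contourPhase]

theorem contourPhase_union (t : ℝ) {A C : Finset ℝ} (h : Disjoint A C) :
    contourPhase t (A ∪ C) = contourPhase t A * contourPhase t C := by
  rw [contourPhase, Finset.card_union_of_disjoint h, Finset.filter_union,
    Finset.card_union_of_disjoint (Finset.disjoint_filter_filter h), pow_add, pow_add]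
  simp only [contourPhase]
  ring

/-- A forward time carries -i and a backward time i, the conjugate of -i: these are the coefficients
of two Dyson series, the one in the left slot of the inner product being conjugated. -/
theorem contourPhase_reflect {t : ℝ} {B B' : Finset ℝ} (hB : ∀ x ∈ B, x < t)
    (hB' : ∀ x ∈ B', x < t) : contourPhase t (B ∪ B'.image fun x => 2 * t - x) =
      Complex.I ^ B'.card * (-Complex.I) ^ B.card := by
  have hd : Disjoint B (B'.image fun x => 2 * t - x) := by
    rw [Finset.disjoint_left]
    intro x hx hx'
    obtain ⟨y, hy, rfl⟩ := Finset.mem_image.1 hx'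
    linarith [hB _ hx, hB' y hy]
  rw [contourPhase, (BathCoupling.filter_contour hB hB').1, Finset.card_union_of_disjoint hd,
    Finset.card_image_of_injective _ sub_right_injective, pow_add, neg_pow Complex.I]
  ring

theorem timeMeasurable_contourPhase (t si sf : ℝ) : TimeMeasurable si sf (contourPhase t) :=
  (timeMeasurable_card fun n => Complex.I ^ n).map₂
    ((timeMeasurable_card fun n => (-1 : ℂ) ^ n).filter (fun x => x < t)
      (fun _ _ h h' => h.trans h') measurableSet_Iio) continuous_mul

section Trace

variable {E : Type*} [NormedAddCommGroup E] [InnerProductSpace ℂ E] [CompleteSpace E]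

/-- The trace of a density against the contour ordered product with insertions at a set of
times. -/
def chainTrace (H : Hamiltonian E) (ρ O W : E →L[ℂ] E) (t si sf : ℝ) (C : Finset ℝ) : ℂ :=
  onFinset (fun m s =>
    hilbertTrace (ρ * orderedChain (keldyshPropagator H.evol O t) W si m s sf)) C

variable {H : Hamiltonian E} {O W ρ : E →L[ℂ] E} {t si sf : ℝ}

theorem hasSum_chainTrace (hW : ∀ x y, ⟪W x, y⟫_ℂ = ⟪x, W y⟫_ℂ) (hsi : si < t)
    (hsum : si + sf = 2 * t) {ι : Type*} {w : ι → E} (hw : Summable fun i => ‖w i‖ ^ 2)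
    (hρ : ∀ x, HasSum (fun i => ⟪w i, x⟫_ℂ • w i) (ρ x)) {C : Finset ℝ}
    (hC : ∀ x ∈ C, x ∈ Set.Ioo si sf) :
    HasSum (fun i => keldyshForm H O W t (H.evol (-si) (w i)) C)
      (chainTrace H ρ O W t si sf C) := hasSum_keldyshForm hW hsi hsum hw hρ hC

theorem norm_chainTrace_le (hW : ∀ x y, ⟪W x, y⟫_ℂ = ⟪x, W y⟫_ℂ) (hsi : si < t)
    (hsum : si + sf = 2 * t) {ι : Type*} {w : ι → E} (hw : Summable fun i => ‖w i‖ ^ 2)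
    (hρ : ∀ x, HasSum (fun i => ⟪w i, x⟫_ℂ • w i) (ρ x)) {C : Finset ℝ}
    (hC : ∀ x ∈ C, x ∈ Set.Ioo si sf) :
    ‖chainTrace H ρ O W t si sf C‖ ≤ ‖O‖ * (∑' i, ‖w i‖ ^ 2) * max ‖W‖ 1 ^ C.card := by
  have h := hasSum_chainTrace (H := H) (O := O) hW hsi hsum hw hρ hC
  rw [← h.tsum_eq]
  refine (tsum_of_norm_bounded (hw.hasSum.mul_left (‖O‖ * max ‖W‖ 1 ^ C.card)) fun i => ?_).trans_eq
    (by ring)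
  refine (norm_keldyshForm_le _ C).trans_eq ?_
  rw [H.norm_evol]

end Trace

/-! ### The full trace as an integral of system traces and Wick sums -/

section Full

variable {κ E F : Type*} [NormedAddCommGroup E] [InnerProductSpace ℂ E] [CompleteSpace E]
  [NormedAddCommGroup F] [InnerProductSpace ℂ F] [CompleteSpace F]
  {bath : ThermalBath κ F} {Hs : Hamiltonian E} {V : BathCoupling bath} {Ws Os ρs : E →L[ℂ] E}
  {H : Hamiltonian (HilbertTensor E F)} {t si sf : ℝ} {k : κ} {v : E}

theorem tensorOp_symmetric (hWs : IsSelfAdjoint Ws) (x y : HilbertTensor E F) :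
    ⟪tensorOp Ws 1 x, y⟫_ℂ = ⟪x, tensorOp Ws 1 y⟫_ℂ := by
  have hsymm : ∀ x y, ⟪Ws x, y⟫_ℂ = ⟪x, Ws y⟫_ℂ := hWs.isSymmetric
  have h : ContinuousLinearMap.adjoint (tensorOp Ws (1 : F →L[ℂ] F)) = tensorOp Ws 1 := by
    refine hilbertTensor_ext fun x y => ?_
    have h2 : (innerSL ℂ (ContinuousLinearMap.adjoint (tensorOp Ws (1 : F →L[ℂ] F))
        (elemTensor x y))) = innerSL ℂ (tensorOp Ws (1 : F →L[ℂ] F) (elemTensor x y)) := by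
      refine hilbertTensor_ext fun x' y' => ?_
      rw [innerSL_apply_apply, innerSL_apply_apply, ContinuousLinearMap.adjoint_inner_left,
        tensorOp_elemTensor, tensorOp_elemTensor, inner_elemTensor, inner_elemTensor, hsymm]
      rfl
    exact (innerSL_inj (𝕜 := ℂ)).1 h2
  rw [← ContinuousLinearMap.adjoint_inner_right, h]

/-- The bath carries the identity at the tip, so its free evolutions cancel by unitarity and the
inner product factorizes into a system form and a bath overlap. -/
theorem inner_freeEvol_dysonTerm (A : Finset ℝ) {B B' : Finset ℝ}
    (hB : ∀ x ∈ B, x < t) (hB' : ∀ x ∈ B', x < t) :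
    ⟪freeEvol Hs bath.ham t (dysonTerm Hs V Ws k v
        ((A.filter fun x => t ≤ x).image fun x => 2 * t - x) B'),
      tensorOp Os 1 (freeEvol Hs bath.ham t (dysonTerm Hs V Ws k v (A.filter fun x => x < t) B))⟫_ℂ =
    contourPhase t (B ∪ B'.image fun x => 2 * t - x) *
      keldyshForm Hs Os Ws t v (A ∪ (B ∪ B'.image fun x => 2 * t - x)) *
        ⟪V.timeVec k B', V.timeVec k B⟫_ℂ := by
  obtain ⟨h1, h2⟩ := BathCoupling.filter_contour hB hB'
  rw [contourPhase_reflect hB hB', keldyshForm, Finset.filter_union (fun x => x < t) A,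
    Finset.filter_union (fun x => t ≤ x) A, h1,
    Finset.image_union, h2, dysonTerm, dysonTerm, map_smul, map_smul, map_smul,
    freeEvol_elemTensor, freeEvol_elemTensor, tensorOp_elemTensor, inner_smul_left,
    inner_smul_right, inner_elemTensor, one_apply_eq_self, bath.ham.inner_evol, map_pow, map_neg,
    Complex.conj_I, neg_neg]
  ring

/-- The Dyson series of the two branches are integrated independently and each sums to an evolution
under H. -/
theorem keldyshForm_full (hH : IsTotalHamiltonian Hs V Ws H)
    (hWs : IsSelfAdjoint Ws) (hV : V.Wick t) (hsi : 0 ≤ si) (hst : si < t)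
    (hsum : si + sf = 2 * t) (hB : V.BoundedCorr t) {A : Finset ℝ}
    (hA : ∀ x ∈ A, x ∈ Set.Ioo si sf) (htA : t ∉ A) (u : E) :
    Integrable (fun z : Conf × Conf =>
      ⟪freeEvol Hs bath.ham t (dysonTerm Hs V Ws k (Hs.evol (-si) u)
        ((A.filter fun x => t ≤ x).image fun x => 2 * t - x) z.2.times),
      tensorOp Os 1 (freeEvol Hs bath.ham t (dysonTerm Hs V Ws k (Hs.evol (-si) u)
        (A.filter fun x => x < t) z.1.times))⟫_ℂ) ((timeMeasure si t).prod (timeMeasure si t)) ∧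
    ∫ z : Conf × Conf,
      ⟪freeEvol Hs bath.ham t (dysonTerm Hs V Ws k (Hs.evol (-si) u)
        ((A.filter fun x => t ≤ x).image fun x => 2 * t - x) z.2.times),
      tensorOp Os 1 (freeEvol Hs bath.ham t (dysonTerm Hs V Ws k (Hs.evol (-si) u)
        (A.filter fun x => x < t) z.1.times))⟫_ℂ ∂(timeMeasure si t).prod (timeMeasure si t) =
    keldyshForm H (tensorOp Os 1) (tensorOp Ws 1) t
      (H.evol (-si) (elemTensor u (bath.eigenvector k))) A := by
  have ht : 0 < t := hsi.trans_lt hst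
  have hA1 : ∀ x ∈ A.filter fun x => x < t, x ∈ Set.Ioo si t := fun x hx => by
    rw [Finset.mem_filter] at hx
    exact ⟨(hA x hx.1).1, hx.2⟩
  have hA2 : ∀ x ∈ (A.filter fun x => t ≤ x).image fun x => 2 * t - x, x ∈ Set.Ioo si t := by
    intro x hx
    obtain ⟨y, hy, rfl⟩ := Finset.mem_image.1 hx
    rw [Finset.mem_filter] at hy
    have h1 := (hA y hy.1).2
    -- The tip is its own reflection and would not land in the open interval; this is why `t ∉ A` is
    -- required.
    have h2 : t < y := lt_of_le_of_ne hy.2 fun h => htA (h ▸ hy.1)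
    constructor <;> linarith
  have hi : ∀ {A : Finset ℝ}, (∀ x ∈ A, x ∈ Set.Ioo si t) → Integrable (fun c : Conf =>
      dysonTerm Hs V Ws k (Hs.evol (-si) u) A c.times) (timeMeasure si t) := fun hA =>
    integrable_dysonTerm hV ht hsi hB hA
  -- The system vector is rewound to time 0 beforehand, while the eigenvector acquires only a phase.
  -- That phase appears on both branches and drops out of the form.
  have hx : freeEvol Hs bath.ham si (elemTensor (Hs.evol (-si) u) (bath.eigenvector k)) =
      BathCoupling.phase bath k si • elemTensor u (bath.eigenvector k) := by
    rw [freeEvol_elemTensor, Hs.evol_evol_neg, BathCoupling.evol_eigenvector,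
      elemTensor_smul_right]
  have hint : ∀ {A : Finset ℝ}, (∀ x ∈ A, x ∈ Set.Ioo si t) →
      freeEvol Hs bath.ham t (∫ c : Conf, dysonTerm Hs V Ws k (Hs.evol (-si) u) A c.times
        ∂timeMeasure si t) = BathCoupling.phase bath k si • H.evol t
          (timeProd (heisenberg H.evol (tensorOp Ws 1)) A
            (H.evol (-si) (elemTensor u (bath.eigenvector k)))) := fun hA => by
    rw [integral_dysonTerm hH hWs hV ht hsi hst.le hB hA, hx, map_smul, map_smul, map_smul]
  have h1 := (freeEvol Hs bath.ham t).integrable_comp (hi hA2)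
  have h2 := ((tensorOp Os 1).comp (freeEvol Hs bath.ham t)).integrable_comp (hi hA1)
  obtain ⟨h3, h4⟩ := integral_prod_inner h2 h1
  refine ⟨h3, h4.trans ?_⟩
  rw [ContinuousLinearMap.integral_comp_comm _ (hi hA2),
    ContinuousLinearMap.integral_comp_comm _ (hi hA1), ContinuousLinearMap.comp_apply, hint hA2,
    hint hA1, map_smul, inner_smul_left, inner_smul_right, ← mul_assoc, Complex.conj_mul',
    BathCoupling.norm_phase, keldyshForm]
  simp

/-- The contribution of an energy eigenvector to the bound for the Dyson series of the trace. -/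
def eigenBound (V : BathCoupling bath) (M : ℝ) (k : κ) (z : Conf × Conf) : ℝ :=
  bath.prob k * ((M ^ z.1.times.card * ‖V.timeVec k z.1.times‖) *
    (M ^ z.2.times.card * ‖V.timeVec k z.2.times‖))

theorem eigenBound_nonneg {M : ℝ} (hM : 0 ≤ M) (k : κ) (z : Conf × Conf) :
    0 ≤ eigenBound V M k z := by
  have := bath.prob_pos k
  unfold eigenBound
  positivity

/-- For a single level the bound with 1/p_k gives integrability. For finite sums of levels
Cauchy–Schwarz gives a pointwise majorant independent of the levels, so the partial sums of the
integrals stay bounded. -/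
theorem summable_integral_eigenBound (hV : V.Wick t) (hsi : 0 ≤ si) (hst : si < t)
    (hB : V.BoundedCorr t) {M : ℝ} (hM : 0 ≤ M) :
    (∀ k, Integrable (eigenBound V M k) ((timeMeasure si t).prod (timeMeasure si t))) ∧
    Summable fun k => ∫ z, eigenBound V M k z ∂(timeMeasure si t).prod (timeMeasure si t) := by
  have ht : 0 < t := hsi.trans_lt hst
  obtain ⟨K, hK⟩ := hB
  have hK0 : 0 ≤ K := (norm_nonneg _).trans (hK 0 0 le_rfl le_rfl (by linarith))
  have hsub : ∀ {c : Conf}, (∀ x ∈ c.times, x ∈ Set.Ioo si t) → ∀ x ∈ c.times, x ∈ Set.Ioo 0 t :=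
    fun h x hx => ⟨hsi.trans_lt (h x hx).1, (h x hx).2⟩
  have h1 : ∀ k, Integrable (fun c : Conf => M ^ c.times.card * ‖V.timeVec k c.times‖)
      (timeMeasure si t) := by
    intro k
    have hm : TimeMeasurable si t fun B : Finset ℝ => M ^ B.card * ‖V.timeVec k B‖ :=
      (timeMeasurable_card fun n => M ^ n).map₂ (V.timeMeasurable_timeVec k si t)
        (op := fun (c : ℝ) (z : F) => c * ‖z‖) (by fun_prop)
    refine integrable_of_growth hm.aestronglyMeasurable (C := Real.sqrt (bath.prob k)⁻¹) hM
      (y := 2 * K) (by positivity) fun c hc => ?_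
    rw [norm_mul, norm_norm, norm_pow, Real.norm_of_nonneg hM, growth]
    have h2 := hV.norm_timeVec_le ht hK0 hK (hsub hc) k
    rw [div_eq_mul_inv, Real.sqrt_mul (by positivity)] at h2
    refine (mul_le_mul_of_nonneg_left h2 (by positivity)).trans_eq ?_
    ring
  have h2 : ∀ k, Integrable (eigenBound V M k) ((timeMeasure si t).prod (timeMeasure si t)) :=
    fun k => ((h1 k).mul_prod (h1 k)).const_mul _
  have hg : Integrable (fun c : Conf => growth M (2 * K) c.times.card) (timeMeasure si t) := by
    refine integrable_of_growth (timeMeasurable_card _).aestronglyMeasurable (C := 1) hM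
      (y := 2 * K) (by positivity) fun c _ => ?_
    rw [one_mul, Real.norm_of_nonneg (growth_nonneg hM _ _)]
  refine ⟨h2, summable_of_sum_le (c := ∫ z : Conf × Conf,
    growth M (2 * K) z.1.times.card * growth M (2 * K) z.2.times.card
      ∂(timeMeasure si t).prod (timeMeasure si t))
    (fun k => integral_nonneg fun z => eigenBound_nonneg hM k z) fun S => ?_⟩
  rw [← integral_finsetSum _ fun k _ => h2 k]
  refine integral_mono_ae (integrable_finsetSum _ fun k _ => h2 k) (hg.mul_prod hg) ?_
  have hae := ae_timeMeasure_mem si t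
  filter_upwards [Measure.quasiMeasurePreserving_fst.ae hae,
    Measure.quasiMeasurePreserving_snd.ae hae] with z hz1 hz2
  obtain ⟨h3, h4⟩ := hV.sum_norm_mul_le ht hK0 hK (hsub hz2) (hsub hz1)
  have h5 : ∀ k, eigenBound V M k z = (M ^ z.1.times.card * M ^ z.2.times.card) *
      (bath.prob k * (‖V.timeVec k z.1.times‖ * ‖V.timeVec k z.2.times‖)) := fun k => by
    rw [eigenBound]
    ring
  simp only [h5, ← Finset.mul_sum]
  have h6 := (h3.sum_le_tsum S fun k _ => mul_nonneg (bath.prob_pos k).le (by positivity)).trans h4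
  refine (mul_le_mul_of_nonneg_left h6 (by positivity)).trans_eq ?_
  simp only [growth]
  ring

/-- The integrand of the Dyson series of the full trace. -/
def traceIntegrand (V : BathCoupling bath) (Hs : Hamiltonian E) (ρs Os Ws : E →L[ℂ] E)
    (t si sf : ℝ) (A C : Finset ℝ) : ℂ :=
  contourPhase t C * chainTrace Hs ρs Os Ws t si sf (A ∪ C) * pairSum (V.corr t) C

/-- After factorization the sum over `ι` is the system trace and the sum over the levels is a Wick
sum, so the double series is their product. -/
theorem hasSum_traceIntegrand (hWs : IsSelfAdjoint Ws) (hV : V.Wick t) (hsi : 0 ≤ si)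
    (hst : si < t) (hsum : si + sf = 2 * t) {ι : Type*} {w : ι → E}
    (hw : Summable fun i => ‖w i‖ ^ 2)
    (hρ : ∀ x, HasSum (fun i => ⟪w i, x⟫_ℂ • w i) (ρs x)) {A : Finset ℝ}
    (hA : ∀ x ∈ A, x ∈ Set.Ioo si sf) {B B' : Finset ℝ} (hB : ∀ x ∈ B, x ∈ Set.Ioo si t)
    (hB' : ∀ x ∈ B', x ∈ Set.Ioo si t) :
    HasSum (fun z : ι × κ => (bath.prob z.2 : ℂ) *
      ⟪freeEvol Hs bath.ham t (dysonTerm Hs V Ws z.2 (Hs.evol (-si) (w z.1))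
        ((A.filter fun x => t ≤ x).image fun x => 2 * t - x) B'),
      tensorOp Os 1 (freeEvol Hs bath.ham t (dysonTerm Hs V Ws z.2 (Hs.evol (-si) (w z.1))
        (A.filter fun x => x < t) B))⟫_ℂ)
      (traceIntegrand V Hs ρs Os Ws t si sf A (B ∪ B'.image fun x => 2 * t - x)) := by
  have hC : ∀ x ∈ A ∪ (B ∪ B'.image fun x => 2 * t - x), x ∈ Set.Ioo si sf := by
    intro x hx
    rcases Finset.mem_union.1 hx with hx | hx
    · exact hA x hx
    rcases Finset.mem_union.1 hx with hx | hx
    · exact ⟨(hB x hx).1, by linarith [(hB x hx).2]⟩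
    · obtain ⟨y, hy, rfl⟩ := Finset.mem_image.1 hx
      have := hB' y hy
      constructor <;> linarith [this.1, this.2]
  have h2 := hV.hasSum_inner (hsi.trans_lt hst) (B := B) (B' := B')
    (fun x hx => ⟨hsi.trans_lt (hB x hx).1, (hB x hx).2⟩)
    (fun x hx => ⟨hsi.trans_lt (hB' x hx).1, (hB' x hx).2⟩)
  have h4 := hasSum_mul_of_hasSum (hasSum_chainTrace (H := Hs) (O := Os) hWs.isSymmetric hst hsum hw hρ hC) h2
    (contourPhase t (B ∪ B'.image fun x => 2 * t - x))
  refine h4.congr_fun fun z => ?_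
  rw [inner_freeEvol_dysonTerm A (fun x hx => (hB x hx).2) fun x hx => (hB' x hx).2]
  ring

theorem timeMeasurable_traceIntegrand (hV : V.Wick t) (ht : 0 < t) (hsi : 0 ≤ si)
    (hsf : sf ≤ 2 * t) {ι : Type*} [Countable ι] {w : ι → E} (hw : Summable fun i => ‖w i‖ ^ 2)
    (hρ : ∀ x, HasSum (fun i => ⟪w i, x⟫_ℂ • w i) (ρs x)) {A : Finset ℝ}
    (hA : ∀ x ∈ A, x ∈ Set.Ioo si sf) :
    TimeMeasurable si sf (traceIntegrand V Hs ρs Os Ws t si sf A) :=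
  ((timeMeasurable_contourPhase t si sf).map₂ ((timeMeasurable_trace hw hρ Os Ws t si sf).union_const
    hA) continuous_mul).map₂ ((hV.timeMeasurable_pairSum_corr ht).mono hsi hsf) continuous_mul

theorem integrable_traceIntegrand (hWs : IsSelfAdjoint Ws) (hV : V.Wick t) (hsi : 0 ≤ si)
    (hst : si < t) (hsum : si + sf = 2 * t) (hB : V.BoundedCorr t) {ι : Type*} [Countable ι]
    {w : ι → E} (hw : Summable fun i => ‖w i‖ ^ 2)
    (hρ : ∀ x, HasSum (fun i => ⟪w i, x⟫_ℂ • w i) (ρs x)) {A : Finset ℝ}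
    (hA : ∀ x ∈ A, x ∈ Set.Ioo si sf) :
    Integrable (fun c : Conf => traceIntegrand V Hs ρs Os Ws t si sf A c.times)
      (timeMeasure si sf) := by
  obtain ⟨K, hK⟩ := hB
  have hK0 : 0 ≤ K := (norm_nonneg _).trans (hK 0 0 le_rfl le_rfl (by linarith))
  refine integrable_of_growth (timeMeasurable_traceIntegrand hV (hsi.trans_lt hst) hsi
    (by linarith) hw hρ hA).aestronglyMeasurable (x := max ‖Ws‖ 1) (y := 2 * K)
    (C := ‖Os‖ * (∑' i, ‖w i‖ ^ 2) * max ‖Ws‖ 1 ^ A.card) (le_max_of_le_right zero_le_one)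
    (by positivity) fun c hc => ?_
  have hM : 1 ≤ max ‖Ws‖ 1 := le_max_right _ _
  have hS : 0 ≤ ∑' i, ‖w i‖ ^ 2 := tsum_nonneg fun _ => by positivity
  have h1 := norm_chainTrace_le (H := Hs) (O := Os) (C := A ∪ c.times) hWs.isSymmetric hst hsum hw
    hρ fun x hx => (Finset.mem_union.1 hx).elim (hA x) (hc x)
  have h2 : ‖pairSum (V.corr t) c.times‖ ≤ growth 1 (2 * K) c.times.card :=
    norm_pairSum_le_growth hK0 fun x hx y hy hxy => hK x y (hsi.trans (hc x hx).1.le) hxy.le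
      ((hc y hy).2.le.trans (by linarith))
  rw [traceIntegrand, norm_mul, norm_mul, norm_contourPhase, one_mul]
  refine (mul_le_mul h1 h2 (norm_nonneg _) (by positivity)).trans ?_
  rw [growth, growth, one_pow, one_mul, ← mul_assoc]
  refine mul_le_mul_of_nonneg_right ?_ (Real.sqrt_nonneg _)
  rw [mul_assoc _ (_ ^ _) (_ ^ _), ← pow_add]
  exact mul_le_mul_of_nonneg_left (pow_le_pow_right₀ hM (Finset.card_union_le _ _)) (by positivity)

/-- The integral is folded at the tip and the integrand expanded over initial vectors and levels.
After exchanging series and integral, each term is an inner product of two Dyson series, evaluated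
by `keldyshForm_full`. -/
theorem fullTrace_eq_integral (hH : IsTotalHamiltonian Hs V Ws H)
    (hWs : IsSelfAdjoint Ws) (hV : V.Wick t) (hsi : 0 ≤ si) (hst : si < t)
    (hsum : si + sf = 2 * t) (hB : V.BoundedCorr t) {ι : Type*} [Countable ι] {w : ι → E}
    (hw : Summable fun i => ‖w i‖ ^ 2)
    (hρ : ∀ x, HasSum (fun i => ⟪w i, x⟫_ℂ • w i) (ρs x)) {A : Finset ℝ}
    (hA : ∀ x ∈ A, x ∈ Set.Ioo si sf) (htA : t ∉ A) :
    HasSum (fun z : ι × κ => (bath.prob z.2 : ℂ) *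
      keldyshForm H (tensorOp Os 1) (tensorOp Ws 1) t
        (H.evol (-si) (elemTensor (w z.1) (bath.eigenvector z.2))) A)
      (∫ c : Conf, traceIntegrand V Hs ρs Os Ws t si sf A c.times ∂timeMeasure si sf) := by
  have := bath.countable
  have hM : 0 ≤ max ‖Ws‖ 1 := le_max_of_le_right zero_le_one
  rw [integral_split_reflect (timeMeasurable_traceIntegrand hV (hsi.trans_lt hst) hsi
    (by linarith) hw hρ hA) (integrable_traceIntegrand hWs hV hsi hst hsum hB hw hρ hA) hsum
    (by linarith)]
  let T : ι × κ → Conf × Conf → ℂ := fun j z => (bath.prob j.2 : ℂ) *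
      ⟪freeEvol Hs bath.ham t (dysonTerm Hs V Ws j.2 (Hs.evol (-si) (w j.1))
        ((A.filter fun x => t ≤ x).image fun x => 2 * t - x) z.2.times),
      tensorOp Os 1 (freeEvol Hs bath.ham t (dysonTerm Hs V Ws j.2 (Hs.evol (-si) (w j.1))
        (A.filter fun x => x < t) z.1.times))⟫_ℂ
  have hkF := fun j : ι × κ => keldyshForm_full (k := j.2) (Os := Os) hH hWs hV hsi hst hsum hB hA
    htA (w j.1)
  have hT : ∀ j, Integrable (T j) ((timeMeasure si t).prod (timeMeasure si t)) := fun j =>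
    (hkF j).1.const_mul _
  obtain ⟨hb1, hb2⟩ := summable_integral_eigenBound hV hsi hst hB hM
  have hae := ae_timeMeasure_mem si t
  have hae2 : ∀ᵐ z ∂(timeMeasure si t).prod (timeMeasure si t),
      (∀ x ∈ z.1.times, x ∈ Set.Ioo si t) ∧ ∀ x ∈ z.2.times, x ∈ Set.Ioo si t := by
    filter_upwards [Measure.quasiMeasurePreserving_fst.ae hae,
      Measure.quasiMeasurePreserving_snd.ae hae] with z hz1 hz2
    exact ⟨hz1, hz2⟩
  -- The majorant separates into a factor in the system vector and one in the level, so summability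
  -- over pairs follows from two separate sums.
  have hTb : ∀ j, ∫ z, ‖T j z‖ ∂(timeMeasure si t).prod (timeMeasure si t) ≤
      (‖Os‖ * max ‖Ws‖ 1 ^ A.card * ‖w j.1‖ ^ 2) *
        ∫ z, eigenBound V (max ‖Ws‖ 1) j.2 z ∂(timeMeasure si t).prod (timeMeasure si t) := by
    intro j
    rw [← integral_const_mul]
    refine integral_mono_ae (hT j).norm ((hb1 j.2).const_mul _) ?_
    filter_upwards [hae2] with z hz
    simp only [T]
    rw [inner_freeEvol_dysonTerm A (fun x hx => (hz.1 x hx).2) fun x hx => (hz.2 x hx).2,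
      norm_mul, norm_mul, norm_mul, norm_contourPhase, one_mul, Complex.norm_real,
      Real.norm_of_nonneg (bath.prob_pos _).le]
    have h1 := norm_keldyshForm_le (H := Hs) (O := Os) (W := Ws) (t := t) (Hs.evol (-si) (w j.1))
      (A ∪ (z.1.times ∪ z.2.times.image fun x => 2 * t - x))
    rw [Hs.norm_evol] at h1
    have h2 : (A ∪ (z.1.times ∪ z.2.times.image fun x => 2 * t - x)).card ≤
        A.card + z.1.times.card + z.2.times.card := by
      have e1 := Finset.card_union_le A (z.1.times ∪ z.2.times.image fun x => 2 * t - x)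
      have e2 := Finset.card_union_le z.1.times (z.2.times.image fun x => 2 * t - x)
      have e3 := Finset.card_image_le (s := z.2.times) (f := fun x => 2 * t - x)
      omega
    have h3 := pow_le_pow_right₀ (le_max_right ‖Ws‖ 1) h2
    have h4 : ‖keldyshForm Hs Os Ws t (Hs.evol (-si) (w j.1))
        (A ∪ (z.1.times ∪ z.2.times.image fun x => 2 * t - x))‖ ≤
        ‖Os‖ * max ‖Ws‖ 1 ^ (A.card + z.1.times.card + z.2.times.card) * ‖w j.1‖ ^ 2 :=
      h1.trans (by gcongr)
    have h5 := norm_inner_le_norm (𝕜 := ℂ) (V.timeVec j.2 z.2.times) (V.timeVec j.2 z.1.times)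
    refine (mul_le_mul_of_nonneg_left (mul_le_mul h4 h5 (norm_nonneg _) (by positivity))
      (bath.prob_pos j.2).le).trans_eq ?_
    rw [eigenBound, pow_add, pow_add]
    ring
  have hTs : Summable fun j => ∫ z, ‖T j z‖ ∂(timeMeasure si t).prod (timeMeasure si t) := by
    refine Summable.of_nonneg_of_le (fun j => integral_nonneg fun z => norm_nonneg _) hTb ?_
    exact (hw.mul_left (‖Os‖ * max ‖Ws‖ 1 ^ A.card)).mul_of_nonneg hb2 (fun i => by positivity)
      fun k => integral_nonneg fun z => eigenBound_nonneg hM k z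
  have h := hasSum_integral_of_summable_integral_norm hT hTs
  have h6 : ∫ z, ∑' j, T j z ∂(timeMeasure si t).prod (timeMeasure si t) =
      ∫ z : Conf × Conf, traceIntegrand V Hs ρs Os Ws t si sf A
        (z.1.times ∪ z.2.times.image fun x => 2 * t - x)
        ∂(timeMeasure si t).prod (timeMeasure si t) := by
    refine integral_congr_ae ?_
    filter_upwards [hae2] with z hz
    exact (hasSum_traceIntegrand hWs hV hsi hst hsum hw hρ hA hz.1 hz.2).tsum_eq
  rw [h6] at h
  refine h.congr_fun fun j => ?_
  simp only [T]
  rw [integral_const_mul, (hkF j).2]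

/-- This is the series of `fullTrace_eq_integral`; uniqueness of sums then identifies the integral
with the full trace. -/
theorem hasSum_fullTrace (hWs : IsSelfAdjoint Ws) (hst : si < t) (hsum : si + sf = 2 * t)
    {ι : Type*} {w : ι → E} (hw : Summable fun i => ‖w i‖ ^ 2)
    (hρ : ∀ x, HasSum (fun i => ⟪w i, x⟫_ℂ • w i) (ρs x)) {A : Finset ℝ}
    (hA : ∀ x ∈ A, x ∈ Set.Ioo si sf) :
    HasSum (fun z : ι × κ => (bath.prob z.2 : ℂ) *
      keldyshForm H (tensorOp Os 1) (tensorOp Ws 1) t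
        (H.evol (-si) (elemTensor (w z.1) (bath.eigenvector z.2))) A)
      (chainTrace H (tensorOp ρs bath.state) (tensorOp Os 1) (tensorOp Ws 1) t si sf A) := by
  have hs : (⇑(A.orderEmbOfFin rfl) : Fin A.card → ℝ) ∈ timeSimplex A.card si sf :=
    ⟨(A.orderEmbOfFin rfl).strictMono, fun i => hA _ (Finset.orderEmbOfFin_mem A rfl i)⟩
  have himg : Finset.univ.image (A.orderEmbOfFin rfl) = A := times_confOf A
  refine (hasSum_hilbertTrace_tensor bath hw hρ _).congr_fun fun z => ?_
  rw [inner_orderedChain (tensorOp_symmetric hWs) hst hsum hs, himg]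

end Full

end

noncomputable section

open MeasureTheory Filter

/-! ### Resummation -/

theorem notMem_timeSimplex {si sf : ℝ} (h : sf ≤ si) {m : ℕ} (hm : 0 < m) (s : Fin m → ℝ) :
    s ∉ timeSimplex m si sf := fun hs =>
  ((hs.2 ⟨0, hm⟩).1.trans (hs.2 ⟨0, hm⟩).2).not_ge h

theorem contourPhase_image {t : ℝ} {m : ℕ} {s : Fin m → ℝ} (hs : StrictMono s) :
    contourPhase t (Finset.univ.image s) = Complex.I ^ m * contourSign t s := by
  rw [contourPhase, contourSign, Finset.filter_image,
    Finset.card_image_of_injective _ hs.injective, Finset.card_image_of_injective _ hs.injective,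
    Finset.card_univ, Fintype.card_fin]

/-- Series of integrals over simplices, of a function that vanishes unless the number of times
has the form `e n`. -/
theorem hasSum_simplices {si sf : ℝ} {f : Finset ℝ → ℂ} {F : (m : ℕ) → (Fin m → ℝ) → ℂ}
    (h : Integrable (fun c : Conf => f c.times) (timeMeasure si sf)) {e : ℕ → ℕ}
    (he : Function.Injective e) (hF : ∀ n, ∀ s ∈ timeSimplex (e n) si sf,
      f (Finset.univ.image s) = Complex.I ^ e n * F (e n) s)
    (h0 : ∀ m, m ∉ Set.range e → ∀ s ∈ timeSimplex m si sf, f (Finset.univ.image s) = 0) :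
    (∀ n, IntegrableOn (F (e n)) (timeSimplex (e n) si sf)) ∧
    (Summable fun n => ∫ s in timeSimplex (e n) si sf, ‖F (e n) s‖) ∧
    HasSum (fun n => Complex.I ^ e n * ∫ s in timeSimplex (e n) si sf, F (e n) s)
      (∫ c : Conf, f c.times ∂timeMeasure si sf) := by
  have hmeas := fun m => measurableSet_timeSimplex m si sf
  obtain ⟨h1, h2⟩ := hasSum_integral_timeSimplex h
  obtain ⟨-, h3⟩ := hasSum_integral_timeSimplex (f := fun A => ‖f A‖) h.norm
  refine ⟨fun n => ?_, ?_, ?_⟩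
  · refine IntegrableOn.congr_fun ((h1 (e n)).const_mul (Complex.I ^ e n)⁻¹) (fun s hs => ?_)
      (hmeas _)
    rw [hF n s hs, inv_mul_cancel_left₀ (pow_ne_zero _ Complex.I_ne_zero)]
  · refine (h3.summable.comp_injective he).congr fun n => ?_
    refine setIntegral_congr_fun (hmeas _) fun s hs => ?_
    simp [hF n s hs]
  · have h4 := (he.hasSum_iff fun m hm =>
      setIntegral_eq_zero_of_forall_eq_zero (h0 m hm)).2 h2
    refine h4.congr_fun fun n => ?_
    rw [← integral_const_mul]
    exact setIntegral_congr_fun (hmeas _) fun s hs => (hF n s hs).symm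

section Resummation

variable {κ E F : Type*} [NormedAddCommGroup E] [InnerProductSpace ℂ E] [CompleteSpace E]
  [NormedAddCommGroup F] [InnerProductSpace ℂ F] [CompleteSpace F]
  {bath : ThermalBath κ F} {Hs : Hamiltonian E} {V V' : BathCoupling bath} {Ws Os ρs : E →L[ℂ] E}
  {H : Hamiltonian (HilbertTensor E F)} {t si sf : ℝ}

/-- The difference of the correlation functions of two couplings. -/
def corrDiff (V V' : BathCoupling bath) (t τ₁ τ₂ : ℝ) : ℂ := V'.corr t τ₁ τ₂ - V.corr t τ₁ τ₂

/-- The sum over nonempty pairings with the difference of the correlation functions. -/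
def diffFactor (V V' : BathCoupling bath) (t : ℝ) (A : Finset ℝ) : ℂ :=
  if A.Nonempty then contourPhase t A * pairSum (corrDiff V V' t) A else 0

theorem timeMeasurable_diffFactor (hV : V.Wick t) (hV' : V'.Wick t) (ht : 0 < t) (hsi : 0 ≤ si)
    (hsf : sf ≤ 2 * t) : TimeMeasurable si sf (diffFactor V V' t) := by
  obtain ⟨g, hg, hgV⟩ := hV.exists_measurable_corr ht
  obtain ⟨g', hg', hgV'⟩ := hV'.exists_measurable_corr ht
  refine ((timeMeasurable_contourPhase t si sf).map₂ (timeMeasurable_pairSum (hg'.sub hg)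
    fun x y hx hxy hy => ?_) continuous_mul).ite fun n => ?_
  · rw [corrDiff, hgV x y (hsi.trans_lt hx) hxy (hy.trans_le hsf),
      hgV' x y (hsi.trans_lt hx) hxy (hy.trans_le hsf)]
    rfl
  · simp only [Finset.image_nonempty]
    exact MeasurableSet.const _

theorem norm_diffFactor_le {K : ℝ} (hK : 0 ≤ K) {A : Finset ℝ}
    (hA : ∀ x ∈ A, ∀ y ∈ A, x < y → ‖corrDiff V V' t x y‖ ≤ K) :
    ‖diffFactor V V' t A‖ ≤ growth 1 (2 * K) A.card := by
  rw [diffFactor]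
  split_ifs
  · rw [norm_mul, norm_contourPhase, one_mul]
    exact norm_pairSum_le_growth hK hA
  · rw [norm_zero]
    exact growth_nonneg zero_le_one _ _

/-- Wick sums grow at most like √(n!) separately in the two sets, with constants K' + K for ΔB and K
for B, and the trace grows only geometrically in the number of times. This justifies Fubini in the
resummation. -/
theorem integrable_resummation (hWs : IsSelfAdjoint Ws) (hV : V.Wick t) (hV' : V'.Wick t)
    (hsi : 0 ≤ si) (hst : si < t) (hsum : si + sf = 2 * t) (hB : V.BoundedCorr t)
    (hB' : V'.BoundedCorr t) {ι : Type*} [Countable ι] {w : ι → E}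
    (hw : Summable fun i => ‖w i‖ ^ 2)
    (hρ : ∀ x, HasSum (fun i => ⟪w i, x⟫_ℂ • w i) (ρs x)) :
    Integrable (fun z : Conf × Conf => diffFactor V V' t z.1.times *
      traceIntegrand V Hs ρs Os Ws t si sf z.1.times z.2.times)
      ((timeMeasure si sf).prod (timeMeasure si sf)) := by
  have ht : 0 < t := hsi.trans_lt hst
  obtain ⟨K, hK⟩ := hB
  obtain ⟨K', hK'⟩ := hB'
  have hK0 : 0 ≤ K := (norm_nonneg _).trans (hK 0 0 le_rfl le_rfl (by linarith))
  have hK0' : 0 ≤ K' := (norm_nonneg _).trans (hK' 0 0 le_rfl le_rfl (by linarith))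
  set M := max ‖Ws‖ 1 with hMdef
  have hM : 0 ≤ M := le_max_of_le_right zero_le_one
  set S := ∑' i, ‖w i‖ ^ 2 with hSdef
  have hS : 0 ≤ S := tsum_nonneg fun _ => by positivity
  have hg : ∀ y : ℝ, 0 ≤ y → Integrable (fun c : Conf => growth M y c.times.card)
      (timeMeasure si sf) := fun y hy =>
    integrable_of_growth (timeMeasurable_card _).aestronglyMeasurable (C := 1) hM
      (y := y) hy fun c _ => by rw [one_mul, Real.norm_of_nonneg (growth_nonneg hM _ _)]
  have hbound := ((hg (2 * (K' + K)) (by positivity)).mul_prod (hg (2 * K) (by positivity))).const_mul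
    (‖Os‖ * S)
  refine hbound.mono' ?_ ?_
  · have m1 := (timeMeasurable_diffFactor hV hV' ht hsi (by linarith : sf ≤ 2 * t)).aestronglyMeasurable
    have m2 := (timeMeasurable_contourPhase t si sf).aestronglyMeasurable
    have m3 : TimeMeasurable si sf (chainTrace Hs ρs Os Ws t si sf) :=
      timeMeasurable_trace hw hρ Os Ws t si sf
    have m4 := ((hV.timeMeasurable_pairSum_corr ht).mono hsi
      (by linarith : sf ≤ 2 * t)).aestronglyMeasurable
    exact m1.comp_fst.mul ((m2.comp_snd.mul m3.union).mul m4.comp_snd)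
  · have hae := ae_timeMeasure_mem si sf
    filter_upwards [Measure.quasiMeasurePreserving_fst.ae hae,
      Measure.quasiMeasurePreserving_snd.ae hae] with z hz1 hz2
    have hrange : ∀ {c : Conf}, (∀ x ∈ c.times, x ∈ Set.Ioo si sf) → ∀ x ∈ c.times,
        0 ≤ x ∧ x ≤ 2 * t := fun h x hx =>
      ⟨hsi.trans (h x hx).1.le, (h x hx).2.le.trans (by linarith)⟩
    have b1 : ‖diffFactor V V' t z.1.times‖ ≤ growth 1 (2 * (K' + K)) z.1.times.card :=
      norm_diffFactor_le (by positivity) fun x hx y hy hxy => (norm_sub_le _ _).trans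
        (add_le_add (hK' x y (hrange hz1 x hx).1 hxy.le (hrange hz1 y hy).2)
          (hK x y (hrange hz1 x hx).1 hxy.le (hrange hz1 y hy).2))
    have b2 : ‖pairSum (V.corr t) z.2.times‖ ≤ growth 1 (2 * K) z.2.times.card :=
      norm_pairSum_le_growth hK0 fun x hx y hy hxy =>
        hK x y (hrange hz2 x hx).1 hxy.le (hrange hz2 y hy).2
    have b3 : ‖chainTrace Hs ρs Os Ws t si sf (z.1.times ∪ z.2.times)‖ ≤
        ‖Os‖ * S * (M ^ z.1.times.card * M ^ z.2.times.card) := by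
      refine (norm_chainTrace_le hWs.isSymmetric hst hsum hw hρ fun x hx =>
        (Finset.mem_union.1 hx).elim (hz1 x) (hz2 x)).trans ?_
      rw [← pow_add]
      exact mul_le_mul_of_nonneg_left (pow_le_pow_right₀ (le_max_right _ _)
        (Finset.card_union_le _ _)) (by positivity)
    rw [traceIntegrand, norm_mul, norm_mul, norm_mul, norm_contourPhase, one_mul]
    refine (mul_le_mul b1 (mul_le_mul b3 b2 (norm_nonneg _) (by positivity)) (by positivity)
      (growth_nonneg zero_le_one _ _)).trans_eq ?_
    simp only [growth]
    ring

/-- The expansion of B̃ = ΔB + B over subsets; subtracting the pairing sum of B removes exactly the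
subset ∅, where `diffFactor` vanishes. -/
theorem sum_powerset_diffFactor (C : Finset ℝ) :
    ∑ A ∈ C.powerset, diffFactor V V' t A * traceIntegrand V Hs ρs Os Ws t si sf A (C \ A) =
      contourPhase t C * chainTrace Hs ρs Os Ws t si sf C *
        (pairSum (V'.corr t) C - pairSum (V.corr t) C) := by
  have h1 : pairSum (V'.corr t) C =
      ∑ A ∈ C.powerset, pairSum (corrDiff V V' t) A * pairSum (V.corr t) (C \ A) := by
    rw [← pairSum_add]
    congr 1
    ext x y
    simp [corrDiff]
  have h2 : pairSum (V.corr t) C = ∑ A ∈ C.powerset,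
      if A = ∅ then pairSum (V.corr t) C else 0 := by
    rw [Finset.sum_ite_eq' C.powerset ∅, if_pos (Finset.empty_mem_powerset C)]
  rw [h1]
  nth_rewrite 1 [h2]
  rw [← Finset.sum_sub_distrib, Finset.mul_sum]
  refine Finset.sum_congr rfl fun A hA => ?_
  have hAC := Finset.mem_powerset.1 hA
  have hph := contourPhase_union t (Finset.disjoint_sdiff (s := A) (t := C))
  rw [Finset.union_sdiff_of_subset hAC] at hph
  rcases A.eq_empty_or_nonempty with rfl | hne
  · simp [diffFactor, pairSum_empty]
  · rw [diffFactor, if_pos hne, if_neg hne.ne_empty, traceIntegrand,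
      Finset.union_sdiff_of_subset hAC, hph, sub_zero]
    ring

/-- One double integral is evaluated in two ways: grouped by the union of the two sets it is the
system side, and integrated first over the second set it is the full side. -/
theorem resummation (hH : IsTotalHamiltonian Hs V Ws H) (hWs : IsSelfAdjoint Ws) (hV : V.Wick t)
    (hV' : V'.Wick t) (hsi : 0 ≤ si) (hst : si < t) (hsum : si + sf = 2 * t)
    (hB : V.BoundedCorr t) (hB' : V'.BoundedCorr t) {ι : Type*} [Countable ι] {w : ι → E}
    (hw : Summable fun i => ‖w i‖ ^ 2)
    (hρ : ∀ x, HasSum (fun i => ⟪w i, x⟫_ℂ • w i) (ρs x)) :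
    Integrable (fun c : Conf => contourPhase t c.times * chainTrace Hs ρs Os Ws t si sf c.times *
      (pairSum (V'.corr t) c.times - pairSum (V.corr t) c.times)) (timeMeasure si sf) ∧
    Integrable (fun c : Conf => diffFactor V V' t c.times * chainTrace H
      (tensorOp ρs bath.state) (tensorOp Os 1) (tensorOp Ws 1) t si sf c.times)
      (timeMeasure si sf) ∧
    ∫ c : Conf, contourPhase t c.times * chainTrace Hs ρs Os Ws t si sf c.times *
      (pairSum (V'.corr t) c.times - pairSum (V.corr t) c.times) ∂timeMeasure si sf =
    ∫ c : Conf, diffFactor V V' t c.times * chainTrace H (tensorOp ρs bath.state) (tensorOp Os 1)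
      (tensorOp Ws 1) t si sf c.times ∂timeMeasure si sf := by
  have hΦ := integrable_resummation (Hs := Hs) (Os := Os) hWs hV hV' hsi hst hsum hB hB' hw hρ
  have hinner : ∀ᵐ c ∂timeMeasure si sf, (∫ c' : Conf, diffFactor V V' t c.times *
      traceIntegrand V Hs ρs Os Ws t si sf c.times c'.times ∂timeMeasure si sf) =
      diffFactor V V' t c.times * chainTrace H (tensorOp ρs bath.state) (tensorOp Os 1)
        (tensorOp Ws 1) t si sf c.times := by
    filter_upwards [ae_timeMeasure_mem si sf, ae_timeMeasure_notMem si sf t] with c h1 h2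
    rw [integral_const_mul, (fullTrace_eq_integral hH hWs hV hsi hst hsum hB hw hρ h1 h2).unique
      (hasSum_fullTrace hWs hst hsum hw hρ h1)]
  refine ⟨?_, hΦ.integral_prod_left.congr hinner, ?_⟩
  · refine (integrable_confSplit hΦ).congr ?_
    filter_upwards [ae_timeMeasure_injective si sf] with c hc
    simp only [times_confSplit]
    rw [sum_finset_image hc fun A A' => diffFactor V V' t A *
      traceIntegrand V Hs ρs Os Ws t si sf A A']
    exact sum_powerset_diffFactor c.times
  · rw [← integral_congr_ae hinner, ← integral_prod _ hΦ]
    refine Eq.trans ?_ (integral_prod_times (Φ := fun A C => diffFactor V V' t A *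
      traceIntegrand V Hs ρs Os Ws t si sf A C) hΦ).symm
    congr 1
    ext c
    exact (sum_powerset_diffFactor c.times).symm

theorem systemIntegrand_eq {m : ℕ} {s : Fin m → ℝ} (hs : StrictMono s) :
    contourPhase t (Finset.univ.image s) * chainTrace Hs ρs Os Ws t si sf (Finset.univ.image s) *
      (pairSum (V'.corr t) (Finset.univ.image s) - pairSum (V.corr t) (Finset.univ.image s)) =
    Complex.I ^ m * systemIntegrand Hs Ws Os ρs (V.corr t) (V'.corr t) t si sf m s := by
  rw [chainTrace, onFinset_image _ hs, contourPhase_image hs, ← sum_orderedPairings hs,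
    ← sum_orderedPairings hs, ← Finset.sum_sub_distrib, systemIntegrand, systemChain]
  ring

/-- The number of times is a successor because `diffFactor` agrees with the phase times the pairing
sum only on nonempty sets. -/
theorem fullIntegrand_eq {m : ℕ} {s : Fin (m + 1) → ℝ} (hs : StrictMono s) :
    diffFactor V V' t (Finset.univ.image s) * chainTrace H (tensorOp ρs bath.state)
      (tensorOp Os 1) (tensorOp Ws 1) t si sf (Finset.univ.image s) =
    Complex.I ^ (m + 1) * fullIntegrand H bath Ws Os ρs
      (fun τ₁ τ₂ => V'.corr t τ₁ τ₂ - V.corr t τ₁ τ₂) t si sf (m + 1) s := by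
  rw [diffFactor, if_pos (Finset.univ_nonempty.image s), chainTrace, onFinset_image _ hs,
    contourPhase_image hs, ← sum_orderedPairings hs, fullIntegrand, fullChain,
    show corrDiff V V' t = fun τ₁ τ₂ => V'.corr t τ₁ τ₂ - V.corr t τ₁ τ₂ from rfl]
  ring

end Resummation

/-! ### The theorem -/

theorem mainTheorem2 {κ E F : Type*}
    [NormedAddCommGroup E] [InnerProductSpace ℂ E] [CompleteSpace E]
    [NormedAddCommGroup F] [InnerProductSpace ℂ F] [CompleteSpace F]
    -- the free system and the thermal bath
    (Hs : Hamiltonian E) (bath : ThermalBath κ F)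
    -- bounded system operators and the initial state of the system
    (Ws Os ρs : E →L[ℂ] E) (hWs : IsSelfAdjoint Ws) (hρs : IsDensity ρs)
    -- the original and the alternative bath coupling, and the total Hamiltonian of the original
    (V V' : BathCoupling bath) (H : Hamiltonian (HilbertTensor E F))
    (hH : IsTotalHamiltonian Hs V Ws H)
    (t : ℝ) (hV : V.Wick t) (hV' : V'.Wick t)
    (hB : V.BoundedCorr t) (hB' : V'.BoundedCorr t)
    -- the endpoints on the contour, for instance `si = 0` and `sf = 2t`
    (si sf : ℝ) (hsi : 0 ≤ si) (hsf : si ≤ sf) (hsum : si + sf = 2 * t) :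
    -- every integral and both series converge absolutely
    (∀ n : ℕ, MeasureTheory.IntegrableOn
      (systemIntegrand Hs Ws Os ρs (V.corr t) (V'.corr t) t si sf (2 * n))
      (timeSimplex (2 * n) si sf)) ∧
    (Summable fun n : ℕ => ∫ s in timeSimplex (2 * n) si sf,
      ‖systemIntegrand Hs Ws Os ρs (V.corr t) (V'.corr t) t si sf (2 * n) s‖) ∧
    (∀ n : ℕ, MeasureTheory.IntegrableOn
      (fullIntegrand H bath Ws Os ρs (fun τ₁ τ₂ => V'.corr t τ₁ τ₂ - V.corr t τ₁ τ₂)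
        t si sf (2 * (n + 1)))
      (timeSimplex (2 * (n + 1)) si sf)) ∧
    (Summable fun n : ℕ => ∫ s in timeSimplex (2 * (n + 1)) si sf,
      ‖fullIntegrand H bath Ws Os ρs (fun τ₁ τ₂ => V'.corr t τ₁ τ₂ - V.corr t τ₁ τ₂)
        t si sf (2 * (n + 1)) s‖) ∧
    -- and their sums agree
    ∑' n : ℕ, Complex.I ^ (2 * n) * ∫ s in timeSimplex (2 * n) si sf,
      systemIntegrand Hs Ws Os ρs (V.corr t) (V'.corr t) t si sf (2 * n) s =
    ∑' n : ℕ, Complex.I ^ (2 * (n + 1)) * ∫ s in timeSimplex (2 * (n + 1)) si sf,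
      fullIntegrand H bath Ws Os ρs (fun τ₁ τ₂ => V'.corr t τ₁ τ₂ - V.corr t τ₁ τ₂)
        t si sf (2 * (n + 1)) s := by
  have he : Function.Injective fun n : ℕ => 2 * n := fun a b h => by simpa using h
  have he' : Function.Injective fun n : ℕ => 2 * (n + 1) := fun a b h => by simpa using h
  suffices h : ∃ f g : Finset ℝ → ℂ,
      Integrable (fun c : Conf => f c.times) (timeMeasure si sf) ∧
      Integrable (fun c : Conf => g c.times) (timeMeasure si sf) ∧
      ∫ c : Conf, f c.times ∂timeMeasure si sf = ∫ c : Conf, g c.times ∂timeMeasure si sf ∧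
      (∀ n, ∀ s ∈ timeSimplex (2 * n) si sf, f (Finset.univ.image s) = Complex.I ^ (2 * n) *
        systemIntegrand Hs Ws Os ρs (V.corr t) (V'.corr t) t si sf (2 * n) s) ∧
      (∀ m, m ∉ Set.range (fun n : ℕ => 2 * n) → ∀ s ∈ timeSimplex m si sf,
        f (Finset.univ.image s) = 0) ∧
      (∀ n, ∀ s ∈ timeSimplex (2 * (n + 1)) si sf, g (Finset.univ.image s) =
        Complex.I ^ (2 * (n + 1)) * fullIntegrand H bath Ws Os ρs
          (fun τ₁ τ₂ => V'.corr t τ₁ τ₂ - V.corr t τ₁ τ₂) t si sf (2 * (n + 1)) s) ∧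
      (∀ m, m ∉ Set.range (fun n : ℕ => 2 * (n + 1)) → ∀ s ∈ timeSimplex m si sf,
        g (Finset.univ.image s) = 0) by
    obtain ⟨f, g, hf, hg, hfg, hf1, hf2, hg1, hg2⟩ := h
    obtain ⟨a1, a2, a3⟩ := hasSum_simplices hf he hf1 hf2
    obtain ⟨b1, b2, b3⟩ := hasSum_simplices hg he' hg1 hg2
    exact ⟨a1, a2, b1, b2, by rw [a3.tsum_eq, b3.tsum_eq, hfg]⟩
  rcases hsf.eq_or_lt with rfl | hlt
  -- For si = sf all simplices of positive dimension are empty. For m = 0 the only pairing is empty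
  -- and both weights are 1, so both sides vanish.
  · refine ⟨fun _ => 0, fun _ => 0, by simp, by simp, rfl, fun n s hs => ?_, fun _ _ _ _ => rfl,
      fun n s hs => ?_, fun _ _ _ _ => rfl⟩
    · rcases n with - | n
      · have : ∀ q ∈ orderedPairings (2 * 0), pairingWeight (V'.corr t) s q -
            pairingWeight (V.corr t) s q = 0 := by
          intro q _
          have hq : q = ∅ := Finset.eq_empty_of_forall_notMem fun p _ => p.1.elim0
          simp [hq, pairingWeight]
        simp [systemIntegrand, Finset.sum_eq_zero this]
      · exact absurd hs (notMem_timeSimplex le_rfl (by omega) s)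
    · exact absurd hs (notMem_timeSimplex le_rfl (by omega) s)
  · have hst : si < t := by linarith
    obtain ⟨ι, w, hι, hw, hρ⟩ := hρs.exists_decomposition
    have := hι.to_subtype
    obtain ⟨h1, h2, h3⟩ := resummation (Os := Os) hH hWs hV hV' hsi hst hsum hB hB' hw hρ
    have hcard : ∀ {m : ℕ} {s : Fin m → ℝ}, s ∈ timeSimplex m si sf →
        (Finset.univ.image s).card = m := fun hs => by
      rw [Finset.card_image_of_injective _ hs.1.injective, Finset.card_univ, Fintype.card_fin]
    refine ⟨fun C => contourPhase t C * chainTrace Hs ρs Os Ws t si sf C *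
      (pairSum (V'.corr t) C - pairSum (V.corr t) C),
      fun C => diffFactor V V' t C * chainTrace H (tensorOp ρs bath.state) (tensorOp Os 1)
        (tensorOp Ws 1) t si sf C, h1, h2, h3, fun n s hs => systemIntegrand_eq hs.1, ?_,
      fun n s hs => fullIntegrand_eq hs.1, ?_⟩
    · intro m hm s hs
      have hodd : ¬ Even (Finset.univ.image s).card := by
        rw [hcard hs]
        rintro ⟨n, rfl⟩
        exact hm ⟨n, two_mul n⟩
      dsimp only
      rw [pairSum_odd hodd, pairSum_odd hodd, sub_zero, mul_zero]
    · intro m hm s hs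
      rcases m with - | m
      · simp [diffFactor]
      · have hodd : ¬ Even (Finset.univ.image s).card := by
          rw [hcard hs]
          rintro ⟨n, hn⟩
          -- The right-hand series starts at two times, so the even number n + n has index n - 1;
          -- here n is positive because the number of times is a successor.
          exact hm ⟨n - 1, by dsimp only; omega⟩
        dsimp only
        rw [diffFactor, pairSum_odd hodd]
        simp

end
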